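/- Let $n\ge 1$, $N=\{1,\dots,n\}$ and $\mathbf N_0=\{\{i,j\};\ 0\le i<j\le n\}$, and let $\mathbb K$ be an algebraically closed field. Let $Q$ be the $n\times\binom{n+1}{2}$ matrix with columns $w_{0i}=e_i$ and $w_{jk}=e_j+e_k$ $(1\le j<k\le n)$, and let $P$ be a Gale dual matrix of $Q$, i.e. a $\binom n2\times\binom{n+1}2$ matrix whose rows form a basis of the null space of $Q$ over $\mathbb Q$ (in particular $PQ^t=0$); denote its columns by $v_\eta$, $\eta\in\mathbf N_0$. All cones are rational convex cones, $\tau^\circ$ is the relative interior of $\tau$, and $\preceq$ means "is a face of". Let $\overline Y\subseteq\bigwedge^2\mathbb K^{n+1}=\mathbb K^{\mathbf N_0}$ be the affine cone over the Grassmannian $\mathrm{Gr}(2,n+1)$ and $T=(\mathbb K^*)^{\mathbf N_0}$. A subset $J\subseteq\mathbf N_0$ is a $\overline Y$-set if some $y\in\overline Y$ satisfies $y_\eta\ne0\Leftrightarrow\eta\in J$. Put $\omega_I=\mathrm{cone}(w_\eta;\ \eta\in I)$ and $$\lambda_1=\Big\{x\in\mathbb Q^n_{\ge0};\ x_1\le\sum_{i\ne1}x_i,\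 \ x_1+x_j\ge\sum_{i\ne1,j}x_i\ \text{ for } j=2,\dots,n\Big\}.$$ Let $\Sigma_1$ be the (simplicial) fan consisting of the cones $\mathrm{cone}(v_\eta;\ \eta\in\mathbf N_0\setminus I)$, where $I\subseteq\mathbf N_0$ runs through the sets such that $\lambda_1^\circ\subseteq\omega_J^\circ\subseteq\omega_I^\circ$ for some $\overline Y$-set $J\subseteq I$. A true two-block partition $R$ of $N$ is a partition of $N$ into two blocks with at least two elements each; let $A_R$ be its block not containing $1$, and set $$\sigma_R=\mathrm{cone}(v_\eta;\ \eta\subseteq\{0\}\cup A_R),\qquad \nu_R=\mathrm{cone}\Big(\sum_{i\in A_R}v_{0i}+2\sum_{j<k\in A_R}v_{jk}\Big).$$ Order the rays $\nu_R$ by $\nu_R\le\nu_S:\Leftrightarrow\sigma_R\preceq\sigma_S$, choose any linear extension of this partial order, and let $\Sigma_r$ be the iterated stellar subdivision of $\Sigma_1$ in all the rays $\nu_R$, in descending order, beginning with the maximal one. Let $\Sigma=\mathrm{GKZ}(P)=\{\sigma(v);\ v\in\mathbb Q^{\binom n2}\}$, where $\sigma(v)$ is the intersection of all cones $\tau$ generated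 by some of the columns of $P$ with $v\in\tau^\circ$. Let $\Delta=P(\mathrm{Trop}(\overline Y\cap T))$, where $\mathrm{Trop}(\overline Y\cap T)\subseteq\mathbb Q^{\mathbf N_0}$ is the tropical variety (trivial valuation, minimum convention), i.e. the set of all $w$ such that for every nonzero polynomial vanishing on $\overline Y\cap T$ the minimal $w$-weight of its monomials is attained at least twice, and let $$\Sigma^\Delta=\{\sigma;\ \sigma\preceq\tau\ \text{for some}\ \tau\in\Sigma\ \text{with}\ \tau^\circ\cap\Delta\ne\emptyset\}$$ be the $\Delta$-reduction of $\Sigma$. Then $\Sigma^\Delta$ is a subfan of $\Sigma_r$: both are fans (finite collections of pointed polyhedral cones, closed under taking faces, any two of which intersect in a common face), and every cone of $\Sigma^\Delta$ is a cone of $\Sigma_r$. -/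

import Mathlib

namespace ConfigFan

section Cones

variable {V : Type*} [AddCommGroup V] [Module ℚ V] {ι : Type*}

/-- The relative interior of a convex set `C` in a rational vector space: the points `x` of `C` such
that every segment of `C` ending in `x` can be prolonged beyond `x` inside `C`. -/
def relint (C : Set V) : Set V :=
  {x | x ∈ C ∧ ∀ y ∈ C, ∃ ε : ℚ, 0 < ε ∧ x + ε • (x - y) ∈ C}

/-- The cone generated by the members `v j`, `j ∈ J`, of a family of vectors. -/
def cone (v : ι → V) (J : Set ι) : PointedCone ℚ V := PointedCone.hull ℚ (v '' J)

/-- A fan: a finite collection of pointed polyhedral cones that contains with each cone all its faces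
and in which any two cones intersect in a common face. -/
structure IsFan (F : Set (PointedCone ℚ V)) : Prop where
  finite : F.Finite
  polyhedral : ∀ σ ∈ F, σ.FG
  pointed : ∀ σ ∈ F, ∀ x ∈ σ, -x ∈ σ → x = 0
  face_mem : ∀ σ ∈ F, ∀ τ : PointedCone ℚ V, τ.IsFaceOf σ → τ ∈ F
  inter_face : ∀ σ ∈ F, ∀ τ ∈ F, (σ ⊓ τ).IsFaceOf σ ∧ (σ ⊓ τ).IsFaceOf τ

/-- `F` is a subfan of `G`. -/
structure IsSubfan (F G : Set (PointedCone ℚ V)) : Prop where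
  isFan_left : IsFan F
  isFan_right : IsFan G
  subset : F ⊆ G

/-- The stellar subdivision of a fan `F` in a ray `ν`: the cones of `F` that do not contain `ν`,
together with all `τ + ν`, where `τ` is a face not containing `ν` of a cone of `F` containing `ν`. -/
def stellar (F : Set (PointedCone ℚ V)) (ν : PointedCone ℚ V) : Set (PointedCone ℚ V) :=
  {σ | σ ∈ F ∧ ¬ ν ≤ σ} ∪
    {ρ | ∃ σ ∈ F, ν ≤ σ ∧ ∃ τ : PointedCone ℚ V, τ.IsFaceOf σ ∧ ¬ ν ≤ τ ∧ ρ = τ ⊔ ν}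

/-- The cone `σ(x)`: the intersection of all cones `τ` that are generated by some of the vectors `v i`
and contain `x` in their relative interior. -/
def gkzCone (v : ι → V) (x : V) : PointedCone ℚ V :=
  sInf {τ | ∃ J : Set ι, τ = cone v J ∧ x ∈ relint (τ : Set V)}

/-- The Gelfand-Kapranov-Zelevinsky decomposition of a vector configuration. -/
def gkzFan (v : ι → V) : Set (PointedCone ℚ V) := Set.range (gkzCone v)

/-- The `Δ`-reduction of a fan: all faces of those cones whose relative interior meets `Δ`. -/
def deltaReduction (F : Set (PointedCone ℚ V)) (Δ : Set V) : Set (PointedCone ℚ V) :=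
  {σ | ∃ τ ∈ F, σ.IsFaceOf τ ∧ (relint (τ : Set V) ∩ Δ).Nonempty}

end Cones

/-- `P` is Gale dual to `Q`: the rows of `P` form a basis of the null space of `Q`. In particular
`P * Qᵀ = 0`. -/
def IsGaleDual {κ ι ρ : Type*} [Fintype ι] (Q : Matrix κ ι ℚ) (P : Matrix ρ ι ℚ) : Prop :=
  LinearIndependent ℚ P.row ∧ Submodule.span ℚ (Set.range P.row) = LinearMap.ker Q.mulVecLin

section Varieties

variable {K : Type*} [Field K] {ι : Type*}

/-- The dense torus of the affine space with coordinates indexed by `ι`. -/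
def torus (K : Type*) [Field K] (ι : Type*) : Set (ι → K) := {z | ∀ i, z i ≠ 0}

/-- A `Y`-set: an index set `I` whose stratum `{y ∈ Y | y i ≠ 0 ↔ i ∈ I}` is not empty. -/
def IsYSet (Y : Set (ι → K)) (I : Set ι) : Prop := ∃ y ∈ Y, ∀ i, y i ≠ 0 ↔ i ∈ I

/-- The tropical variety (for the trivial valuation, with the minimum convention) of a subset `Z` of
the torus: the weights `w` such that for no polynomial `f` vanishing on `Z` the minimal `w`-weight of
the monomials of `f` is attained only once. Monomials are invertible on the torus, so polynomials may
be used instead of Laurent polynomials. -/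
def tropicalVariety [Fintype ι] (Z : Set (ι → K)) : Set (ι → ℚ) :=
  {w | ∀ f : MvPolynomial ι K, (∀ z ∈ Z, MvPolynomial.eval z f = 0) →
    ∀ a ∈ f.support, (∀ b ∈ f.support, ∑ i, (a i : ℚ) * w i ≤ ∑ i, (b i : ℚ) * w i) →
      ∃ b ∈ f.support, b ≠ a ∧ ∑ i, (b i : ℚ) * w i = ∑ i, (a i : ℚ) * w i}

end Varieties

/-- The set `N = {1, …, n}`, inside `{0, …, n}`. -/
abbrev N (n : ℕ) : Type := {i : Fin (n + 1) // i ≠ 0}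

/-- The set `𝐍₀` of pairs `{i, j}` with `0 ≤ i < j ≤ n`. -/
abbrev Pair (n : ℕ) : Type := {p : Fin (n + 1) × Fin (n + 1) // p.1 < p.2}

/-- The two elements of a pair. -/
def Pair.elems {n : ℕ} (η : Pair n) : Finset (Fin (n + 1)) := {η.1.1, η.1.2}

/-- The pair `{0, i}` for `i ∈ N`. -/
def zeroPair {n : ℕ} (i : N n) : Pair n := ⟨(0, i.1), Fin.pos_of_ne_zero i.2⟩

/-- The affine cone over the Grassmannian `Gr(2, n + 1)`: the decomposable bivectors `x ∧ y` in
`⋀² K^(n+1)`, in the coordinates belonging to the basis `e_i ∧ e_j`, `i < j`. -/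
def grassmannCone (K : Type*) [Field K] (n : ℕ) : Set (Pair n → K) :=
  {z | ∃ x y : Fin (n + 1) → K, ∀ η : Pair n, z η = x η.1.1 * y η.1.2 - x η.1.2 * y η.1.1}

/-- The weight matrix `Q = (E_n, D_n)`, with columns `w_{0i} = e_i` and `w_{jk} = e_j + e_k`. -/
def weightMatrix (n : ℕ) : Matrix (N n) (Pair n) ℚ :=
  Matrix.of fun i η => if i.1 ∈ η.elems then 1 else 0

/-- The cone `ω_I` generated by the weights `w_η`, `η ∈ I`. -/
def omega {n : ℕ} (I : Set (Pair n)) : PointedCone ℚ (N n → ℚ) := cone (weightMatrix n).col I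

/-- The linear form `f_1`. -/
def formOne {n : ℕ} (x : N n → ℚ) : ℚ := ∑ i : N n, if i.1 = 1 then x i else -x i

/-- The linear form `f_{1j}`. -/
def formOnePair {n : ℕ} (j : N n) (x : N n → ℚ) : ℚ :=
  ∑ i : N n, if i.1 = 1 ∨ i = j then x i else -x i

/-- The chamber `λ_1` in the positive orthant. -/
def lambdaOne (n : ℕ) : Set (N n → ℚ) :=
  {x | (∀ i, 0 ≤ x i) ∧ formOne x ≤ 0 ∧ ∀ j : N n, j.1 ≠ 1 → 0 ≤ formOnePair j x}

/-- The enveloping sets of `λ_1`, with respect to the cone over the Grassmannian. -/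
def envelopingSets (K : Type*) [Field K] (n : ℕ) : Set (Set (Pair n)) :=
  {I | ∃ J ⊆ I, IsYSet (grassmannCone K n) J ∧
    relint (lambdaOne n) ⊆ relint (omega J : Set (N n → ℚ)) ∧
    relint (omega J : Set (N n → ℚ)) ⊆ relint (omega I : Set (N n → ℚ))}

/-- The true two-block partitions of `N`: two blocks with at least two elements each. -/
abbrev TrueTwoBlock (n : ℕ) : Type :=
  {R : Finpartition (Finset.univ : Finset (N n)) // R.parts.card = 2 ∧ ∀ A ∈ R.parts, 2 ≤ A.card}

/-- The block `A_R` of a two-block partition `R` that does not contain `1`. -/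
def TrueTwoBlock.block {n : ℕ} (R : TrueTwoBlock n) : Finset (N n) :=
  (R.1.parts.filter fun A => ∀ i ∈ A, i.1 ≠ 1).sup id

section Fans

variable {n m : ℕ}

/-- The fan `Σ_1`; the vectors `v_η` are the columns of `P`. -/
def sigmaOne (K : Type*) [Field K] (P : Matrix (Fin m) (Pair n) ℚ) :
    Set (PointedCone ℚ (Fin m → ℚ)) :=
  {σ | ∃ I ∈ envelopingSets K n, σ = cone P.col Iᶜ}

/-- The cone `σ_R` generated by the `v_η` with `η ⊆ {0} ∪ A_R`. -/
def blockCone (P : Matrix (Fin m) (Pair n) ℚ) (R : TrueTwoBlock n) : PointedCone ℚ (Fin m → ℚ) :=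
  cone P.col {η | η.elems ⊆ insert 0 (R.block.image Subtype.val)}

/-- The ray `ν_R` generated by the sum of all `v_{0i}`, `i ∈ A_R`, and twice the sum of all `v_{jk}`,
`j < k` in `A_R`. -/
def nuRay (P : Matrix (Fin m) (Pair n) ℚ) (R : TrueTwoBlock n) : PointedCone ℚ (Fin m → ℚ) :=
  PointedCone.hull ℚ {∑ i ∈ R.block, P.col (zeroPair i) +
    (2 : ℚ) • ∑ η : Pair n with η.elems ⊆ R.block.image Subtype.val, P.col η}

/-- The list `L` enumerates all true two-block partitions in the descending order of some linear
extension of the partial order `ν_R ≤ ν_S :↔ σ_R ⪯ σ_S`. -/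
structure IsDescending (P : Matrix (Fin m) (Pair n) ℚ) (L : List (TrueTwoBlock n)) : Prop where
  nodup : L.Nodup
  complete : ∀ R, R ∈ L
  descending : L.Pairwise fun R S => ¬ (blockCone P R).IsFaceOf (blockCone P S)

/-- The fan `Σ_r`: the iterated stellar subdivision of `Σ_1` in the rays `ν_R`, in the order given by
the list. -/
def sigmaR (K : Type*) [Field K] (P : Matrix (Fin m) (Pair n) ℚ) (L : List (TrueTwoBlock n)) :
    Set (PointedCone ℚ (Fin m → ℚ)) :=
  L.foldl (fun F R => stellar F (nuRay P R)) (sigmaOne K P)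

/-- The set `Δ`: the image under `P` of the tropical variety of the torus part of the cone over the
Grassmannian. -/
def tropicalImage (K : Type*) [Field K] (P : Matrix (Fin m) (Pair n) ℚ) : Set (Fin m → ℚ) :=
  P.mulVec '' tropicalVariety (grassmannCone K n ∩ torus K (Pair n))

end Fans

end ConfigFan

/-!
The proof rests on a description of `Σ^Δ` by trees and on a combinatorial handling of stellar
subdivisions.

By Gale duality, a vector of the target space is `vec P f = ∑ f η • v_η`, where `f` is unique up
to adding a potential `u i + u j` with `u 0 = 0` (`vec_eq_vec_iff`); in particular `f` can be
chosen to vanish at the pairs containing `0`. If the vector lies in `Δ`, the Plücker relations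
between coordinates with indices in `{0, a, b, c}` show that this choice is an ultrametric `h`, in
the sense that the minimum of `h` on any triple in `{1, …, n}` is attained twice
(`exists_isUltra_of_mem_tropicalImage`). Such an `h` is a rooted tree. Its branches below height
`0` are the clusters: the sets `C` such that the values of `h` across `C` are negative and smaller
than those inside `C`.

The cone `σ(vec P h)` is the intersection of all cones spanned by some of the `v_η` that contain
`vec P h` in their relative interior; by linear programming duality and complementary slackness,
cones `σ(x)` and `σ(z)` agree if `x` lies in the relative interior of `σ(z)`
(`gkzCone_eq_of_mem_relint`). So only the cones of ultrametrics matter. Each of them is spanned by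
the `v_{ij}` with `h i j > 0` and by the split vectors of the clusters (`IsUltra.gkzCone_eq`); a
split vector is a `v_{0i}` or the generator of a ray `ν_R`. That these vectors span the cone
follows by telescoping along the branches of the tree: each node of the tree provides a cone
around `vec P h`, and thereby a potential for each point of `σ(vec P h)`; the potentials of a
cluster and of its parent differ by a nonnegative constant on the cluster
(`IsUltra.exists_cut_decomposition`).

The fan `Σ_1` is simplicial: the generators of each of its cones are the members of an abstract
simplicial complex, and nonnegative combinations of the members of a simplex are unique
(`IsSimplicial`, `isSimplicial_envelopingSets`). Stellar subdivision in the interior of a simplex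
preserves this, and acts on the complex by replacing the star of the simplex
(`IsSimplicial.foldl_stellar`). A set of vertices survives all subdivisions if it becomes a
simplex of `Σ_1` after replacing each `ν_R` by the generators of `σ_R`, and if it does not contain
the generators of any `σ_R`, even after replacing the `ν_S` with `σ_R` not a face of `σ_S`
(`mem_foldl_stellarComplex`). For the generators of the cone of an ultrametric, both conditions
follow from the fact that the blocks of its clusters are nested or disjoint
(`IsUltra.mem_envelopingSets`, `IsUltra.exists_mem_carrier`).
-/

open Filter Topology

namespace ConfigFan

/-! ### Cones generated by finitely many vectors -/

section FiniteCones

variable {V : Type*} [AddCommGroup V] [Module ℚ V] {ι : Type*}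

theorem cone_mono {v : ι → V} {J J' : Set ι} (h : J ⊆ J') : cone v J ≤ cone v J' :=
  Submodule.span_mono (Set.image_mono h)

theorem mem_cone {v : ι → V} {J : Set ι} {i : ι} (h : i ∈ J) : v i ∈ cone v J :=
  Submodule.subset_span ⟨i, h, rfl⟩

theorem exists_pos_forall_pos_add_mul {ι : Type*} [Finite ι] (s : Set ι) (c d : ι → ℚ)
    (h : ∀ i ∈ s, 0 < c i) : ∃ ε : ℚ, 0 < ε ∧ ∀ i ∈ s, 0 < c i + ε * d i := by
  have h1 : ∀ i, ∀ᶠ ε in 𝓝[>] (0 : ℚ), i ∈ s → 0 < c i + ε * d i := by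
    intro i
    by_cases hi : i ∈ s
    · have h2 : Tendsto (fun ε : ℚ => c i + ε * d i) (𝓝[>] 0) (𝓝 (c i + 0 * d i)) := by
        apply Tendsto.mono_left _ nhdsWithin_le_nhds
        exact Continuous.tendsto (by fun_prop) 0
      rw [zero_mul, add_zero] at h2
      filter_upwards [h2.eventually (lt_mem_nhds (h i hi))] with ε hε _ using hε
    · exact Eventually.of_forall fun ε hε => absurd hε hi
  obtain ⟨ε, h3, h4⟩ := ((eventually_all.2 h1).and self_mem_nhdsWithin).exists
  exact ⟨ε, h4, h3⟩

variable [Fintype ι] {v : ι → V} {J : Set ι} {x : V}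

theorem mem_cone_iff : x ∈ cone v J ↔
    ∃ c : ι → ℚ, (∀ i, 0 ≤ c i) ∧ (∀ i ∉ J, c i = 0) ∧ ∑ i, c i • v i = x := by
  classical
  constructor
  · intro hx
    induction hx using Submodule.span_induction with
    | mem x hx =>
      obtain ⟨i, hi, rfl⟩ := hx
      refine ⟨Pi.single i 1, fun j => ?_, fun j hj => ?_, ?_⟩
      · by_cases h : j = i
        · subst h; simp
        · simp [h]
      · exact Pi.single_eq_of_ne (by rintro rfl; exact hj hi) _
      · simp [Pi.single_apply]
    | zero => exact ⟨0, by simp, by simp, by simp⟩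
    | add x y _ _ hx hy =>
      obtain ⟨c, h1, h2, rfl⟩ := hx
      obtain ⟨d, h3, h4, rfl⟩ := hy
      exact ⟨c + d, fun i => add_nonneg (h1 i) (h3 i), fun i hi => by simp [h2 i hi, h4 i hi],
        by simp [add_smul, Finset.sum_add_distrib]⟩
    | smul a x _ hx =>
      obtain ⟨c, h1, h2, rfl⟩ := hx
      refine ⟨fun i => a.1 * c i, fun i => mul_nonneg a.2 (h1 i), fun i hi => by simp [h2 i hi], ?_⟩
      rw [Finset.smul_sum]
      exact Finset.sum_congr rfl fun i _ => by rw [mul_smul]; rfl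
  · rintro ⟨c, h1, h2, rfl⟩
    refine Submodule.sum_mem _ fun i _ => ?_
    by_cases hi : i ∈ J
    · exact PointedCone.smul_mem _ (h1 i) (mem_cone hi)
    · simp [h2 i hi]

/-- The relative interior of a finitely generated cone consists of the combinations of all
generators with positive coefficients. -/
theorem mem_relint_cone_iff : x ∈ relint (cone v J : Set V) ↔
    ∃ c : ι → ℚ, (∀ i ∈ J, 0 < c i) ∧ (∀ i ∉ J, c i = 0) ∧ ∑ i, c i • v i = x := by
  classical
  constructor
  · rintro ⟨-, hx⟩
    -- prolong the segment from the sum of all generators to `x`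
    obtain ⟨ε, hε, h⟩ := hx (∑ i, (if i ∈ J then (1 : ℚ) else 0) • v i)
      (mem_cone_iff.2 ⟨_, fun i => by split_ifs <;> norm_num, fun i hi => by simp [hi], rfl⟩)
    obtain ⟨c, h1, h2, h3⟩ := mem_cone_iff.1 h
    have h4 : (0 : ℚ) < 1 + ε := by linarith
    refine ⟨fun i => (1 + ε)⁻¹ * (c i + ε * if i ∈ J then 1 else 0), fun i hi => ?_, fun i hi => ?_,
      ?_⟩
    · have := h1 i
      simp only [hi, if_true]
      positivity
    · simp [h2 i hi, hi]
    · simp only [mul_smul, ← Finset.smul_sum, add_smul, Finset.sum_add_distrib]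
      rw [h3, inv_smul_eq_iff₀ h4.ne']
      module
  · rintro ⟨c, h1, h2, rfl⟩
    refine ⟨mem_cone_iff.2 ⟨c, fun i => ?_, h2, rfl⟩, fun y hy => ?_⟩
    · by_cases hi : i ∈ J
      · exact (h1 i hi).le
      · exact (h2 i hi).ge
    · obtain ⟨d, h3, h4, rfl⟩ := mem_cone_iff.1 hy
      obtain ⟨ε, hε, h5⟩ := exists_pos_forall_pos_add_mul J c (fun i => c i - d i) h1
      refine ⟨ε, hε, mem_cone_iff.2 ⟨fun i => c i + ε * (c i - d i), fun i => ?_, fun i hi => ?_,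
        ?_⟩⟩
      · by_cases hi : i ∈ J
        · exact (h5 i hi).le
        · simp [h2 i hi, h4 i hi]
      · simp [h2 i hi, h4 i hi]
      · simp only [add_smul, mul_smul, sub_smul, Finset.sum_add_distrib, ← Finset.smul_sum,
          Finset.sum_sub_distrib]

end FiniteCones

/-! ### Simplicial fans and their stellar subdivisions -/

section Simplicial

variable {V : Type*} [AddCommGroup V] [Module ℚ V] {E : Type*}

/-- The cones spanned by the members of a collection `𝒮` of index sets. -/
def fanOf (r : E → V) (𝒮 : Set (Set E)) : Set (PointedCone ℚ V) := {σ | ∃ S ∈ 𝒮, σ = cone r S}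

variable [Fintype E]

/-- The collection `𝒮` is an abstract simplicial complex that the vectors `r` realize as a
simplicial fan: a vector has at most one expression as a combination with nonnegative coefficients
of the vectors that belong to some simplex. -/
structure IsSimplicial (r : E → V) (𝒮 : Set (Set E)) : Prop where
  mono : ∀ S ∈ 𝒮, ∀ T ⊆ S, T ∈ 𝒮
  unique : ∀ S ∈ 𝒮, ∀ T ∈ 𝒮, ∀ a b : E → ℚ, (∀ i, 0 ≤ a i) → (∀ i ∉ S, a i = 0) →
    (∀ i, 0 ≤ b i) → (∀ i ∉ T, b i = 0) → ∑ i, a i • r i = ∑ i, b i • r i → a = b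

theorem exists_eq_cone_of_isFaceOf {r : E → V} {S : Set E} {F : PointedCone ℚ V}
    (hF : F.IsFaceOf (cone r S)) : ∃ T ⊆ S, F = cone r T := by
  classical
  refine ⟨{i | i ∈ S ∧ r i ∈ F}, fun i hi => hi.1, le_antisymm (fun x hx => ?_) ?_⟩
  · obtain ⟨a, ha, ha', rfl⟩ := mem_cone_iff.1 (hF.le hx)
    refine mem_cone_iff.2 ⟨a, ha, fun i hi => ?_, rfl⟩
    by_contra hne
    have hiS : i ∈ S := by by_contra hc; exact hne (ha' i hc)
    have h1 := hF.mem_of_sum_smul_mem (f := fun i => if i ∈ S then r i else 0) (c := a)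
      (fun i => ?_) ha ?_ i (lt_of_le_of_ne (ha i) (Ne.symm hne))
    · simp only [hiS, if_true] at h1
      exact hi ⟨hiS, h1⟩
    · split_ifs with hi
      · exact mem_cone hi
      · exact Submodule.zero_mem _
    · convert hx using 1
      refine Finset.sum_congr rfl fun i _ => ?_
      by_cases hi : i ∈ S
      · simp [hi]
      · simp [ha' i hi]
  · refine Submodule.span_le.2 ?_
    rintro _ ⟨i, hi, rfl⟩
    exact hi.2

namespace IsSimplicial

variable {r : E → V} {𝒮 : Set (Set E)} (h : IsSimplicial r 𝒮) {S T : Set E}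
include h

theorem isFaceOf_cone (hS : S ∈ 𝒮) (hT : T ⊆ S) : (cone r T).IsFaceOf (cone r S) := by
  refine ⟨cone_mono hT, fun {x y t} hx hy ht hxy => ?_⟩
  obtain ⟨a, ha, ha', rfl⟩ := mem_cone_iff.1 hx
  obtain ⟨b, hb, hb', rfl⟩ := mem_cone_iff.1 hy
  obtain ⟨d, hd, hd', hd''⟩ := mem_cone_iff.1 hxy
  have key : d = fun i => t * a i + b i := by
    refine h.unique T (h.mono S hS T hT) S hS _ _ hd hd' (fun i => ?_) (fun i hi => ?_) ?_
    · have := ha i; have := hb i; positivity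
    · simp [ha' i hi, hb' i hi]
    · rw [hd'']
      simp [add_smul, mul_smul, Finset.sum_add_distrib, Finset.smul_sum]
  refine mem_cone_iff.2 ⟨a, ha, fun i hi => ?_, rfl⟩
  have h1 := congrFun key i
  rw [hd' i hi] at h1
  have h2 := mul_nonneg ht.le (ha i)
  have h3 := hb i
  have h4 : t * a i = 0 := by linarith
  exact (mul_eq_zero.1 h4).resolve_left ht.ne'

theorem cone_inf_cone (hS : S ∈ 𝒮) (hT : T ∈ 𝒮) : cone r S ⊓ cone r T = cone r (S ∩ T) := by
  refine le_antisymm (fun x hx => ?_) (le_inf (cone_mono Set.inter_subset_left)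
    (cone_mono Set.inter_subset_right))
  obtain ⟨a, ha, ha', rfl⟩ := mem_cone_iff.1 hx.1
  obtain ⟨b, hb, hb', hab⟩ := mem_cone_iff.1 hx.2
  have := h.unique S hS T hT a b ha ha' hb hb' hab.symm
  subst this
  refine mem_cone_iff.2 ⟨a, ha, fun i hi => ?_, rfl⟩
  by_cases hi' : i ∈ S
  · exact hb' i fun hiT => hi ⟨hi', hiT⟩
  · exact ha' i hi'

theorem isFan : IsFan (fanOf r 𝒮) where
  finite := by
    have : fanOf r 𝒮 ⊆ Set.range (cone r) := by
      rintro _ ⟨S, -, rfl⟩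
      exact ⟨S, rfl⟩
    exact (Set.finite_range _).subset this
  polyhedral := by
    rintro _ ⟨S, -, rfl⟩
    exact Submodule.fg_span (Set.toFinite _)
  pointed := by
    rintro _ ⟨S, hS, rfl⟩ x hx hx'
    obtain ⟨a, ha, ha', rfl⟩ := mem_cone_iff.1 hx
    obtain ⟨b, hb, hb', hab⟩ := mem_cone_iff.1 hx'
    have h1 : a + b = 0 := by
      refine h.unique S hS S hS _ _ (fun i => add_nonneg (ha i) (hb i)) (fun i hi => ?_)
        (fun i => le_rfl) (fun i _ => rfl) ?_
      · simp [ha' i hi, hb' i hi]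
      · simp [add_smul, Finset.sum_add_distrib, hab]
    refine Finset.sum_eq_zero fun i _ => ?_
    have h2 := congrFun h1 i
    have h3 := ha i
    have h4 := hb i
    simp only [Pi.add_apply, Pi.zero_apply] at h2
    have h5 : a i = 0 := by linarith
    simp [h5]
  face_mem := by
    rintro _ ⟨S, hS, rfl⟩ τ hτ
    obtain ⟨T, hT, rfl⟩ := exists_eq_cone_of_isFaceOf hτ
    exact ⟨T, h.mono S hS T hT, rfl⟩
  inter_face := by
    rintro _ ⟨S, hS, rfl⟩ _ ⟨T, hT, rfl⟩
    rw [h.cone_inf_cone hS hT]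
    exact ⟨h.isFaceOf_cone hS Set.inter_subset_left, h.isFaceOf_cone hT Set.inter_subset_right⟩

end IsSimplicial

omit [Fintype E] in
/-- The stellar subdivision of a simplicial complex in a new vertex `e` that is placed in the
interior of the simplex `T`. -/
def stellarComplex (𝒮 : Set (Set E)) (T : Set E) (e : E) : Set (Set E) :=
  {S | ¬ T ⊆ S ∧ (e ∉ S ∧ S ∈ 𝒮 ∨ e ∈ S ∧ S \ {e} ∪ T ∈ 𝒮)}

omit [Fintype E] in
theorem stellarComplex_mono {𝒮 : Set (Set E)} (h : ∀ S ∈ 𝒮, ∀ S' ⊆ S, S' ∈ 𝒮) {T : Set E} {e : E} :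
    ∀ S ∈ stellarComplex 𝒮 T e, ∀ S' ⊆ S, S' ∈ stellarComplex 𝒮 T e := by
  rintro S ⟨hTS, hS⟩ S' hS'
  refine ⟨fun hc => hTS (hc.trans hS'), ?_⟩
  by_cases he' : e ∈ S'
  · rcases hS with ⟨h1, -⟩ | ⟨-, h1⟩
    · exact absurd (hS' he') h1
    · exact Or.inr ⟨he', h _ h1 _ (Set.union_subset_union_left _
        (Set.sdiff_subset_sdiff_left hS'))⟩
  · refine Or.inl ⟨he', ?_⟩
    rcases hS with ⟨-, h1⟩ | ⟨-, h1⟩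
    · exact h _ h1 _ hS'
    · refine h _ h1 _ fun i hi => Or.inl ⟨hS' hi, ?_⟩
      rintro rfl
      exact he' hi

theorem IsSimplicial.stellarComplex {r : E → V} {𝒮 : Set (Set E)} (h : IsSimplicial r 𝒮)
    {T : Set E} {e : E} (hT : T ∈ 𝒮) (he : ∀ S ∈ 𝒮, e ∉ S) {p : E → ℚ} (hp : ∀ i ∈ T, 0 < p i)
    (hp' : ∀ i ∉ T, p i = 0) (hr : r e = ∑ i, p i • r i) :
    IsSimplicial r (stellarComplex 𝒮 T e) := by
  classical
  have hpe : p e = 0 := hp' e (he T hT)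
  have hp0 : ∀ i, 0 ≤ p i := fun i => by
    by_cases hi : i ∈ T
    · exact (hp i hi).le
    · exact (hp' i hi).ge
  refine ⟨stellarComplex_mono h.mono, ?_⟩
  -- substituting `∑ p i • r i` for `r e` turns both expressions into expressions over `𝒮`
  have push : ∀ S ∈ ConfigFan.stellarComplex 𝒮 T e, ∀ a : E → ℚ, (∀ i, 0 ≤ a i) →
      (∀ i ∉ S, a i = 0) → ∃ S₁ ∈ 𝒮, ∀ i ∉ S₁, (if i = e then 0 else a i + a e * p i) = 0 := by
    rintro S ⟨hTS, ⟨heS, hS⟩ | ⟨heS, hS⟩⟩ a ha ha'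
    · refine ⟨S, hS, fun i hi => ?_⟩
      simp [ha' e heS, ha' i hi]
    · refine ⟨_, hS, fun i hi => ?_⟩
      split_ifs with hie
      · rfl
      · have h1 : i ∉ S := fun hc => hi (Or.inl ⟨hc, hie⟩)
        have h2 : i ∉ T := fun hc => hi (Or.inr hc)
        simp [ha' i h1, hp' i h2]
  have sum_push : ∀ a : E → ℚ,
      ∑ i, (if i = e then 0 else a i + a e * p i) • r i = ∑ i, a i • r i := by
    intro a
    have h1 : ∀ i, (if i = e then 0 else a i + a e * p i) • r i
        = a i • r i + a e • (p i • r i) - if i = e then a e • r e else 0 := by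
      intro i
      split_ifs with hie
      · subst hie
        simp [hpe]
      · rw [add_smul, mul_smul, sub_zero]
    simp only [h1, Finset.sum_sub_distrib, Finset.sum_add_distrib, ← Finset.smul_sum, ← hr]
    simp
  intro S hS S' hS' a b ha ha' hb hb' hab
  obtain ⟨S₁, hS₁, h1⟩ := push S hS a ha ha'
  obtain ⟨S₂, hS₂, h2⟩ := push S' hS' b hb hb'
  have nonneg : ∀ a : E → ℚ, (∀ i, 0 ≤ a i) → ∀ i, 0 ≤ if i = e then 0 else a i + a e * p i := by
    intro a ha i
    have h1 := ha i
    have h2 := ha e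
    have h3 := hp0 i
    split_ifs
    · exact le_rfl
    · positivity
  have key := h.unique S₁ hS₁ S₂ hS₂ _ _ (nonneg a ha) h1 (nonneg b hb) h2
    (by rw [sum_push, sum_push, hab])
  have key' : ∀ i, i ≠ e → a i + a e * p i = b i + b e * p i := by
    intro i hi
    simpa [hi] using congrFun key i
  -- as `T` is not contained in a simplex, the coefficient of `r e` is a minimum over `T`
  have le : ∀ S ∈ ConfigFan.stellarComplex 𝒮 T e, ∀ a b : E → ℚ, (∀ i ∉ S, a i = 0) →
      (∀ i, 0 ≤ b i) → (∀ i, i ≠ e → a i + a e * p i = b i + b e * p i) → b e ≤ a e := by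
    intro S hS a b ha' hb hab
    obtain ⟨t, htT, htS⟩ := Set.not_subset.1 hS.1
    have hte : t ≠ e := by rintro rfl; exact he T hT htT
    have h1 := hab t hte
    rw [ha' t htS, zero_add] at h1
    have h2 := hb t
    have h3 : b e * p t ≤ a e * p t := by linarith
    exact le_of_mul_le_mul_right h3 (hp t htT)
  have hee : a e = b e := le_antisymm
    (le S' hS' b a hb' ha fun i hi => (key' i hi).symm) (le S hS a b ha' hb key')
  funext i
  by_cases hi : i = e
  · rw [hi, hee]
  · have := key' i hi
    rw [hee] at this
    linarith

theorem IsSimplicial.stellar_fanOf {r : E → V} {𝒮 : Set (Set E)} (h : IsSimplicial r 𝒮)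
    {T : Set E} {e : E} (hT : T ∈ 𝒮) (he : ∀ S ∈ 𝒮, e ∉ S) {p : E → ℚ} (hp : ∀ i ∈ T, 0 < p i)
    (hp' : ∀ i ∉ T, p i = 0) (hr : r e = ∑ i, p i • r i) :
    stellar (fanOf r 𝒮) (PointedCone.hull ℚ {r e}) = fanOf r (ConfigFan.stellarComplex 𝒮 T e) := by
  have hp0 : ∀ i, 0 ≤ p i := fun i => by
    by_cases hi : i ∈ T
    · exact (hp i hi).le
    · exact (hp' i hi).ge
  have ray_le : ∀ S ∈ 𝒮, (PointedCone.hull ℚ {r e} ≤ cone r S ↔ T ⊆ S) := by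
    intro S hS
    have h1 : PointedCone.hull ℚ {r e} ≤ cone r S ↔ r e ∈ cone r S :=
      Submodule.span_singleton_le_iff_mem _ _
    rw [h1]
    constructor
    · intro h2 i hi
      obtain ⟨a, ha, ha', h3⟩ := mem_cone_iff.1 h2
      have h4 := h.unique S hS T hT a p ha ha' hp0 hp' (by rw [h3, hr])
      by_contra hc
      have := hp i hi
      rw [← h4, ha' i hc] at this
      exact this.false
    · intro h2
      exact mem_cone_iff.2 ⟨p, hp0, fun i hi => hp' i fun hc => hi (h2 hc), hr.symm⟩
  have sup_ray : ∀ S : Set E, cone r S ⊔ PointedCone.hull ℚ {r e} = cone r (insert e S) := by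
    intro S
    rw [cone, cone, Set.image_insert_eq, Set.insert_eq, Set.union_comm]
    exact (Submodule.span_union _ _).symm
  ext σ
  constructor
  · rintro (⟨⟨S, hS, rfl⟩, h1⟩ | ⟨_, ⟨S, hS, rfl⟩, h1, τ, hτ, h2, rfl⟩)
    · rw [ray_le S hS] at h1
      exact ⟨S, ⟨h1, Or.inl ⟨he S hS, hS⟩⟩, rfl⟩
    · obtain ⟨S', hS', rfl⟩ := exists_eq_cone_of_isFaceOf hτ
      have hS'' := h.mono S hS S' hS'
      rw [ray_le S hS] at h1
      rw [ray_le S' hS''] at h2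
      refine ⟨insert e S', ⟨fun hc => h2 fun i hi => ?_, Or.inr ⟨Set.mem_insert _ _, ?_⟩⟩,
        sup_ray S'⟩
      · refine (hc hi).resolve_left ?_
        rintro rfl
        exact he T hT hi
      · refine h.mono S hS _ (Set.union_subset ?_ h1)
        rintro i ⟨hi, hie⟩
        exact hS' (hi.resolve_left hie)
  · rintro ⟨S, ⟨hTS, ⟨heS, hS⟩ | ⟨heS, hS⟩⟩, rfl⟩
    · exact Or.inl ⟨⟨S, hS, rfl⟩, by rwa [ray_le S hS]⟩
    · have h1 : S \ {e} ∈ 𝒮 := h.mono _ hS _ Set.subset_union_left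
      refine Or.inr ⟨_, ⟨_, hS, rfl⟩, (ray_le _ hS).2 Set.subset_union_right, cone r (S \ {e}),
        h.isFaceOf_cone hS Set.subset_union_left, ?_, ?_⟩
      · rw [ray_le _ h1]
        exact fun hc => hTS (hc.trans Set.sdiff_subset)
      · rw [sup_ray, Set.insert_sdiff_singleton, Set.insert_eq_of_mem heS]

/-- Iterated stellar subdivision of a simplicial fan. The subdivisions do not interfere with each
other's centres if no simplex `T i` contains an earlier one. -/
theorem IsSimplicial.foldl_stellar {I : Type*} {r : E → V} {T : I → Set E} {e : I → E}
    (he : Function.Injective e) (p : I → E → ℚ) (hp : ∀ i, ∀ j ∈ T i, 0 < p i j)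
    (hp' : ∀ i, ∀ j ∉ T i, p i j = 0) (hr : ∀ i, r (e i) = ∑ j, p i j • r j)
    (L : List I) (hL : L.Nodup) (hL' : L.Pairwise fun i j => ¬ T i ⊆ T j) :
    ∀ 𝒮 : Set (Set E), IsSimplicial r 𝒮 → (∀ i ∈ L, T i ∈ 𝒮) → (∀ i ∈ L, ∀ S ∈ 𝒮, e i ∉ S) →
      IsSimplicial r (L.foldl (fun 𝒮 i => ConfigFan.stellarComplex 𝒮 (T i) (e i)) 𝒮) ∧
      L.foldl (fun F i => stellar F (PointedCone.hull ℚ {r (e i)})) (fanOf r 𝒮) =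
        fanOf r (L.foldl (fun 𝒮 i => ConfigFan.stellarComplex 𝒮 (T i) (e i)) 𝒮) := by
  induction L with
  | nil => exact fun 𝒮 h _ _ => ⟨h, rfl⟩
  | cons i L ih =>
    intro 𝒮 h hT hE
    rw [List.nodup_cons] at hL
    rw [List.pairwise_cons] at hL'
    have hTi := hT i List.mem_cons_self
    have hEi := hE i List.mem_cons_self
    simp only [List.foldl_cons]
    rw [h.stellar_fanOf hTi hEi (hp i) (hp' i) (hr i)]
    refine ih hL.2 hL'.2 _ (h.stellarComplex hTi hEi (hp i) (hp' i) (hr i)) ?_ ?_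
    · intro j hj
      have hTj := hT j (List.mem_cons_of_mem _ hj)
      exact ⟨hL'.1 j hj, Or.inl ⟨hEi _ hTj, hTj⟩⟩
    · rintro j hj S ⟨-, ⟨-, hS⟩ | ⟨-, hS⟩⟩ hjS
      · exact hE j (List.mem_cons_of_mem _ hj) S hS hjS
      · refine hE j (List.mem_cons_of_mem _ hj) _ hS (Or.inl ⟨hjS, fun hc => ?_⟩)
        rw [he (Set.mem_singleton_iff.1 hc)] at hj
        exact hL.1 hj

omit [Fintype E] in
/-- A sufficient condition for a set to be a simplex of an iterated stellar subdivision: replacing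
all new vertices by their carriers gives a simplex of the original complex, and the set does not
contain a carrier `T i`, even after replacing those new vertices whose carrier does not contain
`T i`. -/
theorem mem_foldl_stellarComplex {I : Type*} {T : I → Set E} {e : I → E}
    (he : Function.Injective e) (hTe : ∀ i j, e i ∉ T j) (L : List I) (hL : L.Nodup)
    (hL' : L.Pairwise fun i j => ¬ T i ⊆ T j) (X : Set E)
    (hX : ∀ i ∈ L, ∃ t ∈ T i, t ∉ X ∧ ∀ j, e j ∈ X → t ∈ T j → T i ⊆ T j) :
    ∀ 𝒮 : Set (Set E), (∀ S ∈ 𝒮, ∀ S' ⊆ S, S' ∈ 𝒮) →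
      (∃ S ∈ 𝒮, (∀ t ∈ X, (∀ i ∈ L, t ≠ e i) → t ∈ S) ∧ ∀ i ∈ L, e i ∈ X → T i ⊆ S) →
      X ∈ L.foldl (fun 𝒮 i => ConfigFan.stellarComplex 𝒮 (T i) (e i)) 𝒮 := by
  induction L with
  | nil =>
    rintro 𝒮 h𝒮 ⟨S, hS, h, -⟩
    exact h𝒮 S hS X fun t ht => h t ht (by simp)
  | cons i L ih =>
    rintro 𝒮 h𝒮 ⟨S, hS, h1, h2⟩
    rw [List.nodup_cons] at hL
    rw [List.pairwise_cons] at hL'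
    simp only [List.foldl_cons]
    refine ih hL.2 hL'.2 (fun j hj => hX j (List.mem_cons_of_mem _ hj)) _ (stellarComplex_mono h𝒮)
      ⟨{t | (t ∈ X ∨ ∃ j ∈ L, e j ∈ X ∧ t ∈ T j) ∧ ∀ j ∈ L, t ≠ e j}, ⟨fun hc => ?_, ?_⟩,
        fun t ht ht' => ⟨Or.inl ht, ht'⟩,
        fun j hj hjX t ht => ⟨Or.inr ⟨j, hj, hjX, ht⟩, ?_⟩⟩
    · obtain ⟨t, ht, htX, htT⟩ := hX i List.mem_cons_self
      rcases (hc ht).1 with h3 | ⟨j, hj, hjX, htj⟩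
      · exact htX h3
      · exact hL'.1 j hj (htT j hjX htj)
    · have sub : ∀ t, ((t ∈ X ∨ ∃ j ∈ L, e j ∈ X ∧ t ∈ T j) ∧ ∀ j ∈ L, t ≠ e j) → t ≠ e i →
          t ∈ S := by
        rintro t ⟨h3 | ⟨j, hj, hjX, htj⟩, h4⟩ hti
        · refine h1 t h3 fun j hj => ?_
          rcases List.mem_cons.1 hj with rfl | hj
          · exact hti
          · exact h4 j hj
        · exact h2 j (List.mem_cons_of_mem _ hj) hjX htj
      by_cases hiX : e i ∈ X
      · refine Or.inr ⟨⟨Or.inl hiX, ?_⟩, h𝒮 _ hS _ ?_⟩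
        · rintro j hj hij
          exact hL.1 (he hij ▸ hj)
        · rintro t (⟨h3, h4⟩ | h3)
          · exact sub t h3 h4
          · exact h2 i List.mem_cons_self hiX h3
      · have hi : ∀ t, (t ∈ X ∨ ∃ j ∈ L, e j ∈ X ∧ t ∈ T j) → t ≠ e i := by
          rintro t (h3 | ⟨j, -, -, h3⟩) rfl
          · exact hiX h3
          · exact hTe _ _ h3
        exact Or.inl ⟨fun hc => hi _ hc.1 rfl, h𝒮 _ hS _ fun t ht => sub t ht (hi t ht.1)⟩
    · rintro k - rfl
      exact hTe _ _ ht

end Simplicial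

/-! ### Linear programming duality and the Gelfand-Kapranov-Zelevinsky decomposition -/

section Farkas

/-- The Farkas lemma over `ℚ`: a linear form that is nonpositive wherever finitely many given linear
forms are is a combination of these with nonnegative coefficients. -/
theorem exists_nonneg_combination {U ι : Type*} [AddCommGroup U] [Module ℚ U] (s : Finset ι) :
    ∀ (a : ι → Module.Dual ℚ U) (b : Module.Dual ℚ U),
      (∀ x, (∀ j ∈ s, a j x ≤ 0) → b x ≤ 0) →
      ∃ t : ι → ℚ, (∀ j, 0 ≤ t j) ∧ b = ∑ j ∈ s, t j • a j := by
  classical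
  induction s using Finset.induction_on with
  | empty =>
    intro a b h
    refine ⟨0, by simp, ?_⟩
    ext x
    have h1 := h x (by simp)
    have h2 := h (-x) (by simp)
    rw [map_neg] at h2
    simp only [Finset.sum_empty, LinearMap.zero_apply]
    linarith
  | insert m s hm ih =>
    intro a b h
    by_cases hb : ∀ x, (∀ j ∈ s, a j x ≤ 0) → b x ≤ 0
    · obtain ⟨t, ht, rfl⟩ := ih a b hb
      refine ⟨fun j => if j = m then 0 else t j, fun j => ?_, ?_⟩
      · dsimp only
        split_ifs
        · exact le_rfl
        · exact ht j
      · rw [Finset.sum_insert hm]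
        simp only [if_true, zero_smul, zero_add]
        refine Finset.sum_congr rfl fun j hj => ?_
        rw [if_neg (by rintro rfl; exact hm hj)]
    · push Not at hb
      obtain ⟨x₀, hx₀, hbx⟩ := hb
      have hmx : 0 < a m x₀ := by
        by_contra hc
        refine absurd (h x₀ fun j hj => ?_) (not_le.2 hbx)
        rcases Finset.mem_insert.1 hj with rfl | hj
        · exact not_lt.1 hc
        · exact hx₀ j hj
      -- project along `x₀` onto the hyperplane `a m = 0`
      obtain ⟨t, ht, hbt⟩ := ih (fun j => a j - (a j x₀ / a m x₀) • a m)
        (b - (b x₀ / a m x₀) • a m) (fun x hx => by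
          have h1 := h (x - (a m x / a m x₀) • x₀) (fun j hj => by
            rcases Finset.mem_insert.1 hj with rfl | hj
            · simp [hmx.ne']
            · have := hx j hj
              simp only [LinearMap.sub_apply, LinearMap.smul_apply, smul_eq_mul, map_sub,
                map_smul] at this ⊢
              calc _ = _ := by ring
                _ ≤ 0 := this)
          simp only [LinearMap.sub_apply, LinearMap.smul_apply, smul_eq_mul, map_sub,
            map_smul] at h1 ⊢
          calc _ = _ := by ring
            _ ≤ 0 := h1)
      refine ⟨fun j => if j = m then b x₀ / a m x₀ - ∑ j ∈ s, t j * (a j x₀ / a m x₀) else t j,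
        fun j => ?_, ?_⟩
      · dsimp only
        split_ifs
        · have h1 : 0 < b x₀ / a m x₀ := div_pos hbx hmx
          have h2 : ∑ j ∈ s, t j * (a j x₀ / a m x₀) ≤ 0 := Finset.sum_nonpos fun j hj =>
            mul_nonpos_of_nonneg_of_nonpos (ht j) (div_nonpos_of_nonpos_of_nonneg (hx₀ j hj) hmx.le)
          linarith
        · exact ht j
      · rw [Finset.sum_insert hm]
        dsimp only
        rw [if_pos rfl, sub_smul, Finset.sum_smul]
        have h1 : ∑ j ∈ s, (if j = m then b x₀ / a m x₀ - ∑ j ∈ s, t j * (a j x₀ / a m x₀)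
            else t j) • a j = ∑ j ∈ s, t j • a j :=
          Finset.sum_congr rfl fun j hj => by rw [if_neg (by rintro rfl; exact hm hj)]
        rw [h1]
        refine (sub_eq_iff_eq_add.1 hbt).trans ?_
        simp only [smul_sub, smul_smul, Finset.sum_sub_distrib]
        abel

/-- Strong duality with complementary slackness for the linear program minimizing `c ⬝ a` over the
`a ≥ 0` with `Q a = Q p`. -/
theorem exists_complementary {κ ι : Type*} [Fintype κ] [Fintype ι] (Q : Matrix κ ι ℚ)
    (hQ0 : ∀ k i, 0 ≤ Q k i) (hQ : ∀ i, ∃ k, 0 < Q k i) (c p : ι → ℚ) (hp : ∀ i, 0 ≤ p i) :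
    ∃ (u : κ → ℚ) (a : ι → ℚ), (∀ i, 0 ≤ a i) ∧ (∀ k, ∑ i, a i * Q k i = ∑ i, p i * Q k i) ∧
      (∀ i, ∑ k, u k * Q k i ≤ c i) ∧ ∀ i, a i * (c i - ∑ k, u k * Q k i) = 0 := by
  classical
  set y : κ → ℚ := fun k => ∑ i, p i * Q k i with hy
  have hy0 : ∀ k, 0 ≤ y k := fun k => Finset.sum_nonneg fun i _ => mul_nonneg (hp i) (hQ0 k i)
  -- linear forms in `(r, z, l)`, where `r`, `z` are dual to the constraints and `l` homogenizes
  let fr : ι → Module.Dual ℚ ((ι → ℚ) × (κ → ℚ) × ℚ) := fun i =>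
    LinearMap.proj i ∘ₗ LinearMap.fst ℚ _ _
  let fz : κ → Module.Dual ℚ ((ι → ℚ) × (κ → ℚ) × ℚ) := fun k =>
    LinearMap.proj k ∘ₗ LinearMap.fst ℚ _ _ ∘ₗ LinearMap.snd ℚ _ _
  let fl : Module.Dual ℚ ((ι → ℚ) × (κ → ℚ) × ℚ) := LinearMap.snd ℚ _ _ ∘ₗ LinearMap.snd ℚ _ _
  let g₁ : ι → Module.Dual ℚ ((ι → ℚ) × (κ → ℚ) × ℚ) := fun i => ∑ k, Q k i • fz k + c i • fl
  let g₂ : κ → Module.Dual ℚ ((ι → ℚ) × (κ → ℚ) × ℚ) := fun k => ∑ i, Q k i • fr i - y k • fl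
  let A : (ι ⊕ ι) ⊕ (κ ⊕ κ) → Module.Dual ℚ ((ι → ℚ) × (κ → ℚ) × ℚ) :=
    Sum.elim (Sum.elim (fun i => -fr i) fun i => -g₁ i) (Sum.elim g₂ fun k => -g₂ k)
  let b : Module.Dual ℚ ((ι → ℚ) × (κ → ℚ) × ℚ) := -(∑ i, c i • fr i + ∑ k, y k • fz k)
  obtain ⟨t, ht, hbt⟩ := exists_nonneg_combination Finset.univ A b (by
    rintro ⟨r, z, l⟩ h
    have hr : ∀ i, 0 ≤ r i := fun i => by simpa [A, fr] using h (Sum.inl (Sum.inl i))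
    have hz : ∀ i, 0 ≤ ∑ k, Q k i * z k + c i * l := fun i => by
      have := h (Sum.inl (Sum.inr i)) (Finset.mem_univ _)
      simp only [A, Sum.elim_inl, Sum.elim_inr, g₁, fz, fl, LinearMap.neg_apply,
        LinearMap.add_apply, LinearMap.sum_apply, LinearMap.smul_apply, LinearMap.comp_apply,
        LinearMap.proj_apply, LinearMap.fst_apply, LinearMap.snd_apply, smul_eq_mul] at this
      linarith
    have hl : ∀ k, ∑ i, Q k i * r i = y k * l := fun k => by
      have h1 := h (Sum.inr (Sum.inl k)) (Finset.mem_univ _)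
      have h2 := h (Sum.inr (Sum.inr k)) (Finset.mem_univ _)
      simp only [A, Sum.elim_inl, Sum.elim_inr, g₂, fr, fl, LinearMap.neg_apply,
        LinearMap.sub_apply, LinearMap.sum_apply, LinearMap.smul_apply, LinearMap.comp_apply,
        LinearMap.proj_apply, LinearMap.fst_apply, LinearMap.snd_apply, smul_eq_mul] at h1 h2
      linarith
    have hb : b (r, z, l) = -(∑ i, c i * r i + ∑ k, y k * z k) := by
      simp [b, fr, fz]
    rw [hb]
    have hyz : ∑ k, y k * z k = ∑ i, p i * ∑ k, Q k i * z k := by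
      simp only [hy, Finset.sum_mul, Finset.mul_sum]
      rw [Finset.sum_comm]
      exact Finset.sum_congr rfl fun i _ => Finset.sum_congr rfl fun k _ => by ring
    have hQr : ∀ k, 0 ≤ y k * l := fun k => by
      rw [← hl k]
      exact Finset.sum_nonneg fun i _ => mul_nonneg (hQ0 k i) (hr i)
    have r_zero : (∀ k, y k * l = 0) → ∀ i, r i = 0 := by
      intro h0 i
      obtain ⟨k, hk⟩ := hQ i
      have h1 := hl k
      rw [h0 k] at h1
      have h2 := (Finset.sum_eq_zero_iff_of_nonneg fun i _ => mul_nonneg (hQ0 k i) (hr i)).1 h1 i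
        (Finset.mem_univ _)
      exact (mul_eq_zero.1 h2).resolve_left hk.ne'
    rcases lt_trichotomy l 0 with hl0 | rfl | hl0
    · have h0 : ∀ k, y k = 0 := fun k => by
        have h1 := hQr k
        have h2 := hy0 k
        by_contra hc
        have h3 : y k * l < 0 := mul_neg_of_pos_of_neg (lt_of_le_of_ne h2 (Ne.symm hc)) hl0
        linarith
      have h1 := r_zero fun k => by rw [h0 k, zero_mul]
      simp [h0, h1]
    · have h1 := r_zero fun k => by rw [mul_zero]
      rw [hyz]
      have h2 : 0 ≤ ∑ i, p i * ∑ k, Q k i * z k := Finset.sum_nonneg fun i _ =>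
        mul_nonneg (hp i) (by simpa using hz i)
      simpa [h1] using h2
    · have h1 : 0 ≤ ∑ i, r i * (∑ k, Q k i * z k + c i * l) := Finset.sum_nonneg fun i _ =>
        mul_nonneg (hr i) (hz i)
      have h2 : ∑ i, r i * (∑ k, Q k i * z k + c i * l)
          = l * (∑ i, c i * r i + ∑ k, y k * z k) := by
        have h3 : ∑ i, r i * ∑ k, Q k i * z k = ∑ k, (y k * l) * z k := by
          simp only [← hl, Finset.sum_mul, Finset.mul_sum]
          rw [Finset.sum_comm]
          exact Finset.sum_congr rfl fun i _ => Finset.sum_congr rfl fun k _ => by ring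
        simp only [mul_add, Finset.sum_add_distrib, h3]
        rw [add_comm, Finset.mul_sum, Finset.mul_sum]
        exact congrArg₂ _ (Finset.sum_congr rfl fun i _ => by ring)
          (Finset.sum_congr rfl fun i _ => by ring)
      rw [h2] at h1
      have := nonneg_of_mul_nonneg_right h1 hl0
      linarith)
  set s : ι → ℚ := fun i => t (Sum.inl (Sum.inl i)) with hs
  set a : ι → ℚ := fun i => t (Sum.inl (Sum.inr i)) with ha
  set u : κ → ℚ := fun k => t (Sum.inr (Sum.inr k)) - t (Sum.inr (Sum.inl k)) with hu
  have hbt' : ∀ x, b x = (∑ i, s i * -fr i x + ∑ i, a i * -g₁ i x) + ∑ k, u k * -g₂ k x := by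
    intro x
    rw [hbt]
    simp only [A, Fintype.sum_sum_type, Sum.elim_inl, Sum.elim_inr, LinearMap.add_apply,
      LinearMap.sum_apply, LinearMap.smul_apply, LinearMap.neg_apply, smul_eq_mul, hs, ha, hu,
      sub_mul, Finset.sum_sub_distrib, mul_neg, Finset.sum_neg_distrib]
    ring
  have h1 : ∀ i, c i = s i + ∑ k, u k * Q k i := fun i => by
    have := hbt' (Pi.single i 1, 0, 0)
    simp only [b, fr, fz, fl, g₁, g₂, LinearMap.neg_apply, LinearMap.add_apply,
      LinearMap.sub_apply, LinearMap.sum_apply, LinearMap.smul_apply, LinearMap.comp_apply,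
      LinearMap.proj_apply, LinearMap.fst_apply, LinearMap.snd_apply, smul_eq_mul, Pi.single_apply,
      Pi.zero_apply, mul_ite, mul_one, mul_zero, Finset.sum_ite_eq',
      Finset.mem_univ, if_true, Finset.sum_const_zero, add_zero, sub_zero, neg_zero, mul_neg,
      Finset.sum_neg_distrib] at this
    linarith
  have h2 : ∀ k, y k = ∑ i, a i * Q k i := fun k => by
    have := hbt' (0, Pi.single k 1, 0)
    simp only [b, fr, fz, fl, g₁, g₂, LinearMap.neg_apply, LinearMap.add_apply,
      LinearMap.sub_apply, LinearMap.sum_apply, LinearMap.smul_apply, LinearMap.comp_apply,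
      LinearMap.proj_apply, LinearMap.fst_apply, LinearMap.snd_apply, smul_eq_mul, Pi.single_apply,
      Pi.zero_apply, mul_ite, mul_one, mul_zero, Finset.sum_ite_eq',
      Finset.mem_univ, if_true, Finset.sum_const_zero, add_zero, sub_zero, neg_zero, mul_neg,
      Finset.sum_neg_distrib, zero_add] at this
    linarith
  have h3 : ∑ i, a i * c i = ∑ k, u k * y k := by
    have := hbt' (0, 0, 1)
    simp only [b, fr, fz, fl, g₁, g₂, LinearMap.neg_apply, LinearMap.add_apply,
      LinearMap.sub_apply, LinearMap.sum_apply, LinearMap.smul_apply, LinearMap.comp_apply,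
      LinearMap.proj_apply, LinearMap.fst_apply, LinearMap.snd_apply, smul_eq_mul,
      Pi.zero_apply, mul_one, mul_zero, Finset.sum_const_zero, add_zero, neg_zero, mul_neg,
      Finset.sum_neg_distrib, zero_add, zero_sub, neg_neg] at this
    linarith
  have h4 : ∑ i, a i * s i = 0 := by
    have h5 : ∑ k, u k * y k = ∑ i, a i * ∑ k, u k * Q k i := by
      simp only [h2, Finset.mul_sum]
      rw [Finset.sum_comm]
      exact Finset.sum_congr rfl fun i _ => Finset.sum_congr rfl fun k _ => by ring
    rw [h5] at h3
    have h6 : ∑ i, a i * c i = ∑ i, a i * s i + ∑ i, a i * ∑ k, u k * Q k i := by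
      rw [← Finset.sum_add_distrib]
      exact Finset.sum_congr rfl fun i _ => by rw [h1 i, mul_add]
    linarith
  refine ⟨u, a, fun i => ht _, fun k => (h2 k).symm, fun i => ?_, fun i => ?_⟩
  · have := ht (Sum.inl (Sum.inl i))
    linarith [h1 i]
  · have h5 := (Finset.sum_eq_zero_iff_of_nonneg
      fun i _ => mul_nonneg (ht (Sum.inl (Sum.inr i))) (ht (Sum.inl (Sum.inl i)))).1 h4 i
      (Finset.mem_univ _)
    rw [h1 i, add_sub_cancel_right]
    exact h5

end Farkas

section GKZ

variable {V : Type*} [AddCommGroup V] [Module ℚ V] {ι κ : Type*} [Fintype ι] [Fintype κ]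

omit [Fintype ι] in
theorem mem_gkzCone_iff {v : ι → V} {x y : V} :
    y ∈ gkzCone v x ↔ ∀ J : Set ι, x ∈ relint (cone v J : Set V) → y ∈ cone v J := by
  rw [gkzCone, Submodule.mem_sInf]
  constructor
  · exact fun h J hJ => h _ ⟨J, rfl, hJ⟩
  · rintro h _ ⟨J, rfl, hJ⟩
    exact h J hJ

/-- The cones `σ(x)` have disjoint relative interiors. -/
theorem gkzCone_eq_of_mem_relint {v : ι → V} (Q : Matrix κ ι ℚ) (hQ0 : ∀ k i, 0 ≤ Q k i)
    (hQ : ∀ i, ∃ k, 0 < Q k i) (hsurj : ∀ x : V, ∃ c : ι → ℚ, ∑ i, c i • v i = x)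
    (hv : ∀ a : ι → ℚ, ∑ i, a i • v i = 0 ↔ ∃ u : κ → ℚ, ∀ i, a i = ∑ k, u k * Q k i)
    {x z : V} (hx : x ∈ relint (gkzCone v z : Set V)) : gkzCone v x = gkzCone v z := by
  classical
  -- a cone that contains `z` in its relative interior also contains `x` in its relative interior
  have hzx : ∀ J : Set ι, z ∈ relint (cone v J : Set V) → x ∈ relint (cone v J : Set V) := by
    intro J hJ
    obtain ⟨ε, hε, h1⟩ := hx.2 z (mem_gkzCone_iff.2 fun J hJ => hJ.1)
    obtain ⟨d, hd, hd', hd''⟩ := mem_cone_iff.1 (mem_gkzCone_iff.1 h1 J hJ)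
    obtain ⟨c, hc, hc', rfl⟩ := mem_relint_cone_iff.1 hJ
    have h4 : (0 : ℚ) < 1 + ε := by linarith
    refine mem_relint_cone_iff.2 ⟨fun i => (1 + ε)⁻¹ * (d i + ε * c i), fun i hi => ?_,
      fun i hi => ?_, ?_⟩
    · have := hd i
      have := hc i hi
      positivity
    · simp [hd' i hi, hc' i hi]
    · simp only [mul_smul, ← Finset.smul_sum, add_smul, Finset.sum_add_distrib]
      rw [hd'', inv_smul_eq_iff₀ h4.ne']
      module
  refine le_antisymm (fun y hy => mem_gkzCone_iff.2 fun J hJ => mem_gkzCone_iff.1 hy J (hzx J hJ))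
    fun y hy => mem_gkzCone_iff.2 fun J hJ => ?_
  obtain ⟨d, hd, hd', rfl⟩ := mem_relint_cone_iff.1 hJ
  obtain ⟨c, rfl⟩ := hsurj z
  obtain ⟨u, a, ha, hap, huc, hau⟩ := exists_complementary Q hQ0 hQ c
    (fun i => if i ∈ J then 0 else 1) (fun i => by split_ifs <;> norm_num)
  -- complementary slackness provides a cone around `z` that lies inside the given cone around `x`
  set J' : Set ι := {i | ∑ k, u k * Q k i < c i} with hJ'
  have hzJ' : ∑ i, c i • v i ∈ relint (cone v J' : Set V) := by
    refine mem_relint_cone_iff.2 ⟨fun i => c i - ∑ k, u k * Q k i, fun i hi => sub_pos.2 hi,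
      fun i hi => ?_, ?_⟩
    · exact sub_eq_zero.2 (le_antisymm (not_lt.1 hi) (huc i))
    · simp only [sub_smul, Finset.sum_sub_distrib]
      rw [(hv fun i => ∑ k, u k * Q k i).2 ⟨u, fun i => rfl⟩, sub_zero]
  refine cone_mono ?_ (mem_gkzCone_iff.1 hy J' hzJ')
  obtain ⟨d', h1, h2, h3⟩ := mem_relint_cone_iff.1 (hzx J' hzJ')
  obtain ⟨w, hw⟩ := (hv fun i => d i - d' i).1 (by
    simp only [sub_smul, Finset.sum_sub_distrib, h3, sub_self])
  have hd'0 : ∀ i, 0 ≤ d' i := fun i => by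
    by_cases hi : i ∈ J'
    · exact (h1 i hi).le
    · exact (h2 i hi).ge
  have hd0 : ∀ i, 0 ≤ d i := fun i => by
    by_cases hi : i ∈ J
    · exact (hd i hi).le
    · exact (hd' i hi).ge
  have h4 : ∑ i, a i * (d i - d' i) = ∑ i, (if i ∈ J then 0 else 1) * (d i - d' i) := by
    have h5 : ∀ q : ι → ℚ, ∑ i, q i * (d i - d' i) = ∑ k, w k * ∑ i, q i * Q k i := by
      intro q
      simp only [hw, Finset.mul_sum]
      rw [Finset.sum_comm]
      exact Finset.sum_congr rfl fun k _ => Finset.sum_congr rfl fun i _ => by ring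
    simp only [h5, hap]
  have h5 : ∀ i, a i * (d i - d' i) = a i * d i := by
    intro i
    by_cases hi : i ∈ J'
    · have h6 := hau i
      rw [(mul_eq_zero.1 h6).resolve_right (sub_pos.2 hi).ne']
      simp
    · rw [h2 i hi, sub_zero]
  have h6 : ∀ i, (if i ∈ J then (0 : ℚ) else 1) * (d i - d' i) = -(if i ∈ J then 0 else d' i) := by
    intro i
    split_ifs with hi
    · simp
    · simp [hd' i hi]
  simp only [h5, h6, Finset.sum_neg_distrib] at h4
  have h7 : 0 ≤ ∑ i, a i * d i := Finset.sum_nonneg fun i _ => mul_nonneg (ha i) (hd0 i)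
  have h8 : ∀ i, 0 ≤ if i ∈ J then 0 else d' i := fun i => by
    split_ifs
    · exact le_rfl
    · exact hd'0 i
  have h9 : ∑ i, (if i ∈ J then 0 else d' i) = 0 := by
    have := Finset.sum_nonneg fun i (_ : i ∈ Finset.univ) => h8 i
    linarith
  intro i hi
  by_contra hiJ
  have h10 := (Finset.sum_eq_zero_iff_of_nonneg fun i _ => h8 i).1 h9 i (Finset.mem_univ _)
  rw [if_neg hiJ] at h10
  exact (h1 i hi).ne' h10

end GKZ

/-! ### Gale duality -/

section Gale

variable {κ ι ρ : Type*} [Fintype ι]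

theorem IsGaleDual.sum_smul_col_eq_zero_iff [Fintype κ] {Q : Matrix κ ι ℚ} {P : Matrix ρ ι ℚ}
    (h : IsGaleDual Q P) (a : ι → ℚ) :
    ∑ i, a i • P.col i = 0 ↔ ∃ u : κ → ℚ, ∀ i, a i = ∑ k, u k * Q k i := by
  classical
  constructor
  · intro h0
    let φ : Module.Dual ℚ (ι → ℚ) := ∑ i, a i • LinearMap.proj i
    have hφ : ∀ x, φ x = ∑ i, a i * x i := fun x => by simp [φ]
    have h1 : φ ∈ (LinearMap.ker Q.mulVecLin).dualAnnihilator := by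
      rw [Submodule.mem_dualAnnihilator, ← h.2]
      intro x hx
      have h2 : Submodule.span ℚ (Set.range P.row) ≤ LinearMap.ker φ := by
        refine Submodule.span_le.2 ?_
        rintro _ ⟨k, rfl⟩
        rw [SetLike.mem_coe, LinearMap.mem_ker, hφ]
        have h3 := congrFun h0 k
        simpa [Finset.sum_apply] using h3
      exact h2 hx
    rw [← LinearMap.range_dualMap_eq_dualAnnihilator_ker] at h1
    obtain ⟨g, hg⟩ := h1
    refine ⟨fun k => g (Pi.single k 1), fun i => ?_⟩
    have h2 := hφ (Pi.single i 1)
    rw [← hg] at h2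
    simp only [LinearMap.dualMap_apply, Matrix.mulVecLin_apply, Matrix.mulVec_single_one,
      Pi.single_apply, mul_ite, mul_one, mul_zero, Finset.sum_ite_eq', Finset.mem_univ,
      if_true] at h2
    rw [← h2]
    have h3 : Q.col i = ∑ k, Q k i • Pi.single k (1 : ℚ) := by
      ext l
      simp [Pi.single_apply]
    rw [h3, map_sum]
    exact Finset.sum_congr rfl fun k _ => by rw [map_smul, smul_eq_mul, mul_comm]
  · rintro ⟨u, hu⟩
    ext k
    have h1 : P.row k ∈ LinearMap.ker Q.mulVecLin := by
      rw [← h.2]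
      exact Submodule.subset_span ⟨k, rfl⟩
    have h2 : ∀ l, ∑ i, Q l i * P k i = 0 := fun l => congrFun (LinearMap.mem_ker.1 h1) l
    simp only [Finset.sum_apply, Pi.smul_apply, Matrix.col_apply, smul_eq_mul, Pi.zero_apply, hu,
      Finset.sum_mul]
    rw [Finset.sum_comm]
    refine Finset.sum_eq_zero fun l _ => ?_
    rw [← mul_zero (u l), ← h2 l, Finset.mul_sum]
    exact Finset.sum_congr rfl fun i _ => by ring

theorem IsGaleDual.exists_sum_smul_col_eq [Fintype ρ] {Q : Matrix κ ι ℚ} {P : Matrix ρ ι ℚ}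
    (h : IsGaleDual Q P) (x : ρ → ℚ) : ∃ c : ι → ℚ, ∑ i, c i • P.col i = x := by
  have h1 : LinearMap.range P.mulVecLin = ⊤ := by
    apply Submodule.eq_top_of_finrank_eq
    have := h.1.rank_matrix
    rw [Matrix.rank] at this
    rw [this, Module.finrank_fintype_fun_eq_card]
  obtain ⟨c, hc⟩ := LinearMap.range_eq_top.1 h1 x
  refine ⟨c, ?_⟩
  rw [← hc, Matrix.mulVecLin_apply, Matrix.mulVec_eq_sum]
  exact Finset.sum_congr rfl fun i _ => (op_smul_eq_smul _ _).symm

end Gale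

/-! ### Pairs and weights -/

section Pairs

variable {n : ℕ}

theorem Pair.snd_ne_zero (η : Pair n) : η.1.2 ≠ 0 := ((Fin.zero_le _).trans_lt η.2).ne'

theorem Pair.forall_iff {p : Fin (n + 1) → Fin (n + 1) → Prop} (hp : ∀ i j, p i j → p j i) :
    (∀ η : Pair n, p η.1.1 η.1.2) ↔ ∀ i j, i ≠ j → p i j := by
  constructor
  · intro h i j hij
    rcases lt_or_gt_of_ne hij with h' | h'
    · exact h ⟨(i, j), h'⟩
    · exact hp _ _ (h ⟨(j, i), h'⟩)
  · exact fun h η => h _ _ η.2.ne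

theorem sum_pair (F : Fin (n + 1) → Fin (n + 1) → ℚ) :
    ∑ η : Pair n, F η.1.1 η.1.2 = ∑ i, ∑ j, if i < j then F i j else 0 := by
  rw [← Fintype.sum_prod_type' (f := fun i j => if i < j then F i j else 0), ← Finset.sum_filter]
  exact (Finset.sum_subtype (Finset.univ.filter fun p : Fin (n + 1) × Fin (n + 1) => p.1 < p.2)
    (by simp) fun p => F p.1 p.2).symm

/-- The `k`-th coordinate of a combination of the weights, the coefficients being the values of a
symmetric function at the pairs. -/
theorem sum_mul_weightMatrix (f : Fin (n + 1) → Fin (n + 1) → ℚ) (hf : ∀ i j, f i j = f j i)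
    (hf' : ∀ i, f i i = 0) (k : N n) :
    ∑ η : Pair n, f η.1.1 η.1.2 * weightMatrix n k η = ∑ j, f k j := by
  have h1 : ∀ η : Pair n, f η.1.1 η.1.2 * weightMatrix n k η =
      (fun i j => f i j * if k.1 = i ∨ k.1 = j then 1 else 0) η.1.1 η.1.2 := fun η => by
    simp [weightMatrix, Pair.elems]
  refine ((Finset.sum_congr rfl fun η _ => h1 η).trans
    (sum_pair fun i j => f i j * if k.1 = i ∨ k.1 = j then 1 else 0)).trans ?_
  have h2 : ∀ i j : Fin (n + 1), (if i < j then f i j * (if k.1 = i ∨ k.1 = j then 1 else 0) else 0)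
      = (if k.1 = i then if i < j then f i j else 0 else 0) +
        if k.1 = j then if i < j then f i j else 0 else 0 := by
    intro i j
    by_cases hij : i < j
    · by_cases hi : k.1 = i
      · simp [hij, hi, hij.ne]
      · by_cases hj : k.1 = j <;> simp [hij, hi, hj, hij.ne']
    · simp [hij]
  simp only [h2, Finset.sum_add_distrib]
  have h3 : ∑ i, ∑ j, (if k.1 = i then if i < j then f i j else 0 else 0)
      = ∑ j, if k.1 < j then f k j else 0 := by
    rw [Finset.sum_eq_single k.1]
    · simp
    · intro i _ hi
      simp [hi.symm]
    · simp
  have h4 : ∑ i, ∑ j, (if k.1 = j then if i < j then f i j else 0 else 0)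
      = ∑ j, if j < k.1 then f j k else 0 := by
    simp
  rw [h3, h4, ← Finset.sum_add_distrib]
  refine Finset.sum_congr rfl fun j _ => ?_
  rcases lt_trichotomy k.1 j with h | h | h
  · simp [h, h.not_gt]
  · simp [← h, hf']
  · simp [h, h.not_gt, hf k.1 j]

theorem sum_N_eq (F : Fin (n + 1) → ℚ) (h : F 0 = 0) : ∑ k : N n, F k.1 = ∑ i, F i := by
  rw [← Finset.sum_subtype (Finset.univ.filter fun i : Fin (n + 1) => i ≠ 0) (by simp) F]
  rw [Finset.sum_filter]
  refine Finset.sum_congr rfl fun i _ => ?_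
  split_ifs with hi
  · rfl
  · rw [not_not.1 hi, h]

/-- A linear relation among the vectors `v_η` amounts to a potential `u` on `{0, …, n}` that
vanishes at `0`. -/
theorem sum_smul_col_eq_zero_iff {m : ℕ} {P : Matrix (Fin m) (Pair n) ℚ}
    (hP : IsGaleDual (weightMatrix n) P) (a : Pair n → ℚ) :
    ∑ η, a η • P.col η = 0 ↔
      ∃ u : Fin (n + 1) → ℚ, u 0 = 0 ∧ ∀ η : Pair n, a η = u η.1.1 + u η.1.2 := by
  have key : ∀ u : Fin (n + 1) → ℚ, u 0 = 0 → ∀ η : Pair n,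
      ∑ k : N n, u k * weightMatrix n k η = u η.1.1 + u η.1.2 := by
    intro u hu η
    have h1 : ∀ k : N n, u k * weightMatrix n k η =
        (fun i => u i * if i = η.1.1 ∨ i = η.1.2 then 1 else 0) k.1 := fun k => by
      simp [weightMatrix, Pair.elems]
    refine ((Finset.sum_congr rfl fun k _ => h1 k).trans
      (sum_N_eq (fun i => u i * if i = η.1.1 ∨ i = η.1.2 then 1 else 0) (by simp [hu]))).trans ?_
    have h2 : ∀ i, (u i * if i = η.1.1 ∨ i = η.1.2 then 1 else 0)
        = (if i = η.1.1 then u i else 0) + if i = η.1.2 then u i else 0 := by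
      intro i
      by_cases h : i = η.1.1
      · simp [h, η.2.ne]
      · by_cases h' : i = η.1.2 <;> simp [h, h', η.2.ne']
    simp [h2, Finset.sum_add_distrib]
  rw [hP.sum_smul_col_eq_zero_iff]
  constructor
  · rintro ⟨u, hu⟩
    refine ⟨fun i => if h : i ≠ 0 then u ⟨i, h⟩ else 0, by simp, fun η => (hu η).trans ?_⟩
    refine Eq.trans ?_ (key (fun i => if h : i ≠ 0 then u ⟨i, h⟩ else 0) (by simp) η)
    exact Finset.sum_congr rfl fun k _ => by rw [dif_pos k.2]
  · rintro ⟨u, hu, hu'⟩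
    exact ⟨fun k => u k.1, fun η => by rw [hu', key u hu η]⟩

theorem weightMatrix_nonneg (k : N n) (η : Pair n) : 0 ≤ weightMatrix n k η := by
  simp only [weightMatrix, Matrix.of_apply]
  split_ifs <;> norm_num

theorem exists_weightMatrix_pos (η : Pair n) : ∃ k, 0 < weightMatrix n k η :=
  ⟨⟨η.1.2, η.snd_ne_zero⟩, by simp [weightMatrix, Pair.elems]⟩

end Pairs

/-! ### The chamber `λ_1` and its enveloping sets -/

section Chamber

variable {n : ℕ}

theorem one_ne_zero_of_two_le (hn : 2 ≤ n) : (1 : Fin (n + 1)) ≠ 0 := by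
  rw [Ne, Fin.one_eq_zero_iff]
  omega

/-- The relative interior of a polyhedron with an interior point. -/
theorem mem_relint_polyhedron_iff {V ι : Type*} [AddCommGroup V] [Module ℚ V] [Finite ι]
    (l : ι → V →ₗ[ℚ] ℚ) {y : V} (hy : ∀ i, 0 < l i y) {x : V} :
    x ∈ relint {x : V | ∀ i, 0 ≤ l i x} ↔ ∀ i, 0 < l i x := by
  constructor
  · rintro ⟨-, h⟩ i
    obtain ⟨ε, hε, h1⟩ := h y fun i => (hy i).le
    have h2 := h1 i
    rw [map_add, map_smul, map_sub, smul_eq_mul] at h2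
    have h3 := mul_pos hε (hy i)
    have h4 : 0 < (1 + ε) * l i x := by linarith
    exact pos_of_mul_pos_right h4 (by linarith)
  · intro h
    refine ⟨fun i => (h i).le, fun z hz => ?_⟩
    obtain ⟨ε, hε, h1⟩ := exists_pos_forall_pos_add_mul Set.univ (fun i => l i x)
      (fun i => l i (x - z)) fun i _ => h i
    refine ⟨ε, hε, fun i => ?_⟩
    rw [map_add, map_smul, smul_eq_mul]
    exact (h1 i (Set.mem_univ i)).le

theorem formOne_eq (o : N n) (ho : o.1 = 1) (x : N n → ℚ) : formOne x = 2 * x o - ∑ i, x i := by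
  have h : ∀ i : N n, (if i.1 = 1 then x i else -x i) = (if i = o then 2 * x i else 0) - x i := by
    intro i
    have : i.1 = 1 ↔ i = o := by rw [← ho, Subtype.ext_iff]
    simp only [this]
    split_ifs <;> ring
  simp [formOne, h]

theorem formOnePair_eq (o : N n) (ho : o.1 = 1) (j : N n) (hj : j.1 ≠ 1) (x : N n → ℚ) :
    formOnePair j x = 2 * x o + 2 * x j - ∑ i, x i := by
  have hoj : o ≠ j := fun h => hj (h ▸ ho)
  have h : ∀ i : N n, (if i.1 = 1 ∨ i = j then x i else -x i) =
      (if i = o then 2 * x i else 0) + (if i = j then 2 * x i else 0) - x i := by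
    intro i
    have : i.1 = 1 ↔ i = o := by rw [← ho, Subtype.ext_iff]
    simp only [this]
    by_cases h1 : i = o
    · subst h1
      simp [hoj]
      ring
    · by_cases h2 : i = j
      · subst h2
        simp [h1]
        ring
      · simp [h1, h2]
  simp [formOnePair, h, Finset.sum_add_distrib]

theorem card_N : Fintype.card (N n) = n := by
  simp

/-- A point of the interior of `λ_1`. -/
theorem exists_interior_point (hn : 2 ≤ n) (o : N n) : ∃ x : N n → ℚ, (∀ i, 0 < x i) ∧
    2 * x o < ∑ i, x i ∧ ∀ j, j ≠ o → ∑ i, x i < 2 * x o + 2 * x j := by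
  classical
  have hn' : (2 : ℚ) ≤ n := by exact_mod_cast hn
  have hsum : ∑ i : N n, (if i = o then (n : ℚ) - 3 / 2 else 1) = 2 * n - 5 / 2 := by
    have : ∀ i : N n, (if i = o then (n : ℚ) - 3 / 2 else 1)
        = (if i = o then (n : ℚ) - 5 / 2 else 0) + 1 := by
      intro i
      split_ifs <;> ring
    simp only [this, Finset.sum_add_distrib, Finset.sum_ite_eq', Finset.mem_univ, if_true,
      Finset.sum_const, Finset.card_univ, card_N, nsmul_eq_mul, mul_one]
    ring
  refine ⟨fun i => if i = o then n - 3 / 2 else 1, fun i => ?_, ?_, fun j hj => ?_⟩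
  · dsimp only
    split_ifs <;> linarith
  · dsimp only
    rw [hsum, if_pos rfl]
    linarith
  · dsimp only
    rw [hsum, if_pos rfl, if_neg hj]
    linarith

theorem mem_relint_lambdaOne_iff (hn : 2 ≤ n) (o : N n) (ho : o.1 = 1) {x : N n → ℚ} :
    x ∈ relint (lambdaOne n) ↔ (∀ i, 0 < x i) ∧
      2 * x o < ∑ i, x i ∧ ∀ j, j ≠ o → ∑ i, x i < 2 * x o + 2 * x j := by
  obtain ⟨y, hy1, hy2, hy3⟩ := exists_interior_point hn o
  let π : N n → (N n → ℚ) →ₗ[ℚ] ℚ := LinearMap.proj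
  let l : Option (N n ⊕ {j : N n // j ≠ o}) → (N n → ℚ) →ₗ[ℚ] ℚ := fun k =>
    k.elim (∑ i, π i - (2 : ℚ) • π o)
      (Sum.elim π fun j => (2 : ℚ) • π o + (2 : ℚ) • π j.1 - ∑ i, π i)
  have hl : ∀ (p : ℚ → Prop) (x : N n → ℚ), (∀ k, p (l k x)) ↔ (∀ i, p (x i)) ∧
      p (∑ i, x i - 2 * x o) ∧ ∀ j, j ≠ o → p (2 * x o + 2 * x j - ∑ i, x i) := by
    intro p x
    rw [Option.forall, Sum.forall, Subtype.forall]
    simp [l, π]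
    tauto
  have hne : ∀ j : N n, j.1 ≠ 1 ↔ j ≠ o := fun j => by rw [← ho, Ne, Ne, Subtype.ext_iff]
  have hset : lambdaOne n = {x | ∀ k, 0 ≤ l k x} := by
    ext x
    rw [Set.mem_ofPred_eq, hl (fun t => 0 ≤ t)]
    refine and_congr_right fun _ => and_congr ?_ (forall_congr' fun j => ?_)
    · rw [formOne_eq o ho]
      constructor <;> intro h <;> linarith
    · rw [hne]
      refine forall_congr' fun hj => ?_
      rw [formOnePair_eq o ho j ((hne j).2 hj)]
  rw [hset, mem_relint_polyhedron_iff l (y := y)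
    ((hl (fun t => 0 < t) y).2 ⟨hy1, by linarith, fun j hj => by linarith [hy3 j hj]⟩),
    hl (fun t => 0 < t)]
  simp only [sub_pos]

/-- The interior of `λ_1` is open. -/
theorem exists_add_smul_mem_relint_lambdaOne (hn : 2 ≤ n) {x : N n → ℚ}
    (hx : x ∈ relint (lambdaOne n)) (y : N n → ℚ) :
    ∃ ε : ℚ, 0 < ε ∧ x + ε • y ∈ relint (lambdaOne n) := by
  let o : N n := ⟨1, one_ne_zero_of_two_le hn⟩
  have ho : o.1 = 1 := rfl
  rw [mem_relint_lambdaOne_iff hn o ho] at hx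
  obtain ⟨h1, h2, h3⟩ := hx
  obtain ⟨ε₁, hε₁, h1'⟩ := exists_pos_forall_pos_add_mul Set.univ x (fun i => min (y i) 0)
    fun i _ => h1 i
  obtain ⟨ε₂, hε₂, h2'⟩ := exists_pos_forall_pos_add_mul (Set.univ : Set Unit)
    (fun _ => ∑ i, x i - 2 * x o) (fun _ => min (∑ i, y i - 2 * y o) 0)
    fun i _ => by linarith
  obtain ⟨ε₃, hε₃, h3'⟩ := exists_pos_forall_pos_add_mul {j | j ≠ o}
    (fun j => 2 * x o + 2 * x j - ∑ i, x i) (fun j => min (2 * y o + 2 * y j - ∑ i, y i) 0)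
    fun j hj => by linarith [h3 j hj]
  -- the directional parts are truncated at `0` so that the bounds persist for a smaller `ε`
  have key : ∀ a b ε δ : ℚ, 0 < δ → δ ≤ ε → 0 < a + ε * min b 0 → 0 < a + δ * b := by
    intro a b ε δ hδ hδε h
    have h4 : ε * min b 0 ≤ δ * min b 0 := mul_le_mul_of_nonpos_right hδε (min_le_right _ _)
    have h5 : δ * min b 0 ≤ δ * b := mul_le_mul_of_nonneg_left (min_le_left _ _) hδ.le
    linarith
  set δ := min ε₁ (min ε₂ ε₃)
  have hδ : 0 < δ := lt_min hε₁ (lt_min hε₂ hε₃)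
  refine ⟨δ, hδ, (mem_relint_lambdaOne_iff hn o ho).2 ⟨fun i => ?_, ?_, fun j hj => ?_⟩⟩
  · exact key _ _ _ _ hδ (min_le_left _ _) (h1' i (Set.mem_univ _))
  · have := key _ _ _ _ hδ ((min_le_right _ _).trans (min_le_left _ _)) (h2' () (Set.mem_univ _))
    simp only [Pi.add_apply, Pi.smul_apply, smul_eq_mul, Finset.sum_add_distrib, ← Finset.mul_sum]
    linarith
  · have := key _ _ _ _ hδ ((min_le_right _ _).trans (min_le_right _ _)) (h3' j hj)
    simp only [Pi.add_apply, Pi.smul_apply, smul_eq_mul, Finset.sum_add_distrib, ← Finset.mul_sum]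
    linarith

theorem mem_relint_omega_iff {J : Set (Pair n)} {x : N n → ℚ} :
    x ∈ relint (omega J : Set (N n → ℚ)) ↔ ∃ c : Pair n → ℚ, (∀ η ∈ J, 0 < c η) ∧
      (∀ η ∉ J, c η = 0) ∧ ∀ k, ∑ η, c η * weightMatrix n k η = x k := by
  rw [omega, mem_relint_cone_iff]
  simp only [funext_iff, Finset.sum_apply, Pi.smul_apply, smul_eq_mul, Matrix.col_apply]

/-- If the interior of `λ_1` lies in that of `ω_J`, then the weights belonging to `J` span. -/
theorem exists_sum_mul_weightMatrix_eq (hn : 2 ≤ n) {J : Set (Pair n)}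
    (hJ : relint (lambdaOne n) ⊆ relint (omega J : Set (N n → ℚ))) (y : N n → ℚ) :
    ∃ q : Pair n → ℚ, (∀ η ∉ J, q η = 0) ∧ ∀ k, ∑ η, q η * weightMatrix n k η = y k := by
  let o : N n := ⟨1, one_ne_zero_of_two_le hn⟩
  obtain ⟨x, hx⟩ := exists_interior_point hn o
  rw [← mem_relint_lambdaOne_iff hn o rfl] at hx
  obtain ⟨ε, hε, h⟩ := exists_add_smul_mem_relint_lambdaOne hn hx y
  obtain ⟨c, -, hc, hc'⟩ := mem_relint_omega_iff.1 (hJ hx)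
  obtain ⟨d, -, hd, hd'⟩ := mem_relint_omega_iff.1 (hJ h)
  refine ⟨fun η => ε⁻¹ * (d η - c η), fun η hη => by simp [hc η hη, hd η hη], fun k => ?_⟩
  simp only [mul_assoc, sub_mul, ← Finset.mul_sum, Finset.sum_sub_distrib, hc', hd']
  simp only [Pi.add_apply, Pi.smul_apply, smul_eq_mul, add_sub_cancel_left]
  rw [inv_mul_cancel_left₀ hε.ne']

theorem mem_envelopingSets_of_isYSet (hn : 2 ≤ n) {K : Type*} [Field K] {I J : Set (Pair n)}
    (hJI : J ⊆ I) (hY : IsYSet (grassmannCone K n) J)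
    (hJ : relint (lambdaOne n) ⊆ relint (omega J : Set (N n → ℚ))) :
    I ∈ envelopingSets K n := by
  classical
  refine ⟨J, hJI, hY, hJ, fun z hz => ?_⟩
  obtain ⟨p, hp, hp', hpz⟩ := mem_relint_omega_iff.1 hz
  obtain ⟨q, hq, hq'⟩ := exists_sum_mul_weightMatrix_eq hn hJ
    fun k => ∑ η, (if η ∈ I then 1 else 0) * weightMatrix n k η
  obtain ⟨ε, hε, h⟩ := exists_pos_forall_pos_add_mul J p (fun η => -q η) hp
  -- shift a small multiple of the sum of all weights in `I` from `J` to `I`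
  refine mem_relint_omega_iff.2 ⟨fun η => p η - ε * q η + ε * if η ∈ I then 1 else 0,
    fun η hη => ?_, fun η hη => ?_, fun k => ?_⟩
  · dsimp only
    rw [if_pos hη, mul_one]
    by_cases hηJ : η ∈ J
    · have := h η hηJ
      linarith
    · rw [hp' η hηJ, hq η hηJ]
      linarith
  · have hηJ : η ∉ J := fun hc => hη (hJI hc)
    simp [hη, hp' η hηJ, hq η hηJ]
  · simp only [add_mul, sub_mul, mul_assoc, Finset.sum_add_distrib, Finset.sum_sub_distrib,
      ← Finset.mul_sum, hq', hpz]
    ring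

theorem mem_envelopingSets_mono (hn : 2 ≤ n) {K : Type*} [Field K] {I I' : Set (Pair n)}
    (hI : I ∈ envelopingSets K n) (h : I ⊆ I') : I' ∈ envelopingSets K n := by
  obtain ⟨J, hJI, hY, hJ, -⟩ := hI
  exact mem_envelopingSets_of_isYSet hn (hJI.trans h) hY hJ

/-- The complements of the enveloping sets form a simplicial complex, which is realized by the
vectors `v_η`. Two nonnegative expressions of a vector differ by a potential `u`, which pairs to
zero with an interior point of `λ_1`, and this point is a positive combination of the weights
outside of any simplex. -/
theorem isSimplicial_envelopingSets (hn : 2 ≤ n) (K : Type*) [Field K] {m : ℕ}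
    {P : Matrix (Fin m) (Pair n) ℚ} (hP : IsGaleDual (weightMatrix n) P) :
    IsSimplicial P.col {S | Sᶜ ∈ envelopingSets K n} := by
  refine ⟨fun S hS T hT => mem_envelopingSets_mono hn hS (Set.compl_subset_compl.2 hT), ?_⟩
  intro S hS T hT a b ha ha' hb hb' hab
  obtain ⟨u, hu⟩ := (hP.sum_smul_col_eq_zero_iff fun η => a η - b η).1 (by
    simp only [sub_smul, Finset.sum_sub_distrib, hab, sub_self])
  have hsum : ∀ c : Pair n → ℚ, ∑ η, c η * (a η - b η)
      = ∑ k, u k * ∑ η, c η * weightMatrix n k η := by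
    intro c
    simp only [hu, Finset.mul_sum]
    rw [Finset.sum_comm]
    exact Finset.sum_congr rfl fun k _ => Finset.sum_congr rfl fun i _ => by ring
  obtain ⟨J, hJS, -, hJ, hJ'⟩ := hS
  obtain ⟨J₂, -, -, hJ₂, hJ₂'⟩ := hT
  obtain ⟨x, hx⟩ := exists_interior_point hn ⟨1, one_ne_zero_of_two_le hn⟩
  rw [← mem_relint_lambdaOne_iff hn _ rfl] at hx
  -- express a common interior point by the weights outside of `S`, and by those outside of `T`
  obtain ⟨p, hp, hp', hpx⟩ := mem_relint_omega_iff.1 (hJ' (hJ hx))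
  obtain ⟨q, hq, hq', hqx⟩ := mem_relint_omega_iff.1 (hJ₂' (hJ₂ hx))
  have hp0 : ∀ η, p η * a η = 0 := fun η => by
    by_cases hη : η ∈ S
    · rw [hp' η (not_not.2 hη), zero_mul]
    · rw [ha' η hη, mul_zero]
  have hq0 : ∀ η, q η * b η = 0 := fun η => by
    by_cases hη : η ∈ T
    · rw [hq' η (not_not.2 hη), zero_mul]
    · rw [hb' η hη, mul_zero]
  have hpos : ∀ (c : Pair n → ℚ) (S : Set (Pair n)), (∀ η ∈ Sᶜ, 0 < c η) → (∀ η ∉ Sᶜ, c η = 0) →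
      ∀ η, 0 ≤ c η := fun c S h h' η => by
    by_cases hη : η ∈ Sᶜ
    · exact (h η hη).le
    · exact (h' η hη).ge
  have h1 : ∑ η, p η * (a η - b η) = ∑ η, q η * (a η - b η) := by
    simp only [hsum, hpx, hqx]
  simp only [mul_sub, hp0, hq0, zero_sub, sub_zero, Finset.sum_neg_distrib] at h1
  have h2 : 0 ≤ ∑ η, p η * b η := Finset.sum_nonneg fun η _ =>
    mul_nonneg (hpos p S hp hp' η) (hb η)
  have h3 : 0 ≤ ∑ η, q η * a η := Finset.sum_nonneg fun η _ =>
    mul_nonneg (hpos q T hq hq' η) (ha η)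
  have h4 : ∑ η, p η * b η = 0 := by linarith
  have h5 : ∀ η ∈ Sᶜ, a η - b η = 0 := by
    intro η hη
    have := (Finset.sum_eq_zero_iff_of_nonneg fun η _ =>
      mul_nonneg (hpos p S hp hp' η) (hb η)).1 h4 η (Finset.mem_univ _)
    rw [ha' η hη, (mul_eq_zero.1 this).resolve_left (hp η hη).ne', sub_zero]
  -- the potential vanishes on the weights outside of `S`, which span
  obtain ⟨r, hr, hr'⟩ := exists_sum_mul_weightMatrix_eq hn hJ u
  have h6 : ∑ η, r η * (a η - b η) = 0 := Finset.sum_eq_zero fun η _ => by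
    by_cases hη : η ∈ J
    · rw [h5 η (hJS hη), mul_zero]
    · rw [hr η hη, zero_mul]
  rw [hsum] at h6
  simp only [hr'] at h6
  have h7 : ∀ k, u k = 0 := fun k => mul_self_eq_zero.1
    ((Finset.sum_eq_zero_iff_of_nonneg fun k _ => mul_self_nonneg (u k)).1 h6 k (Finset.mem_univ _))
  funext η
  have := hu η
  simp only [h7, zero_mul, Finset.sum_const_zero] at this
  linarith

/-- The pairs not separated by `D ∋ 0` form a simplex, for suitable `D`: the pairs separated by `D`
are a `Y`-set, and an interior point `x` of `λ_1` is a positive combination of their weights. -/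
theorem cut_mem_envelopingSets (hn : 2 ≤ n) (K : Type*) [Field K] (D : Set (Fin (n + 1)))
    (h0 : 0 ∈ D) (hD : D = {0, 1} ∨ 1 ∉ D ∧ ∃ k, k ≠ 1 ∧ k ∉ D) {S : Set (Pair n)}
    (hS : ∀ η ∈ S, (η.1.1 ∈ D ↔ η.1.2 ∈ D)) : Sᶜ ∈ envelopingSets K n := by
  classical
  let o : N n := ⟨1, one_ne_zero_of_two_le hn⟩
  refine mem_envelopingSets_of_isYSet hn (J := {η | ¬ (η.1.1 ∈ D ↔ η.1.2 ∈ D)})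
    (fun η hη hηS => hη (hS η hηS)) ?_ fun x hx => ?_
  · refine ⟨_, ⟨fun i => if i ∈ D then 1 else 0, fun i => if i ∈ D then 0 else 1,
      fun η => rfl⟩, fun η => ?_⟩
    by_cases h1 : η.1.1 ∈ D <;> by_cases h2 : η.1.2 ∈ D <;> simp [h1, h2]
  · rw [mem_relint_lambdaOne_iff hn o rfl] at hx
    obtain ⟨hx1, hx2, hx3⟩ := hx
    set y : Fin (n + 1) → ℚ := fun i => if h : i ≠ 0 then x ⟨i, h⟩ else 0 with hy
    have hyx : ∀ i : N n, y i.1 = x i := fun i => dif_pos i.2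
    have hypos : ∀ i, i ≠ 0 → 0 < y i := fun i hi => (hyx ⟨i, hi⟩).symm ▸ hx1 _
    have hy0 : y 0 = 0 := by simp [hy]
    have hynonneg : ∀ i, 0 ≤ y i := fun i => by
      by_cases hi : i = 0
      · rw [hi, hy0]
      · exact (hypos i hi).le
    have hT : ∑ i, x i = ∑ i, y i := by
      rw [← sum_N_eq y hy0]
      exact Finset.sum_congr rfl fun i _ => (hyx i).symm
    set a := ∑ i, if i ∈ D then y i else 0 with ha
    set b := ∑ i, if i ∈ D then 0 else y i with hb
    have hab : a + b = ∑ i, y i := by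
      rw [ha, hb, ← Finset.sum_add_distrib]
      exact Finset.sum_congr rfl fun i _ => by split_ifs <;> simp
    -- these are the sums of `x` over the two sides of the partition of `N`
    have hlt : a < b := by
      rw [hT] at hx2 hx3
      rcases hD with hD | ⟨h1, k, hk, hkD⟩
      · have h2 : a = x o := by
          have : ∀ i, (if i ∈ D then y i else 0) = if i = 1 then y i else 0 := by
            intro i
            by_cases h3 : i = 0
            · simp [h3, hy0]
            · simp [hD, h3]
          rw [ha, Finset.sum_congr rfl fun i _ => this i]
          simp [← hyx o, o]
        linarith
      · have hk0 : k ≠ 0 := fun h => hkD (h ▸ h0)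
        have h2 := hx3 ⟨k, hk0⟩ fun h => hk (congrArg Subtype.val h)
        have h3 : x o + x ⟨k, hk0⟩ ≤ b := by
          rw [← hyx, ← hyx, hb]
          have h4 : ∑ i ∈ ({1, k} : Finset (Fin (n + 1))), (if i ∈ D then 0 else y i) ≤
              ∑ i, if i ∈ D then 0 else y i :=
            Finset.sum_le_sum_of_subset_of_nonneg (Finset.subset_univ _) fun i _ _ => by
              split_ifs
              · exact le_rfl
              · exact hynonneg i
          rw [Finset.sum_pair hk.symm, if_neg h1, if_neg hkD] at h4
          exact h4
        linarith
    have ha0 : 0 ≤ a := Finset.sum_nonneg fun i _ => by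
      split_ifs
      · exact hynonneg i
      · exact le_rfl
    have hb0 : 0 < b := ha0.trans_lt hlt
    -- the slack `b - a` is assigned to the index `0`
    set z : Fin (n + 1) → ℚ := fun i => if i = 0 then b - a else y i with hz
    have hzpos : ∀ i, 0 < z i := fun i => by
      by_cases hi : i = 0
      · simp only [hz, hi, if_true]
        linarith
      · simp only [hz, hi, if_false]
        exact hypos i hi
    have hzD : ∑ i, (if i ∈ D then z i else 0) = b := by
      have : ∀ i, (if i ∈ D then z i else 0) =
          (if i = 0 then b - a else 0) + if i ∈ D then y i else 0 := by
        intro i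
        by_cases hi : i = 0
        · simp [hi, h0, hy0, hz]
        · simp [hi, hz]
      simp only [this, Finset.sum_add_distrib, ← ha]
      simp
    have hzD' : ∑ i, (if i ∈ D then 0 else z i) = b := by
      refine Finset.sum_congr rfl fun i _ => ?_
      by_cases hi : i = 0
      · simp [hi, h0]
      · simp [hi, hz]
    -- both sides now have the sum `b`, so that the product of `z` with itself has the right margins
    set f : Fin (n + 1) → Fin (n + 1) → ℚ := fun i j =>
      if (i ∈ D ↔ j ∈ D) then 0 else z i * z j / b with hf
    refine mem_relint_omega_iff.2 ⟨fun η => f η.1.1 η.1.2, fun η hη => ?_, fun η hη => ?_,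
      fun k => ?_⟩
    · have h1 : ¬ (η.1.1 ∈ D ↔ η.1.2 ∈ D) := hη
      simp only [hf, h1, if_false]
      exact div_pos (mul_pos (hzpos _) (hzpos _)) hb0
    · have h1 : η.1.1 ∈ D ↔ η.1.2 ∈ D := not_not.1 hη
      simp only [hf, h1, if_true]
    · rw [sum_mul_weightMatrix f (fun i j => ?_) (fun i => by simp [hf])]
      · have hzk : z k = x k := by
          rw [← hyx]
          simp only [hz, k.2, if_false]
        have h1 : ∀ s : Fin (n + 1) → ℚ, ∑ j, s j * (z k / b) = (∑ j, s j) * (z k / b) := fun s =>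
          (Finset.sum_mul _ _ _).symm
        by_cases hk : k.1 ∈ D
        · have h2 : ∀ j, f k j = (if j ∈ D then 0 else z j) * (z k / b) := fun j => by
            simp only [hf, hk, true_iff]
            split_ifs
            · simp
            · ring
          rw [Finset.sum_congr rfl fun j _ => h2 j, h1, hzD', mul_div_cancel₀ _ hb0.ne', hzk]
        · have h2 : ∀ j, f k j = (if j ∈ D then z j else 0) * (z k / b) := fun j => by
            simp only [hf, hk, false_iff]
            split_ifs
            · ring
            · simp
          rw [Finset.sum_congr rfl fun j _ => h2 j, h1, hzD, mul_div_cancel₀ _ hb0.ne', hzk]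
      · simp only [hf, iff_comm (a := i ∈ D), mul_comm (z i)]

/-- The pairs with `0` and the pairs inside one of the blocks `B`, `C` of a partition of `{2, …, n}`
form a simplex: the remaining pairs are those separated by the partition `{1}, B, C` of `N`, they
are a `Y`-set, and an interior point `x` of `λ_1` is a positive combination of their weights,
because the sums of `x` over the three blocks satisfy the strict triangle inequalities. -/
theorem tripartition_mem_envelopingSets (hn : 2 ≤ n) (K : Type*) [Field K] (B : Set (Fin (n + 1)))
    (h0 : 0 ∉ B) (h1 : 1 ∉ B) (hB : ∃ b, b ∈ B) (hC : ∃ c, c ≠ 0 ∧ c ≠ 1 ∧ c ∉ B)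
    {S : Set (Pair n)}
    (hS : ∀ η ∈ S, η.1.1 = 0 ∨ η.1.1 ≠ 1 ∧ η.1.2 ≠ 1 ∧ (η.1.1 ∈ B ↔ η.1.2 ∈ B)) :
    Sᶜ ∈ envelopingSets K n := by
  classical
  let o : N n := ⟨1, one_ne_zero_of_two_le hn⟩
  -- the class of an index; the value at the index `0` plays no role
  let cl : Fin (n + 1) → Fin 3 := fun i => if i = 1 then 0 else if i ∈ B then 1 else 2
  have h10 : (1 : Fin (n + 1)) ≠ 0 := one_ne_zero_of_two_le hn
  refine mem_envelopingSets_of_isYSet hn (J := {η | η.1.1 ≠ 0 ∧ cl η.1.1 ≠ cl η.1.2})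
    (fun η hη hηS => ?_) ?_ fun x hx => ?_
  · rcases hS η hηS with h | ⟨h2, h3, h4⟩
    · exact hη.1 h
    · exact hη.2 (by simp only [cl, h2, h3, if_false, h4])
  · refine ⟨_, ⟨fun i => if i = 0 ∨ i ∈ B then 0 else 1, fun i => if i = 0 ∨ i = 1 then 0 else 1,
      fun η => rfl⟩, fun η => ?_⟩
    have h2 : η.1.2 ≠ 0 := η.snd_ne_zero
    simp only [Set.mem_ofPred_eq, cl]
    by_cases h3 : η.1.1 = 0
    · simp [h3]
    · by_cases h4 : η.1.1 = 1 <;> by_cases h5 : η.1.2 = 1 <;> by_cases h6 : η.1.1 ∈ B <;>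
        by_cases h7 : η.1.2 ∈ B <;> simp_all
  · rw [mem_relint_lambdaOne_iff hn o rfl] at hx
    obtain ⟨hx1, hx2, hx3⟩ := hx
    set y : Fin (n + 1) → ℚ := fun i => if h : i ≠ 0 then x ⟨i, h⟩ else 0 with hy
    have hyx : ∀ i : N n, y i.1 = x i := fun i => dif_pos i.2
    have hypos : ∀ i, i ≠ 0 → 0 < y i := fun i hi => (hyx ⟨i, hi⟩).symm ▸ hx1 _
    have hy0 : y 0 = 0 := by simp [hy]
    have hynonneg : ∀ i, 0 ≤ y i := fun i => by
      by_cases hi : i = 0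
      · rw [hi, hy0]
      · exact (hypos i hi).le
    have hT : ∑ i, x i = ∑ i, y i := by
      rw [← sum_N_eq y hy0]
      exact Finset.sum_congr rfl fun i _ => (hyx i).symm
    set t : Fin 3 → ℚ := fun c => ∑ i, if cl i = c then y i else 0 with ht
    have le_t : ∀ i, y i ≤ t (cl i) := fun i => by
      have h2 := Finset.single_le_sum (f := fun j => if cl j = cl i then y j else 0)
        (fun j _ => by
          split_ifs
          · exact hynonneg j
          · exact le_rfl) (Finset.mem_univ i)
      simpa using h2
    have ht_sum : t 0 + t 1 + t 2 = ∑ i, y i := by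
      rw [ht, ← Finset.sum_add_distrib, ← Finset.sum_add_distrib]
      refine Finset.sum_congr rfl fun i _ => ?_
      generalize cl i = c
      fin_cases c <;> simp
    have ht0 : t 0 = y 1 := by
      have h2 : ∀ i, (if cl i = 0 then y i else 0) = if i = 1 then y i else 0 := fun i => by
        by_cases h2 : i = 1
        · simp [cl, h2]
        · by_cases h3 : i ∈ B <;> simp [cl, h2, h3]
      simp only [ht, h2]
      simp
    obtain ⟨b, hb⟩ := hB
    obtain ⟨c, hc0, hc1, hcB⟩ := hC
    have hb0 : b ≠ 0 := fun h => h0 (h ▸ hb)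
    have hb1 : b ≠ 1 := fun h => h1 (h ▸ hb)
    have hclb : cl b = 1 := by simp [cl, hb1, hb]
    have hclc : cl c = 2 := by simp [cl, hc1, hcB]
    have hb2 := le_t b
    have hc2 := le_t c
    rw [hclb] at hb2
    rw [hclc] at hc2
    have hyo := hyx o
    have hyb := hyx ⟨b, hb0⟩
    have hyc := hyx ⟨c, hc0⟩
    have hxb := hx3 ⟨b, hb0⟩ fun h => hb1 (congrArg Subtype.val h)
    have hxc := hx3 ⟨c, hc0⟩ fun h => hc1 (congrArg Subtype.val h)
    have hto : y o.1 = t 0 := ht0.symm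
    rw [hT, ← hyo] at hx2
    rw [hT, ← hyo, ← hyb] at hxb
    rw [hT, ← hyo, ← hyc] at hxc
    dsimp only at hxb hxc
    set T := ∑ i, y i with hTdef
    have htpos : ∀ c, 0 < t c := by
      intro c
      have h2 := hypos 1 h10
      have h3 := hypos b hb0
      fin_cases c
      · simp only [Fin.zero_eta]
        linarith
      · simp only [Fin.mk_one]
        linarith
      · have := hypos _ hc0
        simp only [Fin.reduceFinMk]
        linarith
    have htri : ∀ c d, c ≠ d → 0 < 2 * t c + 2 * t d - T := by
      intro c d hcd
      fin_cases c <;> fin_cases d <;>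
        simp only [Fin.zero_eta, Fin.mk_one, Fin.reduceFinMk, ne_eq, not_true_eq_false] at hcd ⊢ <;>
        linarith
    -- solve the problem for the three sums, and distribute in proportion to the coordinates of `x`
    set G : Fin 3 → Fin 3 → ℚ := fun c d =>
      if c = d then 0 else (2 * t c + 2 * t d - T) / (2 * t c * t d) with hG
    have hGsum : ∀ c, ∑ d, t d * G c d = 1 := by
      intro c
      have h2 := (htpos 0).ne'
      have h3 := (htpos 1).ne'
      have h4 := (htpos 2).ne'
      rw [Fin.sum_univ_three]
      fin_cases c
      · simp [hG]
        rw [← ht_sum]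
        field_simp
        ring
      · simp [hG]
        rw [← ht_sum]
        field_simp
        ring
      · simp [hG]
        rw [← ht_sum]
        field_simp
        ring
    have hGsymm : ∀ c d, G c d = G d c := fun c d => by
      simp only [hG, eq_comm (a := c)]
      split_ifs
      · rfl
      · ring
    set f : Fin (n + 1) → Fin (n + 1) → ℚ := fun i j => y i * y j * G (cl i) (cl j) with hf
    refine mem_relint_omega_iff.2 ⟨fun η => f η.1.1 η.1.2, fun η hη => ?_, fun η hη => ?_,
      fun k => ?_⟩
    · have h2 : η.1.2 ≠ 0 := η.snd_ne_zero
      have h3 : 0 < G (cl η.1.1) (cl η.1.2) := by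
        simp only [hG, hη.2, if_false]
        have h4 := htpos (cl η.1.1)
        have h5 := htpos (cl η.1.2)
        have h6 := htri _ _ hη.2
        positivity
      exact mul_pos (mul_pos (hypos _ hη.1) (hypos _ h2)) h3
    · by_cases h2 : η.1.1 = 0
      · simp [hf, h2, hy0]
      · have h3 : cl η.1.1 = cl η.1.2 := by
          by_contra h3
          exact hη ⟨h2, h3⟩
        simp [hf, hG, h3]
    · rw [sum_mul_weightMatrix f (fun i j => ?_) (fun i => by simp [hf, hG])]
      · have h2 : ∀ j, f k j = y k * ∑ d, (if cl j = d then y j else 0) * G (cl k) d := fun j => by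
          simp [hf, mul_assoc]
        rw [Finset.sum_congr rfl fun j _ => h2 j, ← Finset.mul_sum, Finset.sum_comm,
          ← hyx k]
        simp only [← Finset.sum_mul]
        rw [hGsum, mul_one]
      · simp only [hf, hGsymm (cl i), mul_comm (y i)]

end Chamber

/-! ### Ultrametrics and their clusters -/

section Ultrametric

variable {n m : ℕ}

/-- A symmetric function on the pairs in `{0, …, n}` that vanishes at the pairs containing `0` and
attains its minimum at least twice on the three pairs in any triple in `{1, …, n}`. -/
structure IsUltra (h : Fin (n + 1) → Fin (n + 1) → ℚ) : Prop where
  symm : ∀ i j, h i j = h j i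
  zero : ∀ i, h 0 i = 0
  ultra : ∀ i j k, i ≠ 0 → j ≠ 0 → k ≠ 0 → i ≠ j → j ≠ k → i ≠ k → min (h i j) (h j k) ≤ h i k

/-- A nonempty subset `C` of `{1, …, n}` is a node of `h` if the values of `h` at pairs leaving `C`
are negative and smaller than the values at pairs inside `C`. These are the vertices of the rooted
tree of `h`, cut off at height `0`. -/
structure IsNode (h : Fin (n + 1) → Fin (n + 1) → ℚ) (C : Finset (Fin (n + 1))) : Prop where
  zero_notMem : 0 ∉ C
  nonempty : C.Nonempty
  neg : ∀ i ∈ C, ∀ k ∉ C, k ≠ 0 → h i k < 0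
  lt : ∀ i ∈ C, ∀ k ∉ C, k ≠ 0 → ∀ i' ∈ C, ∀ j' ∈ C, i' ≠ j' → h i k < h i' j'

/-- A node other than `{1, …, n}`. -/
def IsCluster (h : Fin (n + 1) → Fin (n + 1) → ℚ) (C : Finset (Fin (n + 1))) : Prop :=
  IsNode h C ∧ ∃ k, k ≠ 0 ∧ k ∉ C

variable {h : Fin (n + 1) → Fin (n + 1) → ℚ} {C D : Finset (Fin (n + 1))}

/-- A level that separates the values inside `C` from those across `C`. -/
theorem IsNode.exists_level (hC : IsNode h C) : ∃ l : ℚ, l ≤ 0 ∧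
    (∀ i ∈ C, ∀ k ∉ C, k ≠ 0 → h i k < l) ∧ (∀ i ∈ C, ∀ j ∈ C, i ≠ j → l ≤ h i j) ∧
    (l = 0 ∨ ∃ i ∈ C, ∃ j ∈ C, i ≠ j ∧ h i j = l) := by
  by_cases h1 : ∀ i ∈ C, ∀ j ∈ C, i ≠ j → 0 ≤ h i j
  · exact ⟨0, le_rfl, hC.neg, h1, Or.inl rfl⟩
  · push Not at h1
    obtain ⟨i, hi, j, hj, hij, hneg⟩ := h1
    obtain ⟨p, hp, hmin⟩ := Finset.exists_min_image C.offDiag (fun p => h p.1 p.2)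
      ⟨(i, j), Finset.mem_offDiag.2 ⟨hi, hj, hij⟩⟩
    obtain ⟨hp1, hp2, hp3⟩ := Finset.mem_offDiag.1 hp
    refine ⟨h p.1 p.2, ?_, fun i hi k hk hk0 => hC.lt i hi k hk hk0 _ hp1 _ hp2 hp3,
      fun i hi j hj hij => hmin (i, j) (Finset.mem_offDiag.2 ⟨hi, hj, hij⟩),
      Or.inr ⟨_, hp1, _, hp2, hp3, rfl⟩⟩
    exact (hmin (i, j) (Finset.mem_offDiag.2 ⟨hi, hj, hij⟩)).trans hneg.le

/-- Two nodes are nested or disjoint. -/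
theorem IsNode.subset_or_subset_or_disjoint (hC : IsNode h C) (hD : IsNode h D) :
    C ⊆ D ∨ D ⊆ C ∨ ∀ i ∈ C, i ∉ D := by
  by_contra! hc
  obtain ⟨h1, h2, i, hiC, hiD⟩ := hc
  obtain ⟨j, hjC, hjD⟩ := Finset.not_subset.1 h1
  obtain ⟨k, hkD, hkC⟩ := Finset.not_subset.1 h2
  have hij : i ≠ j := fun h => hjD (h ▸ hiD)
  have hik : i ≠ k := fun h => hkC (h ▸ hiC)
  have hj0 : j ≠ 0 := fun h => hC.zero_notMem (h ▸ hjC)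
  have hk0 : k ≠ 0 := fun h => hD.zero_notMem (h ▸ hkD)
  have h3 := hC.lt i hiC k hkC hk0 i hiC j hjC hij
  have h4 := hD.lt i hiD j hjD hj0 i hiD k hkD hik
  exact lt_asymm h3 h4

theorem IsUltra.le_of_mem_ball (hh : IsUltra h) {j : Fin (n + 1)} (hj : j ≠ 0) {t : ℚ}
    (hC : ∀ k, k ∈ C ↔ k ≠ 0 ∧ (k = j ∨ t ≤ h j k)) {i i' : Fin (n + 1)} (hi : i ∈ C)
    (hi' : i' ∈ C) (hii' : i ≠ i') : t ≤ h i i' := by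
  obtain ⟨hi0, rfl | hi⟩ := (hC i).1 hi
  · exact (((hC i').1 hi').2.resolve_left hii'.symm)
  · obtain ⟨hi'0, rfl | hi'⟩ := (hC i').1 hi'
    · rwa [hh.symm]
    · by_cases hij : i = j
      · exact hij ▸ hi'
      · by_cases hi'j : i' = j
        · rw [hi'j, hh.symm]
          exact hi
        · refine (le_min ?_ hi').trans (hh.ultra i j i' hi0 hj hi'0 hij (Ne.symm hi'j) hii')
          rwa [hh.symm]

/-- The closed balls of nonpositive radius are nodes. -/
theorem IsUltra.isNode_ball (hh : IsUltra h) {j : Fin (n + 1)} (hj : j ≠ 0) {t : ℚ} (ht : t ≤ 0)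
    (hC : ∀ k, k ∈ C ↔ k ≠ 0 ∧ (k = j ∨ t ≤ h j k)) : IsNode h C := by
  have h2 : ∀ i ∈ C, ∀ k ∉ C, k ≠ 0 → h i k < t := by
    intro i hi k hk hk0
    rw [hC] at hk
    push Not at hk
    obtain ⟨hkj, hk⟩ := hk hk0
    by_cases hij : i = j
    · exact hij ▸ hk
    · have h3 := ((hC i).1 hi).2.resolve_left hij
      have hik : i ≠ k := fun h => (not_le.2 hk) (h ▸ h3)
      have h4 := hh.ultra j i k hj ((hC i).1 hi).1 hk0 (Ne.symm hij) hik (Ne.symm hkj)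
      rcases min_le_iff.1 h4 with h5 | h5
      · exact absurd (h3.trans h5) (not_le.2 hk)
      · exact h5.trans_lt hk
  exact ⟨fun h => ((hC 0).1 h).1 rfl, ⟨j, (hC j).2 ⟨hj, Or.inl rfl⟩⟩,
    fun i hi k hk hk0 => (h2 i hi k hk hk0).trans_le ht,
    fun i hi k hk hk0 i' hi' j' hj' hij =>
      (h2 i hi k hk hk0).trans_le (hh.le_of_mem_ball hj hC hi' hj' hij)⟩

/-- The combination of the `v_η` whose coefficients are the values of `f`. -/
def vec (P : Matrix (Fin m) (Pair n) ℚ) (f : Fin (n + 1) → Fin (n + 1) → ℚ) : Fin m → ℚ :=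
  ∑ η : Pair n, f η.1.1 η.1.2 • P.col η

variable {P : Matrix (Fin m) (Pair n) ℚ}

theorem vec_eq_vec_iff (hP : IsGaleDual (weightMatrix n) P)
    {f g : Fin (n + 1) → Fin (n + 1) → ℚ} : vec P f = vec P g ↔
      ∃ u : Fin (n + 1) → ℚ, u 0 = 0 ∧
        ∀ η : Pair n, f η.1.1 η.1.2 = g η.1.1 η.1.2 + (u η.1.1 + u η.1.2) := by
  rw [← sub_eq_zero, vec, vec, ← Finset.sum_sub_distrib]
  simp only [← sub_smul]
  rw [sum_smul_col_eq_zero_iff hP]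
  simp only [sub_eq_iff_eq_add']

theorem exists_symm_eq (d : Pair n → ℚ) : ∃ f : Fin (n + 1) → Fin (n + 1) → ℚ,
    (∀ i j, f i j = f j i) ∧ ∀ η : Pair n, f η.1.1 η.1.2 = d η := by
  refine ⟨fun i j => if hij : i < j then d ⟨(i, j), hij⟩ else if hij : j < i then d ⟨(j, i), hij⟩
    else 0, fun i j => ?_, fun η => ?_⟩
  · rcases lt_trichotomy i j with hij | rfl | hij
    · simp [hij, hij.not_gt]
    · simp
    · simp [hij, hij.not_gt]
  · simp [η.2]

/-- Every vector is `vec P g` for a function `g` that vanishes at the pairs containing `0`. -/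
theorem exists_vec_eq (hP : IsGaleDual (weightMatrix n) P) (y : Fin m → ℚ) :
    ∃ g : Fin (n + 1) → Fin (n + 1) → ℚ, (∀ i j, g i j = g j i) ∧ (∀ i, g 0 i = 0) ∧
      vec P g = y := by
  obtain ⟨d, rfl⟩ := hP.exists_sum_smul_col_eq y
  obtain ⟨f, hf, hf'⟩ := exists_symm_eq d
  have h1 : ∑ η, d η • P.col η = vec P f :=
    Finset.sum_congr rfl fun η _ => by rw [hf']
  refine ⟨fun i j => if i = 0 ∨ j = 0 then 0 else f i j - f 0 i - f 0 j, fun i j => ?_, by simp, ?_⟩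
  · simp only [or_comm (a := i = 0), hf i j]
    split_ifs <;> ring
  · rw [h1, vec_eq_vec_iff hP]
    refine ⟨fun i => if i = 0 then 0 else -f 0 i, by simp, fun η => ?_⟩
    have h2 : η.1.2 ≠ 0 := η.snd_ne_zero
    by_cases h3 : η.1.1 = 0
    · simp [h3, h2]
    · simp only [h3, h2, or_self, if_false]
      ring

/-- The function with value `-1` at the pairs in `{1, …, n}` that `C` separates, and `0` elsewhere:
minus the split metric of `C`. -/
def cut (C : Finset (Fin (n + 1))) (i j : Fin (n + 1)) : ℚ :=
  if i ≠ 0 ∧ j ≠ 0 ∧ ¬ (i ∈ C ↔ j ∈ C) then -1 else 0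

/-- The function with value `1` at the pairs `{0, i}`, `i ∈ C`, and `2` at the pairs inside `C`. -/
def block (C : Finset (Fin (n + 1))) (i j : Fin (n + 1)) : ℚ :=
  if i = 0 ∨ j = 0 then (if i ∈ C ∨ j ∈ C then 1 else 0) else if i ∈ C ∧ j ∈ C then 2 else 0

theorem vec_block (hP : IsGaleDual (weightMatrix n) P) (hC : 0 ∉ C) :
    vec P (block C) = vec P (cut C) := by
  rw [vec_eq_vec_iff hP]
  refine ⟨fun i => if i ∈ C then 1 else 0, by simp [hC], fun η => ?_⟩
  have h2 : η.1.2 ≠ 0 := η.snd_ne_zero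
  by_cases h3 : η.1.1 = 0
  · by_cases h5 : η.1.2 ∈ C <;> simp [block, cut, h3, h5, hC]
  · by_cases h4 : η.1.1 ∈ C <;> by_cases h5 : η.1.2 ∈ C <;>
      simp [block, cut, h3, h2, h4, h5]
    norm_num

theorem cut_compl (h : ∀ i, i ≠ 0 → (i ∈ D ↔ i ∉ C)) : cut D = cut C := by
  funext i j
  by_cases hi : i = 0
  · simp [cut, hi]
  · by_cases hj : j = 0
    · simp [cut, hj]
    · simp only [cut, h i hi, h j hj, not_iff_not]

/-- A representation of `vec P h` with positive coefficients by the `v_η`, `η ∈ J`, differs from `h`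
by a nonnegative potential `a`. -/
theorem IsUltra.exists_potential (hP : IsGaleDual (weightMatrix n) P) (hh : IsUltra h)
    {J : Set (Pair n)} (hJ : vec P h ∈ relint (cone P.col J : Set (Fin m → ℚ))) :
    ∃ a : Fin (n + 1) → ℚ, a 0 = 0 ∧ (∀ i, i ≠ 0 → 0 ≤ a i) ∧
      (∀ i j, i ≠ j → 0 ≤ h i j + (a i + a j)) ∧
      ∀ η : Pair n, 0 < h η.1.1 η.1.2 + (a η.1.1 + a η.1.2) → η ∈ J := by
  obtain ⟨c, hc, hc', hch⟩ := mem_relint_cone_iff.1 hJ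
  obtain ⟨f, hf, hfc⟩ := exists_symm_eq c
  have hvec : vec P f = vec P h := by
    rw [← hch]
    exact Finset.sum_congr rfl fun η _ => by rw [hfc]
  obtain ⟨a, ha0, ha⟩ := (vec_eq_vec_iff hP).1 hvec
  have hnonneg : ∀ i j, i ≠ j → 0 ≤ h i j + (a i + a j) :=
    (Pair.forall_iff (p := fun i j => 0 ≤ h i j + (a i + a j)) fun i j hij => by
      rwa [hh.symm, add_comm (a j)]).1 fun η => by
      rw [← ha, hfc]
      by_cases hη : η ∈ J
      · exact (hc η hη).le
      · exact (hc' η hη).ge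
  refine ⟨a, ha0, fun i hi => ?_, hnonneg, fun η hη => ?_⟩
  · have := hnonneg 0 i (Ne.symm hi)
    rwa [hh.zero, ha0, zero_add, zero_add] at this
  · by_contra hηJ
    rw [← ha, hfc, hc' η hηJ] at hη
    exact hη.false

theorem IsUltra.col_mem_gkzCone (hP : IsGaleDual (weightMatrix n) P) (hh : IsUltra h) {η : Pair n}
    (h0 : η.1.1 ≠ 0) (hη : 0 < h η.1.1 η.1.2) : P.col η ∈ gkzCone P.col (vec P h) := by
  rw [mem_gkzCone_iff]
  intro J hJ
  obtain ⟨a, -, ha, -, hmem⟩ := hh.exists_potential hP hJ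
  refine mem_cone (hmem η ?_)
  have h1 := ha _ h0
  have h2 := ha η.1.2 η.snd_ne_zero
  linarith

/-- The cones around an ultrametric point contain the vectors of its clusters: a combination with
positive coefficients of the `v_η`, `η ∈ J`, that represents the point shows either all pairs inside
`{0} ∪ C` or all pairs inside `{0} ∪ (N \ C)` to belong to `J`. -/
theorem IsNode.vec_cut_mem_gkzCone (hP : IsGaleDual (weightMatrix n) P) (hh : IsUltra h)
    (hC : IsNode h C) : vec P (cut C) ∈ gkzCone P.col (vec P h) := by
  rw [mem_gkzCone_iff]
  intro J hJ
  obtain ⟨a, ha0, -, hf_nonneg, hmem⟩ := hh.exists_potential hP hJ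
  -- a block all of whose pairs have positive coefficients
  have of_block : ∀ D : Finset (Fin (n + 1)), 0 ∉ D → (∀ i ∈ D, 0 < a i) →
      (∀ i ∈ D, ∀ j ∈ D, i ≠ j → 0 < h i j + (a i + a j)) → vec P (cut D) ∈ cone P.col J := by
    intro D hD0 hDa hDf
    rw [← vec_block hP hD0]
    refine mem_cone_iff.2 ⟨_, fun η => ?_, fun η hη => ?_, rfl⟩
    · simp only [block]
      split_ifs <;> norm_num
    · have h2 : η.1.2 ≠ 0 := η.snd_ne_zero
      by_contra hne
      apply hη
      apply hmem
      by_cases h3 : η.1.1 = 0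
      · rw [h3, hh.zero, ha0, zero_add, zero_add]
        apply hDa
        by_contra h4
        simp [block, h3, h4, hD0] at hne
      · by_cases h4 : η.1.1 ∈ D ∧ η.1.2 ∈ D
        · exact hDf _ h4.1 _ h4.2 η.2.ne
        · simp [block, h3, h2, h4] at hne
  obtain ⟨l, hl0, hl, hl', -⟩ := hC.exists_level
  -- a small value of the potential inside `C` forces large values outside of `C`
  by_cases hcase : ∃ i ∈ C, a i ≤ -l / 2
  · obtain ⟨i, hi, hai⟩ := hcase
    have hi0 : i ≠ 0 := fun h => hC.zero_notMem (h ▸ hi)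
    set D := Finset.univ.filter fun k => k ≠ 0 ∧ k ∉ C with hD
    have hmemD : ∀ k, k ∈ D ↔ k ≠ 0 ∧ k ∉ C := fun k => by simp [hD]
    rw [← cut_compl (C := C) (D := D) fun i hi => by simp [hmemD, hi]]
    have hak : ∀ k ∈ D, -h i k - a i ≤ a k := fun k hk => by
      have hik : i ≠ k := fun h => ((hmemD k).1 hk).2 (h ▸ hi)
      have h1 := hf_nonneg i k hik
      linarith
    refine of_block D (by simp [hmemD]) (fun k hk => ?_) fun j hj k hk hjk => ?_
    · have h1 := hak k hk
      have h2 := hl i hi k ((hmemD k).1 hk).2 ((hmemD k).1 hk).1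
      linarith
    · have h1 := hak k hk
      have h2 := hak j hj
      have h3 := hl i hi k ((hmemD k).1 hk).2 ((hmemD k).1 hk).1
      have h4 := hl i hi j ((hmemD j).1 hj).2 ((hmemD j).1 hj).1
      have hij : i ≠ j := fun h => ((hmemD j).1 hj).2 (h ▸ hi)
      have hik : i ≠ k := fun h => ((hmemD k).1 hk).2 (h ▸ hi)
      have h5 := hh.ultra j i k ((hmemD j).1 hj).1 hi0 ((hmemD k).1 hk).1 hij.symm hik hjk
      rw [hh.symm j i] at h5
      rcases min_le_iff.1 h5 with h6 | h6 <;> linarith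
  · push Not at hcase
    refine of_block C hC.zero_notMem (fun i hi => ?_) fun i hi j hj hij => ?_
    · have := hcase i hi
      linarith
    · have h1 := hcase i hi
      have h2 := hcase j hj
      have h3 := hl' i hi j hj hij
      linarith

/-- Each node of `h` gives a cone around `vec P h`, and thereby a condition on the points `vec P g`
of `σ(vec P h)`: the function `a` measures the distances from the node. -/
theorem IsNode.exists_distance (hP : IsGaleDual (weightMatrix n) P) (hh : IsUltra h)
    (hC : IsNode h C) {g : Fin (n + 1) → Fin (n + 1) → ℚ} (hg : ∀ i j, g i j = g j i)
    (hg0 : ∀ i, g 0 i = 0) (hy : vec P g ∈ gkzCone P.col (vec P h)) :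
    ∃ a : Fin (n + 1) → ℚ, (∀ i, i ≠ 0 → 0 ≤ a i) ∧
      (∀ i j, i ≠ j → 0 ≤ g i j + (a i + a j)) ∧
      (∀ i ∈ C, ∀ k ∉ C, k ≠ 0 → g i k + (a i + a k) = 0) ∧
      (∀ i ∈ C, ∀ j ∈ C, i ≠ j → h i j ≤ 0 →
        (∀ i' ∈ C, ∀ j' ∈ C, i' ≠ j' → h i j ≤ h i' j') → g i j + (a i + a j) = 0) ∧
      ((∀ i ∈ C, ∀ j ∈ C, i ≠ j → 0 ≤ h i j) → ∀ i ∈ C, a i = 0) := by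
  obtain ⟨l, hl0, hl, hl', hl''⟩ := hC.exists_level
  obtain ⟨c, hc⟩ := hC.nonempty
  have hc0 : c ≠ 0 := fun h => hC.zero_notMem (h ▸ hc)
  have ne_zero : ∀ i ∈ C, i ≠ 0 := fun i hi h => hC.zero_notMem (h ▸ hi)
  have hcross : ∀ i ∈ C, ∀ k ∉ C, k ≠ 0 → h i k = h c k := by
    intro i hi k hk hk0
    by_cases hic : i = c
    · rw [hic]
    · have hik : i ≠ k := fun h => hk (h ▸ hi)
      have hck : c ≠ k := fun h => hk (h ▸ hc)
      have h1 := hl i hi k hk hk0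
      have h2 := hl c hc k hk hk0
      have h3 := hl' i hi c hc hic
      have h4 := hh.ultra i c k (ne_zero i hi) hc0 hk0 hic hck hik
      have h5 := hh.ultra c i k hc0 (ne_zero i hi) hk0 (Ne.symm hic) hik hck
      rw [min_eq_right (by linarith)] at h4
      rw [hh.symm c i, min_eq_right (by linarith)] at h5
      exact le_antisymm h5 h4
  -- the distances from `C` for `h` itself; adding this potential to `h` gives a representation `F`
  -- of `vec P h` that vanishes across `C`, and at those pairs inside `C` where `h` takes the value
  -- `l`
  set α : Fin (n + 1) → ℚ := fun i => if i = 0 then 0 else if i ∈ C then -l / 2 else -h c i + l / 2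
    with hα
  have hα0 : α 0 = 0 := by simp [hα]
  have hα_in : ∀ i ∈ C, α i = -l / 2 := fun i hi => by simp [hα, hi, ne_zero i hi]
  have hα_out : ∀ i ∉ C, i ≠ 0 → α i = -h c i + l / 2 := fun i hi hi0 => by simp [hα, hi, hi0]
  have hα_nonneg : ∀ i, 0 ≤ α i := fun i => by
    by_cases hi0 : i = 0
    · rw [hi0, hα0]
    · by_cases hi : i ∈ C
      · rw [hα_in i hi]
        linarith
      · rw [hα_out i hi hi0]
        have := hl c hc i hi hi0
        linarith
  set F : Fin (n + 1) → Fin (n + 1) → ℚ := fun i j => h i j + (α i + α j) with hF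
  have hF0 : ∀ i, F 0 i = α i := fun i => by simp [hF, hh.zero, hα0]
  have hFsymm : ∀ i j, F i j = F j i := fun i j => by
    simp only [hF, hh.symm i j, add_comm (α i)]
  have hF_in : ∀ i ∈ C, ∀ j ∈ C, F i j = h i j - l := fun i hi j hj => by
    simp only [hF, hα_in i hi, hα_in j hj]
    ring
  have hF_cross : ∀ i ∈ C, ∀ k ∉ C, k ≠ 0 → F i k = 0 := fun i hi k hk hk0 => by
    simp only [hF, hα_in i hi, hα_out k hk hk0, hcross i hi k hk hk0]
    ring
  have hF_nonneg : ∀ i j, i ≠ j → 0 ≤ F i j := by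
    intro i j hij
    by_cases hi0 : i = 0
    · rw [hi0, hF0]
      exact hα_nonneg j
    · by_cases hj0 : j = 0
      · rw [hj0, hFsymm, hF0]
        exact hα_nonneg i
      · by_cases hi : i ∈ C <;> by_cases hj : j ∈ C
        · rw [hF_in i hi j hj]
          linarith [hl' i hi j hj hij]
        · rw [hF_cross i hi j hj hj0]
        · rw [hFsymm, hF_cross j hj i hi hi0]
        · simp only [hF, hα_out i hi hi0, hα_out j hj hj0]
          have h1 := hl c hc i hi hi0
          have h2 := hl c hc j hj hj0
          have hic : i ≠ c := fun h => hi (h ▸ hc)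
          have hcj : c ≠ j := fun h => hj (h ▸ hc)
          have h3 := hh.ultra i c j hi0 hc0 hj0 hic hcj hij
          rw [hh.symm i c] at h3
          rcases min_le_iff.1 h3 with h4 | h4 <;> linarith
  have hrel : vec P h ∈ relint (cone P.col {η | 0 < F η.1.1 η.1.2} : Set (Fin m → ℚ)) := by
    refine mem_relint_cone_iff.2 ⟨fun η => F η.1.1 η.1.2, fun η hη => hη, fun η hη => ?_, ?_⟩
    · exact le_antisymm (not_lt.1 hη) (hF_nonneg _ _ η.2.ne)
    · exact (vec_eq_vec_iff hP).2 ⟨α, hα0, fun η => rfl⟩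
  obtain ⟨d, hd, hd', hdg⟩ := mem_cone_iff.1 (mem_gkzCone_iff.1 hy _ hrel)
  obtain ⟨f, hf, hfd⟩ := exists_symm_eq d
  have hvec : vec P f = vec P g := by
    rw [← hdg]
    exact Finset.sum_congr rfl fun η _ => by rw [hfd]
  obtain ⟨a, ha0, ha⟩ := (vec_eq_vec_iff hP).1 hvec
  have h_nonneg : ∀ i j, i ≠ j → 0 ≤ g i j + (a i + a j) :=
    (Pair.forall_iff (p := fun i j => 0 ≤ g i j + (a i + a j)) fun i j hij => by
      rwa [hg, add_comm (a j)]).1 fun η => by rw [← ha η, hfd]; exact hd η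
  have h_tight : ∀ i j, i ≠ j → F i j = 0 → g i j + (a i + a j) = 0 :=
    (Pair.forall_iff (p := fun i j => F i j = 0 → g i j + (a i + a j) = 0) fun i j hij hF => by
      rw [hg, add_comm (a j)]; exact hij (hFsymm i j ▸ hF)).1 fun η hη => by
        rw [← ha η, hfd]
        exact hd' η fun hc => (hη ▸ hc : (0 : ℚ) < 0).false
  refine ⟨a, fun i hi => ?_, h_nonneg, fun i hi k hk hk0 => ?_, fun i hi j hj hij h1 h2 => ?_,
    fun h1 i hi => ?_⟩
  · have := h_nonneg 0 i (Ne.symm hi)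
    rwa [hg0, ha0, zero_add, zero_add] at this
  · exact h_tight i k (fun h => hk (h ▸ hi)) (hF_cross i hi k hk hk0)
  · apply h_tight i j hij
    rw [hF_in i hi j hj]
    have h3 := hl' i hi j hj hij
    rcases hl'' with h4 | ⟨p, hp, q, hq, hpq, h4⟩
    · linarith
    · have := h2 p hp q hq hpq
      linarith
  · have hl1 : l = 0 := by
      rcases hl'' with h4 | ⟨p, hp, q, hq, hpq, h4⟩
      · exact h4
      · have := h1 p hp q hq hpq
        linarith
    have h2 := h_tight 0 i (Ne.symm (ne_zero i hi)) (by rw [hF0, hα_in i hi, hl1]; simp)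
    rwa [hg0, ha0, zero_add, zero_add] at h2

end Ultrametric

/-! ### Decomposition into cuts -/

section Decomposition

variable {n m : ℕ} {h : Fin (n + 1) → Fin (n + 1) → ℚ} {C D : Finset (Fin (n + 1))}

/-- `D` is the parent of `C` in the rooted tree of `h`. -/
structure IsParent (h : Fin (n + 1) → Fin (n + 1) → ℚ) (C D : Finset (Fin (n + 1))) : Prop where
  isNode : IsNode h D
  ssubset : C ⊂ D
  neg : ∀ j ∈ C, ∀ k ∈ D, k ∉ C → h j k < 0
  le : ∀ j ∈ C, ∀ k ∈ D, k ∉ C → ∀ i' ∈ D, ∀ j' ∈ D, i' ≠ j' → h j k ≤ h i' j'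

theorem IsNode.ne_zero (hC : IsNode h C) {i : Fin (n + 1)} (hi : i ∈ C) : i ≠ 0 :=
  fun h => hC.zero_notMem (h ▸ hi)

theorem IsCluster.exists_isParent (hh : IsUltra h) (hC : IsCluster h C) :
    ∃ D, IsParent h C D := by
  obtain ⟨hC, k₁, hk₁, hk₁C⟩ := hC
  obtain ⟨c, hc⟩ := hC.nonempty
  obtain ⟨k, hk, hmax⟩ := Finset.exists_max_image
    (Finset.univ.filter fun k => k ≠ 0 ∧ k ∉ C) (h c) ⟨k₁, by simp [hk₁, hk₁C]⟩
  simp only [Finset.mem_filter, Finset.mem_univ, true_and] at hk hmax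
  have hneg := hC.neg c hc k hk.2 hk.1
  set D := Finset.univ.filter fun i => i ≠ 0 ∧ (i = c ∨ h c k ≤ h c i) with hD
  have hmem : ∀ i, i ∈ D ↔ i ≠ 0 ∧ (i = c ∨ h c k ≤ h c i) := fun i => by simp [hD]
  have hDn := hh.isNode_ball (hC.ne_zero hc) hneg.le hmem
  have hle : ∀ j ∈ C, ∀ i ∈ D, i ∉ C → h j i ≤ h c k := by
    intro j hj i hi hiC
    have h1 := hmax i ⟨hDn.ne_zero hi, hiC⟩
    by_cases hjc : j = c
    · rwa [hjc]
    · have hji : j ≠ i := fun h => hiC (h ▸ hj)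
      have hci : c ≠ i := fun h => hiC (h ▸ hc)
      have h2 := hh.ultra c j i (hC.ne_zero hc) (hC.ne_zero hj) (hDn.ne_zero hi) (Ne.symm hjc)
        hji hci
      have h3 := hC.lt c hc k hk.2 hk.1 c hc j hj (Ne.symm hjc)
      rcases min_le_iff.1 h2 with h4 | h4 <;> linarith
  refine ⟨D, hDn, ⟨fun i hi => (hmem i).2 ⟨hC.ne_zero hi, ?_⟩, fun hDC => hk.2 (hDC ?_)⟩,
    fun j hj i hi hiC => (hle j hj i hi hiC).trans_lt hneg, fun j hj i hi hiC i' hi' j' hj' hij =>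
      (hle j hj i hi hiC).trans (hh.le_of_mem_ball (hC.ne_zero hc) hmem hi' hj' hij)⟩
  · by_cases hic : i = c
    · exact Or.inl hic
    · exact Or.inr (hC.lt c hc k hk.2 hk.1 c hc i hi (Ne.symm hic)).le
  · exact (hmem k).2 ⟨hk.1, Or.inr le_rfl⟩

theorem IsParent.unique (hC : IsNode h C) {D₁ D₂ : Finset (Fin (n + 1))} (h₁ : IsParent h C D₁)
    (h₂ : IsParent h C D₂) : D₁ = D₂ := by
  obtain ⟨c, hc⟩ := hC.nonempty
  have key : ∀ D₁ D₂, IsParent h C D₁ → IsParent h C D₂ → D₁ ⊆ D₂ → D₂ ⊆ D₁ := by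
    intro D₁ D₂ h₁ h₂ h12 k hk
    by_contra hkD
    obtain ⟨k₁, hk₁, hk₁C⟩ := Finset.exists_of_ssubset h₁.ssubset
    have hck : c ≠ k := fun h => hkD (h ▸ h₁.ssubset.1 hc)
    have hck₁ : c ≠ k₁ := fun h => hk₁C (h ▸ hc)
    have h3 := h₁.isNode.lt c (h₁.ssubset.1 hc) k hkD (h₂.isNode.ne_zero hk) c (h₁.ssubset.1 hc)
      k₁ hk₁ hck₁
    have h4 := h₂.le c hc k₁ (h12 hk₁) hk₁C c (h₂.ssubset.1 hc) k hk hck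
    exact not_le.2 h3 h4
  rcases h₁.isNode.subset_or_subset_or_disjoint h₂.isNode with h3 | h3 | h3
  · exact h3.antisymm (key D₁ D₂ h₁ h₂ h3)
  · exact (key D₂ D₁ h₂ h₁ h3).antisymm h3
  · exact absurd (h₂.ssubset.1 hc) (h3 c (h₁.ssubset.1 hc))

/-- A node `C` with a negative value inside is the parent of the cluster below `C` that contains a
given element `j`. -/
theorem IsNode.exists_child (hh : IsUltra h) (hC : IsNode h C)
    (hneg : ∃ p ∈ C, ∃ q ∈ C, p ≠ q ∧ h p q < 0) {j : Fin (n + 1)} (hj : j ∈ C) :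
    ∃ C', IsCluster h C' ∧ j ∈ C' ∧ IsParent h C' C := by
  classical
  obtain ⟨p₁, hp₁, q₁, hq₁, hpq₁, hneg₁⟩ := hneg
  obtain ⟨⟨p, q⟩, hpq, hmin⟩ := Finset.exists_min_image C.offDiag (fun p => h p.1 p.2)
    ⟨(p₁, q₁), Finset.mem_offDiag.2 ⟨hp₁, hq₁, hpq₁⟩⟩
  obtain ⟨hp, hq, hpq⟩ := Finset.mem_offDiag.1 hpq
  dsimp only at hp hq hpq hmin
  have hmin' : ∀ i ∈ C, ∀ k ∈ C, i ≠ k → h p q ≤ h i k := fun i hi k hk hik =>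
    hmin (i, k) (Finset.mem_offDiag.2 ⟨hi, hk, hik⟩)
  have hl : h p q < 0 := (hmin' _ hp₁ _ hq₁ hpq₁).trans_lt hneg₁
  set C' := C.filter fun k => k = j ∨ h p q < h j k with hC'
  have hmem : ∀ k, k ∈ C' ↔ k ∈ C ∧ (k = j ∨ h p q < h j k) := fun k => by simp [hC']
  have hjC' : j ∈ C' := (hmem j).2 ⟨hj, Or.inl rfl⟩
  have hsub : C' ⊆ C := Finset.filter_subset _ _
  have hin : ∀ i ∈ C', ∀ k ∈ C', i ≠ k → h p q < h i k := by
    intro i hi k hk hik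
    rcases ((hmem i).1 hi).2 with rfl | h1
    · exact ((hmem k).1 hk).2.resolve_left hik.symm
    · rcases ((hmem k).1 hk).2 with rfl | h2
      · rwa [hh.symm i]
      · by_cases hij : i = j
        · exact hij ▸ h2
        · by_cases hkj : k = j
          · rw [hkj, hh.symm i]
            exact h1
          · refine (lt_min ?_ h2).trans_le (hh.ultra i j k (hC.ne_zero (hsub hi))
              (hC.ne_zero hj) (hC.ne_zero (hsub hk)) hij (Ne.symm hkj) hik)
            rwa [hh.symm i]
  have hout : ∀ i ∈ C', ∀ k ∈ C, k ∉ C' → h i k ≤ h p q := by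
    intro i hi k hk hkC'
    have h1 : k ≠ j ∧ h j k ≤ h p q := by
      by_contra hc
      apply hkC'
      rw [hmem]
      refine ⟨hk, ?_⟩
      by_contra hc'
      push Not at hc'
      exact hc hc'
    by_cases hij : i = j
    · rw [hij]
      exact h1.2
    · have h2 := ((hmem i).1 hi).2.resolve_left hij
      have hik : i ≠ k := fun h => hkC' (h ▸ hi)
      have h3 := hh.ultra j i k (hC.ne_zero hj) (hC.ne_zero (hsub hi)) (hC.ne_zero hk)
        (Ne.symm hij) hik h1.1.symm
      rcases min_le_iff.1 h3 with h4 | h4 <;> linarith [h1.2]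
  have hout' : ∀ i ∈ C', ∀ k ∉ C', k ≠ 0 → h i k ≤ h p q := by
    intro i hi k hk hk0
    by_cases hkC : k ∈ C
    · exact hout i hi k hkC hk
    · exact (hC.lt i (hsub hi) k hkC hk0 p hp q hq hpq).le
  have hss : C' ⊂ C := by
    refine ⟨hsub, fun hc => ?_⟩
    exact (hin p (hc hp) q (hc hq) hpq).false
  obtain ⟨k, hk, hkC'⟩ := Finset.exists_of_ssubset hss
  refine ⟨C', ⟨⟨fun h0 => hC.zero_notMem (hsub h0), ⟨j, hjC'⟩,
    fun i hi k hk hk0 => (hout' i hi k hk hk0).trans_lt hl,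
    fun i hi k hk hk0 i' hi' j' hj' hij => (hout' i hi k hk hk0).trans_lt (hin i' hi' j' hj' hij)⟩,
    k, hC.ne_zero hk, hkC'⟩, hjC', hC, hss, fun i hi k hk hkC' => (hout i hi k hk hkC').trans_lt hl,
    fun i hi k hk hkC' i' hi' j' hj' hij => (hout i hi k hk hkC').trans (hmin' i' hi' j' hj' hij)⟩

/-- A node that is strictly contained in `C` and meets a child `C'` of `C` lies in `C'`. -/
theorem IsParent.ssubset_iff {C' C'' : Finset (Fin (n + 1))} (hp : IsParent h C' C)
    (hC' : IsNode h C') (hC'' : IsNode h C'') {j : Fin (n + 1)} (hj' : j ∈ C') (hj'' : j ∈ C'') :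
    C'' ⊂ C ↔ C'' = C' ∨ C'' ⊂ C' := by
  constructor
  · intro hss
    rcases hC''.subset_or_subset_or_disjoint hC' with h1 | h1 | h1
    · exact h1.eq_or_ssubset
    · by_contra hc
      push Not at hc
      have h2 : ¬ C'' ⊆ C' := fun h2 => hc.1 (h2.antisymm h1)
      obtain ⟨k, hk, hkC'⟩ := Finset.not_subset.1 h2
      obtain ⟨k₂, hk₂, hk₂C⟩ := Finset.exists_of_ssubset hss
      have hjk : j ≠ k := fun h => hkC' (h ▸ hj')
      have hjk₂ : j ≠ k₂ := fun h => hk₂C (h ▸ hj'')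
      have h3 := hC''.lt j hj'' k₂ hk₂C (hp.isNode.ne_zero hk₂) j hj'' k hk hjk
      have h4 := hp.le j hj' k (hss.1 hk) hkC' j (hss.1 hj'') k₂ hk₂ hjk₂
      exact not_le.2 h3 h4
    · exact absurd hj' (h1 j hj'')
  · rintro (rfl | h1)
    · exact hp.ssubset
    · exact h1.trans hp.ssubset

open Classical in
/-- The points `vec P g` of the cone `σ(vec P h)` are combinations of the cuts belonging to the
clusters of `h` and of the vectors `v_{ij}` with `h i j > 0`. The coefficient of a cluster is the
length of the edge between the cluster and its parent, and distances are telescoping sums of these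
lengths. -/
theorem IsUltra.exists_cut_decomposition {P : Matrix (Fin m) (Pair n) ℚ}
    (hP : IsGaleDual (weightMatrix n) P) (hh : IsUltra h)
    {g : Fin (n + 1) → Fin (n + 1) → ℚ} (hg : ∀ i j, g i j = g j i)
    (hg0 : ∀ i, g 0 i = 0) (hy : vec P g ∈ gkzCone P.col (vec P h)) :
    ∃ b : Finset (Fin (n + 1)) → ℚ, (∀ C, IsCluster h C → 0 ≤ b C) ∧
      ∀ i j, i ≠ 0 → j ≠ 0 → i ≠ j → ∃ r : ℚ, 0 ≤ r ∧ (h i j ≤ 0 → r = 0) ∧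
        g i j = r + ∑ C with IsCluster h C, b C * cut C i j := by
  choose! a ha_nonneg ha_le ha_cross ha_tight ha_zero using
    fun (C : Finset (Fin (n + 1))) (hC : IsNode h C) => hC.exists_distance hP hh hg hg0 hy
  choose! par hpar using fun (C : Finset (Fin (n + 1))) (hC : IsCluster h C) =>
    hC.exists_isParent hh
  choose! c hc using fun (C : Finset (Fin (n + 1))) (hC : IsNode h C) => hC.nonempty
  -- the edge length does not depend on the chosen element of the cluster, as `hb_eq` shows
  set b : Finset (Fin (n + 1)) → ℚ := fun C => a (par C) (c C) - a C (c C) with hb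
  have hadd : ∀ C D, IsNode h C → IsParent h C D → ∀ j ∈ C, ∀ k ∉ C, k ≠ 0 →
      a C j + a C k = a D j + a D k := by
    intro C D hC hD j hj k hk hk0
    have h1 := ha_cross C hC j hj k hk hk0
    have h2 : g j k + (a D j + a D k) = 0 := by
      by_cases hkD : k ∈ D
      · exact ha_tight D hD.isNode j (hD.ssubset.1 hj) k hkD (fun h => hk (h ▸ hj))
          (hD.neg j hj k hkD hk).le (hD.le j hj k hkD hk)
      · exact ha_cross D hD.isNode j (hD.ssubset.1 hj) k hkD hk0
    linarith
  have hb_eq : ∀ C, IsCluster h C → ∀ j ∈ C, a (par C) j - a C j = b C := by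
    intro C hC j hj
    obtain ⟨k, hk0, hk⟩ := hC.2
    have h1 := hadd C _ hC.1 (hpar C hC) j hj k hk hk0
    have h2 := hadd C _ hC.1 (hpar C hC) _ (hc C hC.1) k hk hk0
    simp only [hb]
    linarith
  have hb_nonneg : ∀ C, IsCluster h C → 0 ≤ b C := by
    intro C hC
    by_cases h1 : ∀ i ∈ C, ∀ j ∈ C, i ≠ j → 0 ≤ h i j
    · have h2 := ha_zero C hC.1 h1 _ (hc C hC.1)
      have h3 := ha_nonneg _ (hpar C hC).isNode (c C) (hC.1.ne_zero (hc C hC.1))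
      simp only [hb, h2, sub_zero]
      exact h3
    · push Not at h1
      obtain ⟨i, hi, j, hj, hij, hneg⟩ := h1
      obtain ⟨⟨p, q⟩, hpq, hmin⟩ := Finset.exists_min_image C.offDiag (fun p => h p.1 p.2)
        ⟨(i, j), Finset.mem_offDiag.2 ⟨hi, hj, hij⟩⟩
      obtain ⟨hp, hq, hpq⟩ := Finset.mem_offDiag.1 hpq
      have hmin' : ∀ i ∈ C, ∀ k ∈ C, i ≠ k → h p q ≤ h i k := fun i hi k hk hik =>
        hmin (i, k) (Finset.mem_offDiag.2 ⟨hi, hk, hik⟩)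
      have h2 := ha_tight C hC.1 p hp q hq hpq ((hmin' _ hi _ hj hij).trans hneg.le) hmin'
      have h3 := ha_le _ (hpar C hC).isNode p q hpq
      have h4 := hb_eq C hC p hp
      have h5 := hb_eq C hC q hq
      linarith
  -- the distance from a node to an element is the sum of the edge lengths along the path
  have tele : ∀ N : ℕ, ∀ C, IsNode h C → C.card ≤ N → ∀ j ∈ C,
      a C j = ∑ C' with IsCluster h C' ∧ j ∈ C' ∧ C' ⊂ C, b C' := by
    intro N
    induction N with
    | zero =>
      intro C hC hN
      exact absurd (Finset.card_pos.2 hC.nonempty) (by omega)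
    | succ N ih =>
      intro C hC hN j hj
      by_cases h1 : ∀ i ∈ C, ∀ j ∈ C, i ≠ j → 0 ≤ h i j
      · rw [ha_zero C hC h1 j hj, Finset.sum_eq_zero]
        intro C' hC'
        simp only [Finset.mem_filter, Finset.mem_univ, true_and] at hC'
        obtain ⟨hC', hj', hss⟩ := hC'
        obtain ⟨k, hk, hkC'⟩ := Finset.exists_of_ssubset hss
        have h2 := hC'.1.neg j hj' k hkC' (hC.ne_zero hk)
        exact absurd (h1 j hj k hk fun h => hkC' (h ▸ hj')) (not_le.2 h2)
      · push Not at h1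
        obtain ⟨C', hC', hj', hp⟩ := hC.exists_child hh h1 hj
        have hpC : par C' = C := IsParent.unique hC'.1 (hpar C' hC') hp
        have h2 := hb_eq C' hC' j hj'
        rw [hpC] at h2
        have h3 := ih C' hC'.1 (by have := Finset.card_lt_card hp.ssubset; omega) j hj'
        have h4 : (Finset.univ.filter fun C'' => IsCluster h C'' ∧ j ∈ C'' ∧ C'' ⊂ C) =
            insert C' (Finset.univ.filter fun C'' => IsCluster h C'' ∧ j ∈ C'' ∧ C'' ⊂ C') := by
          ext C''
          simp only [Finset.mem_filter, Finset.mem_univ, true_and, Finset.mem_insert]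
          constructor
          · rintro ⟨h5, h6, h7⟩
            rcases (hp.ssubset_iff hC'.1 h5.1 hj' h6).1 h7 with h8 | h8
            · exact Or.inl h8
            · exact Or.inr ⟨h5, h6, h8⟩
          · rintro (rfl | ⟨h5, h6, h7⟩)
            · exact ⟨hC', hj', hp.ssubset⟩
            · exact ⟨h5, h6, h7.trans hp.ssubset⟩
        rw [h4, Finset.sum_insert (by simp), ← h3]
        linarith
  refine ⟨b, hb_nonneg, fun i j hi0 hj0 hij => ?_⟩
  have hsum : ∑ C with IsCluster h C, b C * cut C i j =
      -∑ C with IsCluster h C ∧ ¬ (i ∈ C ↔ j ∈ C), b C := by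
    rw [← Finset.filter_filter, Finset.sum_filter (fun C => ¬ (i ∈ C ↔ j ∈ C)),
      ← Finset.sum_neg_distrib]
    refine Finset.sum_congr rfl fun C _ => ?_
    by_cases h1 : i ∈ C ↔ j ∈ C <;> simp [cut, h1, hi0, hj0]
  -- the smallest node that contains `i` and `j`
  set C := Finset.univ.filter fun k => k ≠ 0 ∧ (k = i ∨ min (h i j) 0 ≤ h i k) with hC
  have hmem : ∀ k, k ∈ C ↔ k ≠ 0 ∧ (k = i ∨ min (h i j) 0 ≤ h i k) := fun k => by simp [hC]
  have hCn : IsNode h C := hh.isNode_ball hi0 (min_le_right _ _) hmem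
  have hiC : i ∈ C := (hmem i).2 ⟨hi0, Or.inl rfl⟩
  have hjC : j ∈ C := (hmem j).2 ⟨hj0, Or.inr (min_le_left _ _)⟩
  have hle : ∀ i' ∈ C, ∀ j' ∈ C, i' ≠ j' → min (h i j) 0 ≤ h i' j' :=
    fun i' hi' j' hj' hij' => hh.le_of_mem_ball hi0 hmem hi' hj' hij'
  -- if `h i j < 0`, then the clusters separating `i` and `j` belong to the edges of the path
  -- between them; otherwise no cluster separates them
  by_cases hneg : h i j < 0
  · refine ⟨0, le_rfl, fun _ => rfl, ?_⟩
    rw [min_eq_left hneg.le] at hle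
    have h1 := ha_tight C hCn i hiC j hjC hij hneg.le hle
    have h2 : (Finset.univ.filter fun C' => IsCluster h C' ∧ ¬ (i ∈ C' ↔ j ∈ C')) =
        (Finset.univ.filter fun C' => IsCluster h C' ∧ i ∈ C' ∧ C' ⊂ C) ∪
        (Finset.univ.filter fun C' => IsCluster h C' ∧ j ∈ C' ∧ C' ⊂ C) := by
      have key : ∀ p q, p ∈ C → q ∈ C → ∀ C', IsCluster h C' → p ∈ C' → q ∉ C' → C' ⊂ C := by
        intro p q hpC hqC C' hC' hp hq
        rcases hC'.1.subset_or_subset_or_disjoint hCn with h3 | h3 | h3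
        · exact ⟨h3, fun hc => hq (hc hqC)⟩
        · exact absurd (h3 hqC) hq
        · exact absurd hpC (h3 p hp)
      have key' : ∀ C', IsCluster h C' → C' ⊂ C → i ∈ C' → j ∉ C' := by
        intro C' hC' hss hi hj
        obtain ⟨k, hk, hkC'⟩ := Finset.exists_of_ssubset hss
        have hik : i ≠ k := fun h => hkC' (h ▸ hi)
        exact not_le.2 (hC'.1.lt i hi k hkC' (hCn.ne_zero hk) i hi j hj hij) (hle i hiC k hk hik)
      ext C'
      simp only [Finset.mem_filter, Finset.mem_univ, true_and, Finset.mem_union]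
      constructor
      · rintro ⟨hC', hsep⟩
        by_cases hi : i ∈ C'
        · have hj : j ∉ C' := fun hj => hsep ⟨fun _ => hj, fun _ => hi⟩
          exact Or.inl ⟨hC', hi, key i j hiC hjC C' hC' hi hj⟩
        · have hj : j ∈ C' := by
            by_contra hj
            exact hsep ⟨fun h => absurd h hi, fun h => absurd h hj⟩
          exact Or.inr ⟨hC', hj, key j i hjC hiC C' hC' hj hi⟩
      · rintro (⟨hC', hi, hss⟩ | ⟨hC', hj, hss⟩)
        · exact ⟨hC', fun hc => key' C' hC' hss hi (hc.1 hi)⟩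
        · exact ⟨hC', fun hc => key' C' hC' hss (hc.2 hj) hj⟩
    have h3 : Disjoint (Finset.univ.filter fun C' => IsCluster h C' ∧ i ∈ C' ∧ C' ⊂ C)
        (Finset.univ.filter fun C' => IsCluster h C' ∧ j ∈ C' ∧ C' ⊂ C) := by
      rw [Finset.disjoint_left]
      intro C' h4 h5
      simp only [Finset.mem_filter, Finset.mem_univ, true_and] at h4 h5
      obtain ⟨k, hk, hkC'⟩ := Finset.exists_of_ssubset h4.2.2
      have hik : i ≠ k := fun h => hkC' (h ▸ h4.2.1)
      exact not_le.2 (h4.1.1.lt i h4.2.1 k hkC' (hCn.ne_zero hk) i h4.2.1 j h5.2.1 hij)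
        (hle i hiC k hk hik)
    rw [hsum, h2, Finset.sum_union h3, ← tele _ C hCn le_rfl i hiC, ← tele _ C hCn le_rfl j hjC]
    linarith
  · rw [not_lt] at hneg
    rw [min_eq_right hneg] at hle
    have h1 := ha_zero C hCn hle
    have h2 := ha_le C hCn i j hij
    rw [h1 i hiC, h1 j hjC, add_zero, add_zero] at h2
    refine ⟨g i j, h2, fun h3 => ?_, ?_⟩
    · have h4 : h i j = 0 := le_antisymm h3 hneg
      have h5 := ha_tight C hCn i hiC j hjC hij h3 (by rw [h4]; exact hle)
      rwa [h1 i hiC, h1 j hjC, add_zero, add_zero] at h5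
    · rw [hsum, Finset.sum_eq_zero, neg_zero, add_zero]
      intro C' hC'
      simp only [Finset.mem_filter, Finset.mem_univ, true_and] at hC'
      obtain ⟨hC', hsep⟩ := hC'
      exfalso
      by_cases hi : i ∈ C'
      · have hj : j ∉ C' := fun hj => hsep ⟨fun _ => hj, fun _ => hi⟩
        exact not_lt.2 hneg (hC'.1.neg i hi j hj hj0)
      · have hj : j ∈ C' := by
          by_contra hj
          exact hsep ⟨fun h => absurd h hi, fun h => absurd h hj⟩
        have := hC'.1.neg j hj i hi hi0
        rw [hh.symm] at this
        exact not_lt.2 hneg this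

end Decomposition

/-! ### True two-block partitions -/

section Partitions

variable {n m : ℕ}

theorem exists_ne_mem_of_two_le_card {α : Type*} {s : Finset α} (hs : 2 ≤ s.card) (a : α) :
    ∃ b ∈ s, b ≠ a := by
  obtain ⟨b, hb, c, hc, hbc⟩ := Finset.one_lt_card.1 hs
  by_cases h : b = a
  · exact ⟨c, hc, fun h' => hbc (h.trans h'.symm)⟩
  · exact ⟨b, hb, h⟩

theorem TrueTwoBlock.parts_eq (hn : 2 ≤ n) (R : TrueTwoBlock n) : (∀ i ∈ R.block, i.1 ≠ 1) ∧
    2 ≤ R.block.card ∧ 2 ≤ R.blockᶜ.card ∧ R.1.parts = {R.block, R.blockᶜ} := by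
  classical
  obtain ⟨R, hR, hcard⟩ := R
  let o : N n := ⟨1, one_ne_zero_of_two_le hn⟩
  obtain ⟨B, hB, hoB⟩ := R.exists_mem (Finset.mem_univ o)
  obtain ⟨A, hA, hAB⟩ := exists_ne_mem_of_two_le_card hR.ge B
  have hparts : R.parts = {A, B} := by
    symm
    refine Finset.eq_of_subset_of_card_le ?_ (by rw [hR, Finset.card_pair hAB])
    intro C hC
    rcases Finset.mem_insert.1 hC with rfl | hC
    · exact hA
    · rwa [Finset.mem_singleton.1 hC]
  have hdisj : Disjoint A B := R.disjoint hA hB hAB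
  have hunion : A ∪ B = Finset.univ := by
    have := R.sup_parts
    rw [hparts] at this
    simpa using this
  have hBA : B = Aᶜ := by
    ext i
    rw [Finset.mem_compl]
    constructor
    · exact fun hi hi' => Finset.disjoint_left.1 hdisj hi' hi
    · intro hi
      have := Finset.mem_univ i
      rw [← hunion, Finset.mem_union] at this
      exact this.resolve_left hi
  have hoA : ∀ i ∈ A, i.1 ≠ 1 := by
    intro i hi h1
    have : i = o := Subtype.ext h1
    exact Finset.disjoint_left.1 hdisj hi (this ▸ hoB)
  have hblock : TrueTwoBlock.block ⟨R, hR, hcard⟩ = A := by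
    have h1 : (R.parts.filter fun A => ∀ i ∈ A, i.1 ≠ 1) = {A} := by
      ext C
      rw [hparts, Finset.mem_filter, Finset.mem_insert, Finset.mem_singleton, Finset.mem_singleton]
      constructor
      · rintro ⟨rfl | rfl, h1⟩
        · rfl
        · exact absurd rfl (h1 o hoB)
      · rintro rfl
        exact ⟨Or.inl rfl, hoA⟩
    rw [TrueTwoBlock.block, h1, Finset.sup_singleton, id]
  rw [hblock, ← hBA]
  exact ⟨hoA, hcard A hA, hcard B hB, hparts⟩

/-- The block of `R` that does not contain `1`, as a subset of `{0, …, n}`. -/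
def TrueTwoBlock.side (R : TrueTwoBlock n) : Finset (Fin (n + 1)) := R.block.image Subtype.val

theorem TrueTwoBlock.mem_side {R : TrueTwoBlock n} {i : N n} : i.1 ∈ R.side ↔ i ∈ R.block := by
  simp [TrueTwoBlock.side, i.2]

theorem TrueTwoBlock.zero_notMem_side (R : TrueTwoBlock n) : 0 ∉ R.side := by
  simp [TrueTwoBlock.side]

theorem TrueTwoBlock.one_notMem_side (hn : 2 ≤ n) (R : TrueTwoBlock n) : 1 ∉ R.side := by
  intro h
  obtain ⟨i, hi, hi1⟩ := Finset.mem_image.1 h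
  exact (R.parts_eq hn).1 i hi hi1

theorem TrueTwoBlock.exists_ne_mem_side (hn : 2 ≤ n) (R : TrueTwoBlock n) (i : Fin (n + 1)) :
    ∃ j ∈ R.side, j ≠ i := by
  refine exists_ne_mem_of_two_le_card ?_ i
  rw [TrueTwoBlock.side, Finset.card_image_of_injective _ Subtype.val_injective]
  exact (R.parts_eq hn).2.1

theorem TrueTwoBlock.exists_notMem_side (hn : 2 ≤ n) (R : TrueTwoBlock n) :
    ∃ k, k ≠ 0 ∧ k ≠ 1 ∧ k ∉ R.side := by
  obtain ⟨k, hk, hk1⟩ := exists_ne_mem_of_two_le_card (R.parts_eq hn).2.2.1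
    ⟨1, one_ne_zero_of_two_le hn⟩
  refine ⟨k, k.2, fun h => hk1 (Subtype.ext h), ?_⟩
  rw [TrueTwoBlock.mem_side]
  exact Finset.mem_compl.1 hk

theorem TrueTwoBlock.exists_side_eq (hn : 2 ≤ n) {A : Finset (Fin (n + 1))} (h0 : 0 ∉ A)
    (h1 : 1 ∉ A) (hA : 2 ≤ A.card) (hA' : ∃ k, k ≠ 0 ∧ k ≠ 1 ∧ k ∉ A) :
    ∃ R : TrueTwoBlock n, R.side = A := by
  classical
  obtain ⟨k, hk0, hk1, hkA⟩ := hA'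
  set B : Finset (N n) := Finset.univ.filter fun i => i.1 ∈ A with hB
  have hBA : B.image Subtype.val = A := by
    ext i
    simp only [hB, Finset.mem_image, Finset.mem_filter, Finset.mem_univ, true_and]
    constructor
    · rintro ⟨j, hj, rfl⟩
      exact hj
    · exact fun hi => ⟨⟨i, fun h => h0 (h ▸ hi)⟩, hi, rfl⟩
  have hcard : 2 ≤ B.card := by
    rwa [← hBA, Finset.card_image_of_injective _ Subtype.val_injective] at hA
  have hcard' : 2 ≤ Bᶜ.card := by
    refine Finset.one_lt_card.2 ⟨⟨1, one_ne_zero_of_two_le hn⟩, by simp [hB, h1], ⟨k, hk0⟩,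
      by simp [hB, hkA], fun h => hk1 (congrArg Subtype.val h).symm⟩
  have hne : B ≠ Bᶜ := by
    intro h
    obtain ⟨b, hb⟩ := Finset.card_pos.1 (by omega : 0 < B.card)
    have hb' := hb
    rw [h, Finset.mem_compl] at hb'
    exact hb' hb
  have hbot : ∀ C : Finset (N n), 2 ≤ C.card → C ≠ ∅ := by
    rintro C hC rfl
    simp at hC
  let R : Finpartition (Finset.univ : Finset (N n)) :=
    { parts := {B, Bᶜ}
      supIndep := by
        rw [Finset.supIndep_pair hne]
        exact disjoint_compl_right
      sup_parts := by simp
      bot_notMem := by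
        simp only [Finset.mem_insert, Finset.mem_singleton, not_or]
        exact ⟨(hbot B hcard).symm, (hbot _ hcard').symm⟩ }
  let S : TrueTwoBlock n := ⟨R, Finset.card_pair hne, by
    intro C hC
    rcases Finset.mem_insert.1 hC with rfl | hC
    · exact hcard
    · rwa [Finset.mem_singleton.1 hC]⟩
  refine ⟨S, ?_⟩
  have h2 : S.block ∈ ({B, Bᶜ} : Finset (Finset (N n))) := by
    have h3 : S.1.parts = {B, Bᶜ} := rfl
    rw [← h3, (S.parts_eq hn).2.2.2]
    exact Finset.mem_insert_self _ _
  have h3 : S.block = B := by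
    rcases Finset.mem_insert.1 h2 with h2 | h2
    · exact h2
    · refine absurd rfl ((S.parts_eq hn).1 ⟨1, one_ne_zero_of_two_le hn⟩ ?_)
      rw [Finset.mem_singleton.1 h2, Finset.mem_compl]
      simp [hB, h1]
  rw [TrueTwoBlock.side, h3, hBA]

/-- The generator of the ray `ν_R`. -/
def nuVec (P : Matrix (Fin m) (Pair n) ℚ) (R : TrueTwoBlock n) : Fin m → ℚ :=
  ∑ i ∈ R.block, P.col (zeroPair i) +
    (2 : ℚ) • ∑ η : Pair n with η.elems ⊆ R.block.image Subtype.val, P.col η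

theorem nuVec_eq (P : Matrix (Fin m) (Pair n) ℚ) (R : TrueTwoBlock n) :
    nuVec P R = vec P (block R.side) := by
  classical
  have h0 := R.zero_notMem_side
  have h1 : ∑ i ∈ R.block, P.col (zeroPair i) =
      ∑ η : Pair n, (if η.1.1 = 0 ∧ η.1.2 ∈ R.side then (1 : ℚ) else 0) • P.col η := by
    simp only [ite_smul, one_smul, zero_smul]
    rw [← Finset.sum_filter]
    refine Finset.sum_bij (fun i _ => zeroPair i) (fun i hi => ?_) (fun i _ j _ hij => ?_)
      (fun η hη => ?_) fun i _ => rfl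
    · simp only [Finset.mem_filter, Finset.mem_univ, true_and, zeroPair]
      exact TrueTwoBlock.mem_side.2 hi
    · exact Subtype.ext (congrArg (fun η : Pair n => η.1.2) hij)
    · simp only [Finset.mem_filter, Finset.mem_univ, true_and] at hη
      have h2 : η.1.2 ≠ 0 := η.snd_ne_zero
      refine ⟨⟨η.1.2, h2⟩, TrueTwoBlock.mem_side.1 hη.2, ?_⟩
      exact Subtype.ext (Prod.ext hη.1.symm rfl)
  have h2 : (2 : ℚ) • ∑ η : Pair n with η.elems ⊆ R.block.image Subtype.val, P.col η =
      ∑ η : Pair n, (if η.1.1 ∈ R.side ∧ η.1.2 ∈ R.side then (2 : ℚ) else 0) • P.col η := by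
    rw [Finset.sum_filter, Finset.smul_sum]
    refine Finset.sum_congr rfl fun η _ => ?_
    have h3 : η.elems ⊆ R.block.image Subtype.val ↔ η.1.1 ∈ R.side ∧ η.1.2 ∈ R.side := by
      rw [Pair.elems, Finset.insert_subset_iff, Finset.singleton_subset_iff, TrueTwoBlock.side]
    simp only [h3]
    split_ifs <;> simp
  rw [nuVec, h1, h2, ← Finset.sum_add_distrib, vec]
  refine Finset.sum_congr rfl fun η _ => ?_
  rw [← add_smul]
  congr 1
  have h3 : η.1.2 ≠ 0 := η.snd_ne_zero
  by_cases h4 : η.1.1 = 0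
  · by_cases h5 : η.1.2 ∈ R.side <;> simp [block, h4, h0, h5]
  · simp [block, h4, h3]

/-- The vectors `v_η` together with the generators of the rays `ν_R`. -/
def gen (P : Matrix (Fin m) (Pair n) ℚ) : Pair n ⊕ TrueTwoBlock n → Fin m → ℚ :=
  Sum.elim P.col (nuVec P)

end Partitions

/-! ### The cone of an ultrametric -/

section UltraCone

variable {n m : ℕ} {h : Fin (n + 1) → Fin (n + 1) → ℚ}

/-- One of the two blocks of the partition `{A, N \ A}` is a cluster. -/
def IsSplit (h : Fin (n + 1) → Fin (n + 1) → ℚ) (A : Finset (Fin (n + 1))) : Prop :=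
  ∃ C, IsCluster h C ∧ ((∀ i, i ≠ 0 → (i ∈ C ↔ i ∈ A)) ∨ ∀ i, i ≠ 0 → (i ∈ C ↔ i ∉ A))

/-- The generators of the cone `σ(vec P h)`: the generators of the rays `ν_R` belonging to the true
two-block partitions induced by clusters, the `v_{0i}` for which `{i}` is a cluster, and the
`v_{ij}` with `h i j > 0`. If `n = 2`, then `v_{01} = v_{02}`, and only `v_{01}` is used. -/
def ultraGens (h : Fin (n + 1) → Fin (n + 1) → ℚ) : Set (Pair n ⊕ TrueTwoBlock n) :=
  Sum.inl '' {η | η.1.1 = 0 ∧ (∀ k, k ≠ 0 → k ≠ η.1.2 → h η.1.2 k < 0) ∧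
      (η.1.2 = 1 ∨ ∃ k, k ≠ 0 ∧ k ≠ 1 ∧ k ≠ η.1.2) ∨ η.1.1 ≠ 0 ∧ 0 < h η.1.1 η.1.2} ∪
    Sum.inr '' {R | IsSplit h R.side}

theorem IsSplit.neg (hh : IsUltra h) {A : Finset (Fin (n + 1))} (hA : IsSplit h A)
    {i k : Fin (n + 1)} (hi : i ∈ A) (hi0 : i ≠ 0) (hk : k ∉ A) (hk0 : k ≠ 0) : h i k < 0 := by
  obtain ⟨C, hC, hCA | hCA⟩ := hA
  · exact hC.1.neg i ((hCA i hi0).2 hi) k (fun h => hk ((hCA k hk0).1 h)) hk0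
  · rw [hh.symm]
    exact hC.1.neg k ((hCA k hk0).2 hk) i (fun h => (hCA i hi0).1 h hi) hi0

theorem vec_cut_singleton {P : Matrix (Fin m) (Pair n) ℚ} (hP : IsGaleDual (weightMatrix n) P)
    (i : N n) : vec P (cut {i.1}) = P.col (zeroPair i) := by
  rw [← vec_block hP (by simpa using i.2.symm), vec, Finset.sum_eq_single (zeroPair i)]
  · simp [block, zeroPair]
  · intro η _ hη
    have h3 : η.1.2 ≠ 0 := η.snd_ne_zero
    have h4 : block {i.1} η.1.1 η.1.2 = 0 := by
      by_cases h4 : η.1.1 = 0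
      · have h5 : η.1.2 ≠ i.1 := fun h5 => hη (Subtype.ext (Prod.ext h4 h5))
        simp [block, h4, h5, i.2.symm]
      · have h5 : ¬ (η.1.1 = i.1 ∧ η.1.2 = i.1) := fun h5 => η.2.ne (h5.1.trans h5.2.symm)
        simp [block, h4, h3, h5]
    rw [h4, zero_smul]
  · simp

/-- The cone spanned by the generators contains the vectors of all clusters. -/
theorem IsCluster.vec_cut_mem_cone (hn : 2 ≤ n) {P : Matrix (Fin m) (Pair n) ℚ}
    (hP : IsGaleDual (weightMatrix n) P) (hh : IsUltra h) {C : Finset (Fin (n + 1))}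
    (hC : IsCluster h C) : vec P (cut C) ∈ cone (gen P) (ultraGens h) := by
  classical
  have h10 := one_ne_zero_of_two_le hn
  -- pass to the block that does not contain `1`
  obtain ⟨A, h0A, h1A, hAne, hsplit, hcut⟩ : ∃ A : Finset (Fin (n + 1)), 0 ∉ A ∧ 1 ∉ A ∧
      A.Nonempty ∧ IsSplit h A ∧ cut A = cut C := by
    by_cases h1 : 1 ∈ C
    · obtain ⟨k, hk0, hk⟩ := hC.2
      refine ⟨Finset.univ.filter fun i => i ≠ 0 ∧ i ∉ C, by simp, by simp [h1],
        ⟨k, by simp [hk0, hk]⟩, ⟨C, hC, Or.inr fun i hi => by simp [hi]⟩,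
        cut_compl fun i hi => by simp [hi]⟩
    · exact ⟨C, hC.1.zero_notMem, h1, hC.1.nonempty, ⟨C, hC, Or.inl fun _ _ => Iff.rfl⟩, rfl⟩
  rw [← hcut]
  have neg : ∀ i ∈ A, ∀ k, k ≠ 0 → k ∉ A → h i k < 0 := fun i hi k hk0 hk =>
    hsplit.neg hh hi (fun h => h0A (h ▸ hi)) hk hk0
  have single : ∀ i : N n, (∀ k, k ≠ 0 → k ≠ i.1 → h i.1 k < 0) →
      (i.1 = 1 ∨ ∃ k, k ≠ 0 ∧ k ≠ 1 ∧ k ≠ i.1) →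
      vec P (cut {i.1}) ∈ cone (gen P) (ultraGens h) := by
    intro i hi hi'
    rw [vec_cut_singleton hP]
    exact mem_cone (v := gen P) (i := Sum.inl (zeroPair i))
      (Or.inl ⟨zeroPair i, Or.inl ⟨rfl, hi, hi'⟩, rfl⟩)
  by_cases hk : ∃ k, k ≠ 0 ∧ k ≠ 1 ∧ k ∉ A
  · by_cases hcard : 2 ≤ A.card
    · obtain ⟨R, hR⟩ := TrueTwoBlock.exists_side_eq hn h0A h1A hcard hk
      rw [← vec_block hP h0A, ← hR, ← nuVec_eq]
      have hR' : R ∈ {R : TrueTwoBlock n | IsSplit h R.side} := by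
        rw [Set.mem_ofPred_eq, hR]
        exact hsplit
      exact mem_cone (v := gen P) (i := Sum.inr R) (Or.inr ⟨R, hR', rfl⟩)
    · obtain ⟨i, rfl⟩ := Finset.card_eq_one.1
        (le_antisymm (by omega) (Finset.card_pos.2 hAne))
      have hi0 : i ≠ 0 := fun h => h0A (by simp [h])
      obtain ⟨k, hk0, hk1, hk⟩ := hk
      exact single ⟨i, hi0⟩ (fun k hk0 hki => neg i (Finset.mem_singleton_self i) k hk0 (by simpa))
        (Or.inr ⟨k, hk0, hk1, by simpa using hk⟩)
  · push Not at hk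
    have h2 : cut A = cut {1} := cut_compl fun i hi => by
      rw [Finset.mem_singleton]
      exact ⟨fun h h' => h1A (h' ▸ h), fun h => hk i hi h⟩
    rw [h2]
    refine single ⟨1, h10⟩ (fun k hk0 hk1 => ?_) (Or.inl rfl)
    rw [hh.symm]
    exact neg k (hk k hk0 hk1) 1 h10 h1A

/-- The inclusion from left to right is the decomposition into cuts, and the one from right to left
holds generator by generator. -/
theorem IsUltra.gkzCone_eq (hn : 2 ≤ n) {P : Matrix (Fin m) (Pair n) ℚ}
    (hP : IsGaleDual (weightMatrix n) P) (hh : IsUltra h) :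
    gkzCone P.col (vec P h) = cone (gen P) (ultraGens h) := by
  classical
  apply le_antisymm
  · intro y hy
    obtain ⟨g, hg, hg0, rfl⟩ := exists_vec_eq hP y
    obtain ⟨b, hb, hdec⟩ := hh.exists_cut_decomposition hP hg hg0 hy
    have h1 : ∀ η : Pair n, ∃ r : ℚ, 0 ≤ r ∧ (r ≠ 0 → Sum.inl η ∈ ultraGens h) ∧
        g η.1.1 η.1.2 = r + ∑ C with IsCluster h C, b C * cut C η.1.1 η.1.2 := by
      intro η
      by_cases h2 : η.1.1 = 0
      · refine ⟨0, le_rfl, fun h => absurd rfl h, ?_⟩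
        rw [h2, hg0, zero_add, Finset.sum_eq_zero]
        intro C _
        simp [cut]
      · obtain ⟨r, hr, hr', hgr⟩ := hdec _ _ h2 η.snd_ne_zero η.2.ne
        refine ⟨r, hr, fun h3 => Or.inl ⟨η, Or.inr ⟨h2, ?_⟩, rfl⟩, hgr⟩
        by_contra h4
        exact h3 (hr' (not_lt.1 h4))
    choose r hr hr' hgr using h1
    have h2 : vec P g = ∑ η, r η • P.col η + ∑ C with IsCluster h C, b C • vec P (cut C) := by
      simp only [vec, hgr, add_smul, Finset.sum_add_distrib, Finset.sum_smul, Finset.smul_sum,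
        mul_smul]
      rw [Finset.sum_comm]
    rw [h2]
    refine Submodule.add_mem _ (Submodule.sum_mem _ fun η _ => ?_)
      (Submodule.sum_mem _ fun C hC => ?_)
    · by_cases h3 : r η = 0
      · simp [h3]
      · exact PointedCone.smul_mem _ (hr η) (mem_cone (v := gen P) (hr' η h3))
    · have hC' := (Finset.mem_filter.1 hC).2
      exact PointedCone.smul_mem _ (hb C hC') (hC'.vec_cut_mem_cone hn hP hh)
  · refine Submodule.span_le.2 ?_
    rintro _ ⟨_, ⟨η, ⟨h0, hneg, -⟩ | ⟨h0, hpos⟩, rfl⟩ | ⟨R, ⟨C, hC, hCR⟩, rfl⟩, rfl⟩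
    · have h2 : η.1.2 ≠ 0 := η.snd_ne_zero
      have h3 : IsNode h {η.1.2} := by
        refine ⟨by simpa using h2.symm, ⟨_, Finset.mem_singleton_self _⟩, ?_, ?_⟩
        · intro i hi k hk hk0
          rw [Finset.mem_singleton] at hi hk
          rw [hi]
          exact hneg k hk0 hk
        · intro i _ k _ _ i' hi' j' hj' hij
          rw [Finset.mem_singleton] at hi' hj'
          exact absurd (hi'.trans hj'.symm) hij
      have h4 := h3.vec_cut_mem_gkzCone hP hh
      have h5 := vec_cut_singleton hP ⟨η.1.2, h2⟩
      rw [h5] at h4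
      have h6 : zeroPair ⟨η.1.2, h2⟩ = η := Subtype.ext (Prod.ext h0.symm rfl)
      rw [h6] at h4
      exact h4
    · exact hh.col_mem_gkzCone hP h0 hpos
    · have h1 : gen P (Sum.inr R) = vec P (cut C) := by
        change nuVec P R = _
        rw [nuVec_eq, vec_block hP R.zero_notMem_side]
        rcases hCR with hCR | hCR
        · have h2 : C = R.side := by
            ext i
            by_cases hi : i = 0
            · simp [hi, R.zero_notMem_side, hC.1.zero_notMem]
            · exact hCR i hi
          rw [h2]
        · rw [cut_compl hCR]
      rw [h1]
      exact hC.1.vec_cut_mem_gkzCone hP hh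

end UltraCone

/-! ### The cone of an ultrametric in the iterated stellar subdivision -/

section Membership

variable {n m : ℕ} {h : Fin (n + 1) → Fin (n + 1) → ℚ}

/-- The pairs `η ⊆ {0} ∪ A_R`; these are the indices of the generators of the cone `σ_R`. -/
def carrier (R : TrueTwoBlock n) : Set (Pair n) :=
  {η | η.elems ⊆ insert 0 (R.block.image Subtype.val)}

theorem mem_carrier {R : TrueTwoBlock n} {η : Pair n} :
    η ∈ carrier R ↔ (η.1.1 = 0 ∨ η.1.1 ∈ R.side) ∧ η.1.2 ∈ R.side := by
  have h2 : η ∈ carrier R ↔ η.elems ⊆ insert 0 R.side := Iff.rfl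
  rw [h2, Pair.elems, Finset.insert_subset_iff, Finset.singleton_subset_iff, Finset.mem_insert,
    Finset.mem_insert, or_iff_right η.snd_ne_zero]

theorem carrier_mono {R S : TrueTwoBlock n} (h : R.side ⊆ S.side) : carrier R ⊆ carrier S := by
  intro η hη
  rw [mem_carrier] at hη ⊢
  exact ⟨hη.1.imp_right fun h1 => h h1, h hη.2⟩

/-- Clusters induce compatible splits, so that the blocks not containing `1` are nested or
disjoint. -/
theorem IsSplit.subset_or_subset_or_disjoint (hn : 2 ≤ n) {A B : Finset (Fin (n + 1))}
    (hA : IsSplit h A) (hB : IsSplit h B) (hA0 : 0 ∉ A) (hB0 : 0 ∉ B) (hA1 : 1 ∉ A) (hB1 : 1 ∉ B) :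
    A ⊆ B ∨ B ⊆ A ∨ ∀ i ∈ A, i ∉ B := by
  have h10 := one_ne_zero_of_two_le hn
  by_contra! hc
  obtain ⟨h1, h2, i, hiA, hiB⟩ := hc
  obtain ⟨j, hjA, hjB⟩ := Finset.not_subset.1 h1
  obtain ⟨k, hkB, hkA⟩ := Finset.not_subset.1 h2
  have hi0 : i ≠ 0 := fun h => hA0 (h ▸ hiA)
  have hj0 : j ≠ 0 := fun h => hA0 (h ▸ hjA)
  have hk0 : k ≠ 0 := fun h => hB0 (h ▸ hkB)
  obtain ⟨C, hC, hCA⟩ := hA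
  obtain ⟨D, hD, hDB⟩ := hB
  rcases hC.1.subset_or_subset_or_disjoint hD.1 with h3 | h3 | h3
  all_goals
    rcases hCA with hCA | hCA <;> rcases hDB with hDB | hDB <;>
      grind

/-- No carrier of a ray `ν_R` is covered by the `v_η` that generate the cone of an ultrametric
together with those carriers of generators `ν_S` that do not contain it. -/
theorem IsUltra.exists_mem_carrier (hn : 2 ≤ n) (hh : IsUltra h) (R : TrueTwoBlock n) :
    ∃ η ∈ carrier R, Sum.inl η ∉ ultraGens h ∧
      ∀ S : TrueTwoBlock n, IsSplit h S.side → η ∈ carrier S → R.side ⊆ S.side := by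
  classical
  by_contra! hc
  have hR0 : ∀ i ∈ R.side, i ≠ 0 := fun i hi h => R.zero_notMem_side (h ▸ hi)
  have hpos : ∀ η : Pair n, η.1.1 ≠ 0 → Sum.inl η ∈ ultraGens h → 0 < h η.1.1 η.1.2 := by
    rintro η h0 (⟨_, ⟨h1, -⟩ | h1, he⟩ | ⟨_, -, he⟩)
    · cases he
      exact absurd h1 h0
    · cases he
      exact h1.2
    · cases he
  have hpair : ∀ i ∈ R.side, ∀ k ∈ R.side, i ≠ k → 0 < h i k ∨ ∃ S : TrueTwoBlock n,
      IsSplit h S.side ∧ i ∈ S.side ∧ k ∈ S.side ∧ ¬ R.side ⊆ S.side := by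
    have key : ∀ η : Pair n, η.1.1 ∈ R.side → η.1.2 ∈ R.side → 0 < h η.1.1 η.1.2 ∨
        ∃ S : TrueTwoBlock n, IsSplit h S.side ∧ η.1.1 ∈ S.side ∧ η.1.2 ∈ S.side ∧
          ¬ R.side ⊆ S.side := by
      intro η h1 h2
      by_cases h3 : Sum.inl η ∈ ultraGens h
      · exact Or.inl (hpos η (hR0 _ h1) h3)
      · obtain ⟨S, hS, hηS, hRS⟩ := hc η (mem_carrier.2 ⟨Or.inr h1, h2⟩) h3
        rw [mem_carrier, or_iff_right (hR0 _ h1)] at hηS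
        exact Or.inr ⟨S, hS, hηS.1, hηS.2, hRS⟩
    intro i hi k hk hik
    rcases lt_or_gt_of_ne hik with h1 | h1
    · exact key ⟨(i, k), h1⟩ hi hk
    · rw [hh.symm]
      rcases key ⟨(k, i), h1⟩ hk hi with h2 | ⟨S, h2, h3, h4, h5⟩
      · exact Or.inl h2
      · exact Or.inr ⟨S, h2, h4, h3, h5⟩
  -- a maximal block that meets `R.side` without containing it leaves some pair uncovered
  by_cases hex : ∃ S : TrueTwoBlock n, IsSplit h S.side ∧ ¬ R.side ⊆ S.side ∧
      ∃ i ∈ R.side, i ∈ S.side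
  · obtain ⟨S, ⟨hS, hRS, i, hiR, hiS⟩, hmax⟩ := Set.exists_max_image
      {S : TrueTwoBlock n | IsSplit h S.side ∧ ¬ R.side ⊆ S.side ∧ ∃ i ∈ R.side, i ∈ S.side}
      (fun S => S.side.card) (Set.toFinite _) hex
    obtain ⟨k, hkR, hkS⟩ := Finset.not_subset.1 hRS
    rcases hpair i hiR k hkR fun h => hkS (h ▸ hiS) with h1 | ⟨S', hS', hi', hk', hRS'⟩
    · exact absurd h1 (hS.neg hh hiS (hR0 i hiR) hkS (hR0 k hkR)).not_gt
    · rcases hS.subset_or_subset_or_disjoint hn hS' S.zero_notMem_side S'.zero_notMem_side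
        (S.one_notMem_side hn) (S'.one_notMem_side hn) with h2 | h2 | h2
      · exact absurd (hmax S' ⟨hS', hRS', i, hiR, hi'⟩)
          (not_le.2 (Finset.card_lt_card ⟨h2, fun h3 => hkS (h3 hk')⟩))
      · exact hkS (h2 hk')
      · exact h2 i hiS hi'
  · push Not at hex
    obtain ⟨i, hi, hi0⟩ := R.exists_ne_mem_side hn 0
    obtain ⟨k, hk, hki⟩ := R.exists_ne_mem_side hn i
    have h1 : 0 < h i k := by
      rcases hpair i hi k hk hki.symm with h1 | ⟨S, hS, hiS, -, hRS⟩
      · exact h1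
      · exact absurd hiS (hex S hS hRS i hi)
    obtain ⟨S, hS, hηS, hRS⟩ := hc (zeroPair ⟨i, hi0⟩) (mem_carrier.2 ⟨Or.inl rfl, hi⟩) (by
      rintro (⟨_, ⟨-, h2, -⟩ | ⟨h2, -⟩, he⟩ | ⟨_, -, he⟩)
      · cases he
        exact absurd h1 (h2 k (hR0 k hk) hki).not_gt
      · cases he
        exact h2 rfl
      · cases he)
    exact hex S hS hRS i hi (mem_carrier.1 hηS).2

/-- The `v_η` that generate the cone of an ultrametric and the carriers of the generators `ν_R` lie
in a common cone of `Σ_1`. -/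
theorem IsUltra.mem_envelopingSets (hn : 2 ≤ n) (K : Type*) [Field K] (hh : IsUltra h) :
    {η | Sum.inl η ∈ ultraGens h ∨ ∃ R : TrueTwoBlock n, IsSplit h R.side ∧ η ∈ carrier R}ᶜ ∈
      envelopingSets K n := by
  classical
  have h10 := one_ne_zero_of_two_le hn
  -- a case distinction for the pairs in question
  have cases_mem : ∀ η : Pair n,
      (Sum.inl η ∈ ultraGens h ∨ ∃ R : TrueTwoBlock n, IsSplit h R.side ∧ η ∈ carrier R) →
      (η.1.1 = 0 ∧ (∀ k, k ≠ 0 → k ≠ η.1.2 → h η.1.2 k < 0) ∧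
        (η.1.2 = 1 ∨ ∃ k, k ≠ 0 ∧ k ≠ 1 ∧ k ≠ η.1.2)) ∨ (η.1.1 ≠ 0 ∧ 0 < h η.1.1 η.1.2) ∨
      ∃ R : TrueTwoBlock n, IsSplit h R.side ∧ (η.1.1 = 0 ∨ η.1.1 ∈ R.side) ∧ η.1.2 ∈ R.side := by
    rintro η ((⟨_, h1 | h1, he⟩ | ⟨_, -, he⟩) | ⟨R, hR, hη⟩)
    · cases he
      exact Or.inl h1
    · cases he
      exact Or.inr (Or.inl h1)
    · cases he
    · exact Or.inr (Or.inr ⟨R, hR, mem_carrier.1 hη⟩)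
  by_cases case1 : ∃ k, k ≠ 0 ∧ k ≠ 1 ∧ 0 ≤ h 1 k
  · obtain ⟨k₀, hk₀0, hk₀1, hk₀⟩ := case1
    refine cut_mem_envelopingSets hn K {k | k = 0 ∨ k ≠ 1 ∧ h 1 k < 0} (Or.inl rfl)
      (Or.inr ⟨fun hc => hc.elim h10 fun hc => hc.1 rfl, k₀, hk₀1,
        fun hc => hc.elim hk₀0 fun hc => hk₀.not_gt hc.2⟩) fun η hη => ?_
    have hη0 := η.snd_ne_zero
    rcases cases_mem η hη with ⟨h0, hneg, -⟩ | ⟨h0, hpos⟩ | ⟨R, hR, h1, h2⟩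
    · refine iff_of_true (Or.inl h0) (Or.inr ⟨?_, ?_⟩)
      · intro h1
        rw [h1] at hneg
        exact hk₀.not_gt (hneg k₀ hk₀0 hk₀1)
      · rw [hh.symm]
        refine hneg 1 h10 fun h1 => ?_
        rw [← h1] at hneg
        exact hk₀.not_gt (hneg k₀ hk₀0 hk₀1)
    · by_cases h1 : η.1.1 = 1
      · rw [h1] at hpos
        refine iff_of_false (fun hc => hc.elim h0 fun hc => hc.1 h1)
          (fun hc => hc.elim hη0 fun hc => hpos.not_gt hc.2)
      by_cases h2 : η.1.2 = 1
      · rw [h2, hh.symm] at hpos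
        refine iff_of_false (fun hc => hc.elim h0 fun hc => hpos.not_gt hc.2)
          (fun hc => hc.elim hη0 fun hc => hc.1 h2)
      have h3 := hh.ultra 1 η.1.1 η.1.2 h10 h0 hη0 (Ne.symm h1) η.2.ne (Ne.symm h2)
      have h4 := hh.ultra 1 η.1.2 η.1.1 h10 hη0 h0 (Ne.symm h2) η.2.ne' (Ne.symm h1)
      rw [hh.symm η.1.2] at h4
      simp only [Set.mem_ofPred_eq, h0, h1, h2, hη0, false_or, ne_eq, not_false_eq_true, true_and]
      constructor
      · intro h5
        exact (min_le_iff.1 h4).elim (fun h => h.trans_lt h5) fun h => by linarith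
      · intro h5
        exact (min_le_iff.1 h3).elim (fun h => h.trans_lt h5) fun h => by linarith
    · have key : ∀ i ∈ R.side, i ≠ 1 ∧ h 1 i < 0 := by
        intro i hi
        refine ⟨fun h => R.one_notMem_side hn (h ▸ hi), ?_⟩
        rw [hh.symm]
        exact hR.neg hh hi (fun h => R.zero_notMem_side (h ▸ hi)) (R.one_notMem_side hn) h10
      exact iff_of_true (h1.imp_right (key _)) (Or.inr (key _ h2))
  push Not at case1
  have hpos1 : ∀ η : Pair n, η.1.1 ≠ 0 → 0 < h η.1.1 η.1.2 → η.1.1 ≠ 1 ∧ η.1.2 ≠ 1 := by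
    intro η h0 hpos
    constructor
    · intro h1
      rw [h1] at hpos
      exact hpos.not_gt (case1 _ η.snd_ne_zero fun h2 => η.2.ne (h1.trans h2.symm))
    · intro h2
      rw [h2, hh.symm] at hpos
      exact hpos.not_gt (case1 _ h0 fun h1 => η.2.ne (h1.trans h2.symm))
  by_cases case2 : ∀ j k, j ≠ 0 → j ≠ 1 → k ≠ 0 → k ≠ 1 → j ≠ k → 0 ≤ h j k
  · refine cut_mem_envelopingSets hn K {0, 1} (Or.inl rfl) (Or.inl rfl) fun η hη => ?_
    simp only [Set.mem_insert_iff, Set.mem_singleton_iff]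
    rcases cases_mem η hη with ⟨h0, hneg, h1 | ⟨k, hk0, hk1, hk⟩⟩ | ⟨h0, hpos⟩ | ⟨R, hR, h1, h2⟩
    · exact iff_of_true (Or.inl h0) (Or.inr h1)
    · refine iff_of_true (Or.inl h0) (Or.inr ?_)
      by_contra h1
      exact (hneg k hk0 hk).not_ge (case2 _ _ η.snd_ne_zero h1 hk0 hk1 hk.symm)
    · have h1 := hpos1 η h0 hpos
      exact iff_of_false (by simp [h0, h1.1]) (by simp [η.snd_ne_zero, h1.2])
    · obtain ⟨k, hk0, hk1, hk⟩ := R.exists_notMem_side hn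
      exact absurd (hR.neg hh h2 η.snd_ne_zero hk hk0) (not_lt.2 (case2 _ _ η.snd_ne_zero
        (fun h => R.one_notMem_side hn (h ▸ h2)) hk0 hk1 fun h => hk (h ▸ h2)))
  push Not at case2
  by_cases case3 : ∃ R : TrueTwoBlock n, IsSplit h R.side
  · -- the block is chosen maximal, so that all other blocks are contained in it or disjoint from it
    obtain ⟨R, hR, hmax⟩ := Set.exists_max_image {R : TrueTwoBlock n | IsSplit h R.side}
      (fun R => R.side.card) (Set.toFinite _) case3
    obtain ⟨b, hb, -⟩ := R.exists_ne_mem_side hn 0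
    refine tripartition_mem_envelopingSets hn K R.side R.zero_notMem_side (R.one_notMem_side hn)
      ⟨b, hb⟩ (R.exists_notMem_side hn) fun η hη => ?_
    rcases cases_mem η hη with ⟨h0, -⟩ | ⟨h0, hpos⟩ | ⟨S, hS, h0 | h1, h2⟩
    · exact Or.inl h0
    · have h1 := hpos1 η h0 hpos
      refine Or.inr ⟨h1.1, h1.2, ?_⟩
      by_contra hc
      by_cases h2 : η.1.1 ∈ R.side
      · exact hpos.not_gt (hR.neg hh h2 h0 (fun h3 => hc (iff_of_true h2 h3)) η.snd_ne_zero)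
      · rw [hh.symm] at hpos
        refine hpos.not_gt (hR.neg hh ?_ η.snd_ne_zero h2 h0)
        by_contra h3
        exact hc (iff_of_false h2 h3)
    · exact Or.inl h0
    · refine Or.inr ⟨fun h => S.one_notMem_side hn (h ▸ h1), fun h => S.one_notMem_side hn (h ▸ h2),
        ?_⟩
      rcases hS.subset_or_subset_or_disjoint hn hR S.zero_notMem_side R.zero_notMem_side
        (S.one_notMem_side hn) (R.one_notMem_side hn) with h3 | h3 | h3
      · exact iff_of_true (h3 h1) (h3 h2)
      · rw [Finset.eq_of_subset_of_card_le h3 (hmax S hS)]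
        exact iff_of_true h1 h2
      · exact iff_of_false (h3 _ h1) (h3 _ h2)
  · obtain ⟨p, q, hp0, hp1, hq0, hq1, hpq, hneg⟩ := case2
    refine tripartition_mem_envelopingSets hn K {k | k ≠ 0 ∧ k ≠ 1 ∧ (k = p ∨ 0 < h p k)}
      (fun hc => hc.1 rfl) (fun hc => hc.2.1 rfl) ⟨p, hp0, hp1, Or.inl rfl⟩
      ⟨q, hq0, hq1, fun hc => hc.2.2.elim (fun h => hpq h.symm) hneg.not_gt⟩ fun η hη => ?_
    rcases cases_mem η hη with ⟨h0, -⟩ | ⟨h0, hpos⟩ | ⟨R, hR, -⟩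
    · exact Or.inl h0
    · have h1 := hpos1 η h0 hpos
      refine Or.inr ⟨h1.1, h1.2, ?_⟩
      have key : ∀ i j, i ≠ 0 → j ≠ 0 → i ≠ j → 0 < h i j → (i = p ∨ 0 < h p i) →
          j = p ∨ 0 < h p j := by
        rintro i j hi hj hij hpos (rfl | h2)
        · exact Or.inr hpos
        · by_cases h3 : j = p
          · exact Or.inl h3
          · by_cases h4 : i = p
            · exact Or.inr (h4 ▸ hpos)
            · exact Or.inr ((lt_min h2 hpos).trans_le
                (hh.ultra p i j hp0 hi hj (Ne.symm h4) hij (Ne.symm h3)))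
      simp only [Set.mem_ofPred_eq, ne_eq, h0, h1.1, h1.2, η.snd_ne_zero, not_false_eq_true,
        true_and]
      exact ⟨key _ _ h0 η.snd_ne_zero η.2.ne hpos,
        key _ _ η.snd_ne_zero h0 η.2.ne' (by rwa [hh.symm])⟩
    · exact absurd ⟨R, hR⟩ case3

end Membership

section Subdivision

variable {n m : ℕ}

theorem IsSimplicial.image_inl {V E E' : Type*} [AddCommGroup V] [Module ℚ V] [Fintype E]
    [Fintype E'] {r : E → V} {𝒮 : Set (Set E)} (h : IsSimplicial r 𝒮) (r' : E' → V) :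
    IsSimplicial (Sum.elim r r') {S | ∃ S' ∈ 𝒮, S = Sum.inl '' S'} := by
  constructor
  · rintro _ ⟨S, hS, rfl⟩ T hT
    obtain ⟨T, hTS, rfl⟩ := Set.subset_image_iff.1 hT
    exact ⟨T, h.mono S hS T hTS, rfl⟩
  · rintro _ ⟨S, hS, rfl⟩ _ ⟨T, hT, rfl⟩ a b ha ha' hb hb' hab
    have ha2 : ∀ j, a (Sum.inr j) = 0 := fun j => ha' _ (by simp)
    have hb2 : ∀ j, b (Sum.inr j) = 0 := fun j => hb' _ (by simp)
    simp only [Fintype.sum_sum_type, Sum.elim_inl, Sum.elim_inr, ha2, hb2, zero_smul,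
      Finset.sum_const_zero, add_zero] at hab
    have h1 := h.unique S hS T hT (fun i => a (Sum.inl i)) (fun i => b (Sum.inl i))
      (fun i => ha _) (fun i hi => ha' _ (by simpa using hi)) (fun i => hb _)
      (fun i hi => hb' _ (by simpa using hi)) hab
    funext i
    rcases i with i | j
    · exact congrFun h1 i
    · rw [ha2, hb2]

theorem cone_image_inl {V E E' : Type*} [AddCommGroup V] [Module ℚ V] (r : E → V) (r' : E' → V)
    (S : Set E) : cone (Sum.elim r r') (Sum.inl '' S) = cone r S := by
  rw [cone, cone, Set.image_image]
  rfl

/-- The carriers form simplices of the complex underlying `Σ_1`. -/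
theorem compl_carrier_mem_envelopingSets (hn : 2 ≤ n) (K : Type*) [Field K] (R : TrueTwoBlock n) :
    (carrier R)ᶜ ∈ envelopingSets K n := by
  obtain ⟨k, hk0, hk1, hk⟩ := R.exists_notMem_side hn
  refine cut_mem_envelopingSets hn K {i | i = 0 ∨ i ∈ R.side} (Or.inl rfl)
    (Or.inr ⟨fun hc => hc.elim (one_ne_zero_of_two_le hn) (R.one_notMem_side hn), k, hk1,
      fun hc => hc.elim hk0 hk⟩) fun η hη => ?_
  rw [mem_carrier] at hη
  exact iff_of_true hη.1 (Or.inr hη.2)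

/-- In a descending list, no carrier is contained in a later one: an inclusion of carriers makes
`σ_R` a face of `σ_S`, as `Σ_1` is simplicial. -/
theorem IsDescending.pairwise_carrier (hn : 2 ≤ n) (K : Type*) [Field K]
    {P : Matrix (Fin m) (Pair n) ℚ} (hP : IsGaleDual (weightMatrix n) P)
    {L : List (TrueTwoBlock n)} (hL : IsDescending P L) : L.Pairwise fun R S =>
      ¬ (Sum.inl '' carrier R : Set (Pair n ⊕ TrueTwoBlock n)) ⊆ Sum.inl '' carrier S := by
  refine hL.descending.imp fun {R S} hRS hc => hRS ?_
  refine (isSimplicial_envelopingSets hn K hP).isFaceOf_cone (T := carrier R) (S := carrier S)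
    (compl_carrier_mem_envelopingSets hn K S) ?_
  exact (Set.image_subset_image_iff Sum.inl_injective).1 hc

/-- The complex underlying the fan `Σ_r`: the iterated stellar subdivision of the complex of
complements of enveloping sets. -/
def complexR (K : Type*) [Field K] (L : List (TrueTwoBlock n)) :
    Set (Set (Pair n ⊕ TrueTwoBlock n)) :=
  L.foldl (fun 𝒮 R => stellarComplex 𝒮 (Sum.inl '' carrier R) (Sum.inr R))
    {S | ∃ S' ∈ {S | Sᶜ ∈ envelopingSets K n}, S = Sum.inl '' S'}

theorem isSimplicial_complexR (hn : 2 ≤ n) (K : Type*) [Field K] {P : Matrix (Fin m) (Pair n) ℚ}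
    (hP : IsGaleDual (weightMatrix n) P) {L : List (TrueTwoBlock n)} (hL : IsDescending P L) :
    IsSimplicial (gen P) (complexR K L) ∧ sigmaR K P L = fanOf (gen P) (complexR K L) := by
  classical
  have h1 := isSimplicial_envelopingSets hn K hP
  have h2 : fanOf (gen P) {S | ∃ S' ∈ {S | Sᶜ ∈ envelopingSets K n}, S = Sum.inl '' S'} =
      sigmaOne K P := by
    ext σ
    constructor
    · rintro ⟨_, ⟨S, hS, rfl⟩, rfl⟩
      exact ⟨Sᶜ, hS, by rw [compl_compl]; exact cone_image_inl _ _ _⟩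
    · rintro ⟨I, hI, rfl⟩
      exact ⟨_, ⟨Iᶜ, by rwa [Set.mem_ofPred_eq, compl_compl], rfl⟩, (cone_image_inl _ _ _).symm⟩
  have h3 := IsSimplicial.foldl_stellar (r := gen P) (T := fun R => Sum.inl '' carrier R)
    (e := fun R : TrueTwoBlock n => Sum.inr R) Sum.inr_injective
    (fun R => Sum.elim (fun η => block R.side η.1.1 η.1.2) fun _ => 0) ?_ ?_ ?_ L hL.nodup ?_
    _ (h1.image_inl (nuVec P)) ?_ ?_
  · refine ⟨h3.1, ?_⟩
    rw [sigmaR, ← h2]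
    exact h3.2
  · rintro R _ ⟨η, hη, rfl⟩
    obtain ⟨h4, h5⟩ := mem_carrier.1 hη
    by_cases h6 : η.1.1 = 0
    · simp [block, h6, h5]
    · simp [block, h6, h5, h4.resolve_left h6, η.snd_ne_zero]
  · rintro R (η | S) hη
    · have h4 : ¬ ((η.1.1 = 0 ∨ η.1.1 ∈ R.side) ∧ η.1.2 ∈ R.side) := by
        rw [← mem_carrier]
        exact fun h => hη ⟨η, h, rfl⟩
      by_cases h6 : η.1.1 = 0
      · simp_all [block, R.zero_notMem_side]
      · simp_all [block, η.snd_ne_zero]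
    · rfl
  · intro R
    change nuVec P R = _
    rw [nuVec_eq, Fintype.sum_sum_type]
    simp [vec, gen]
  · exact hL.pairwise_carrier hn K hP
  · exact fun R _ => ⟨carrier R, compl_carrier_mem_envelopingSets hn K R, rfl⟩
  · rintro R _ _ ⟨S, -, rfl⟩ ⟨_, -, h4⟩
    cases h4

/-- The cone of an ultrametric is a cone of `Σ_r`. -/
theorem IsUltra.ultraGens_mem_complexR (hn : 2 ≤ n) (K : Type*) [Field K]
    {P : Matrix (Fin m) (Pair n) ℚ} (hP : IsGaleDual (weightMatrix n) P)
    {L : List (TrueTwoBlock n)} (hL : IsDescending P L) {h : Fin (n + 1) → Fin (n + 1) → ℚ}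
    (hh : IsUltra h) : ultraGens h ∈ complexR K L := by
  have h1 := isSimplicial_envelopingSets hn K hP
  have hsplit : ∀ R : TrueTwoBlock n, Sum.inr R ∈ ultraGens h ↔ IsSplit h R.side := by
    intro R
    constructor
    · rintro (⟨_, -, h2⟩ | ⟨_, h2, h3⟩)
      · cases h2
      · cases h3
        exact h2
    · exact fun h2 => Or.inr ⟨R, h2, rfl⟩
  refine mem_foldl_stellarComplex Sum.inr_injective ?_ L hL.nodup ?_ _ ?_ _
    (h1.image_inl (nuVec P)).mono ?_
  · rintro R S ⟨_, -, h2⟩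
    cases h2
  · exact hL.pairwise_carrier hn K hP
  · intro R _
    obtain ⟨η, hη, h2, h3⟩ := hh.exists_mem_carrier hn R
    refine ⟨Sum.inl η, ⟨η, hη, rfl⟩, h2, fun S hS hηS => ?_⟩
    obtain ⟨_, h4, h5⟩ := hηS
    cases h5
    exact Set.image_mono (carrier_mono (h3 S ((hsplit S).1 hS) h4))
  · refine ⟨_, ⟨_, hh.mem_envelopingSets hn K, rfl⟩, ?_, ?_⟩
    · rintro (η | R) ht ht'
      · exact ⟨η, Or.inl ht, rfl⟩
      · exact absurd rfl (ht' R (hL.complete R))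
    · exact fun R _ hR => Set.image_mono fun η hη => Or.inr ⟨R, (hsplit R).1 hR, hη⟩

end Subdivision

/-! ### The tropical variety -/

section Tropical

/-- If a trinomial vanishes on `Z`, then none of its monomials is the only one of minimal weight. -/
theorem exists_weight_le_of_mem_tropicalVariety {K : Type*} [Field K] {ι : Type*} [Fintype ι]
    {Z : Set (ι → K)} {w : ι → ℚ} (hw : w ∈ tropicalVariety Z) {p q r : ι →₀ ℕ} (hpq : p ≠ q)
    (hpr : p ≠ r) (hqr : q ≠ r) (hZ : ∀ z ∈ Z, MvPolynomial.eval z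
      (MvPolynomial.monomial p 1 - MvPolynomial.monomial q 1 + MvPolynomial.monomial r 1) = 0)
    {a : ι →₀ ℕ} (ha : a = p ∨ a = q ∨ a = r) : ∃ b, b ≠ a ∧ (b = p ∨ b = q ∨ b = r) ∧
      ∑ i, (b i : ℚ) * w i ≤ ∑ i, (a i : ℚ) * w i := by
  classical
  set f : MvPolynomial ι K :=
    MvPolynomial.monomial p 1 - MvPolynomial.monomial q 1 + MvPolynomial.monomial r 1
  have hf : ∀ b, b ∈ f.support ↔ b = p ∨ b = q ∨ b = r := by
    intro b
    simp only [f, MvPolynomial.mem_support_iff, MvPolynomial.coeff_add, MvPolynomial.coeff_sub,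
      MvPolynomial.coeff_monomial, eq_comm (b := b)]
    by_cases h1 : b = p
    · subst h1
      simp [hpq, hpr]
    by_cases h2 : b = q
    · subst h2
      simp [hpq.symm, hqr]
    by_cases h3 : b = r
    · subst h3
      simp [hpr.symm, hqr.symm]
    · simp [h1, h2, h3]
  obtain ⟨b, hb, hmin⟩ := Finset.exists_min_image f.support (fun b => ∑ i, (b i : ℚ) * w i)
    ⟨a, (hf a).2 ha⟩
  by_cases hab : b = a
  · subst hab
    obtain ⟨c, hc, hcb, hcw⟩ := hw f hZ b hb hmin
    exact ⟨c, hcb, (hf c).1 hc, hcw.le⟩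
  · exact ⟨b, hab, (hf b).1 hb, hmin a ((hf a).2 ha)⟩

variable {n m : ℕ}

/-- The tropical relations given by the Plücker relations between the coordinates with indices in
`{0, a, b, c}`. -/
theorem plucker_relation {K : Type*} [Field K] {w : Pair n → ℚ}
    (hw : w ∈ tropicalVariety (grassmannCone K n ∩ torus K (Pair n)))
    {W : Fin (n + 1) → Fin (n + 1) → ℚ} (hW : ∀ η : Pair n, W η.1.1 η.1.2 = w η)
    {a b c : Fin (n + 1)} (ha : 0 < a) (hab : a < b) (hbc : b < c) :
    min (W 0 b + W a c) (W 0 c + W a b) ≤ W 0 a + W b c ∧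
    min (W 0 a + W b c) (W 0 c + W a b) ≤ W 0 b + W a c ∧
    min (W 0 a + W b c) (W 0 b + W a c) ≤ W 0 c + W a b := by
  classical
  let e₁ : Pair n := ⟨(0, a), ha⟩
  let e₂ : Pair n := ⟨(0, b), ha.trans hab⟩
  let e₃ : Pair n := ⟨(0, c), (ha.trans hab).trans hbc⟩
  let f₁ : Pair n := ⟨(b, c), hbc⟩
  let f₂ : Pair n := ⟨(a, c), hab.trans hbc⟩
  let f₃ : Pair n := ⟨(a, b), hab⟩
  have wt : ∀ e f : Pair n, ∑ i, (((Finsupp.single e 1 + Finsupp.single f 1 : Pair n →₀ ℕ) i : ℕ) :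
      ℚ) * w i = W e.1.1 e.1.2 + W f.1.1 f.1.2 := by
    intro e f
    simp [hW, Finsupp.single_apply, add_mul, Finset.sum_add_distrib]
  have ne : ∀ e f e' f' : Pair n, e ≠ e' → e ≠ f' →
      (Finsupp.single e 1 + Finsupp.single f 1 : Pair n →₀ ℕ) ≠
        Finsupp.single e' 1 + Finsupp.single f' 1 := by
    intro e f e' f' h1 h2 h
    have h3 := DFunLike.congr_fun h e
    simp [h1.symm, h2.symm] at h3
  have h12 : e₁ ≠ e₂ := fun h => hab.ne (congrArg (fun η : Pair n => η.1.2) h)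
  have h13 : e₁ ≠ e₃ := fun h => (hab.trans hbc).ne (congrArg (fun η : Pair n => η.1.2) h)
  have h23 : e₂ ≠ e₃ := fun h => hbc.ne (congrArg (fun η : Pair n => η.1.2) h)
  have hf : ∀ (i j k : Fin (n + 1)) (hi : 0 < i) (hjk : j < k), 0 < j →
      (⟨(0, i), hi⟩ : Pair n) ≠ ⟨(j, k), hjk⟩ :=
    fun i j k hi hjk hj h => hj.ne (congrArg (fun η : Pair n => η.1.1) h)
  have hpq := ne e₁ f₁ e₂ f₂ h12 (hf _ _ _ _ _ ha)
  have hpr := ne e₁ f₁ e₃ f₃ h13 (hf _ _ _ _ _ ha)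
  have hqr := ne e₂ f₂ e₃ f₃ h23 (hf _ _ _ _ _ ha)
  have key := fun {x} => exists_weight_le_of_mem_tropicalVariety hw hpq hpr hqr (a := x) (by
    rintro z ⟨⟨x, y, hz⟩, -⟩
    have mon : ∀ e f : Pair n, (MvPolynomial.monomial (Finsupp.single e 1 + Finsupp.single f 1) 1 :
        MvPolynomial (Pair n) K) = MvPolynomial.X e * MvPolynomial.X f := by
      intro e f
      rw [MvPolynomial.X, MvPolynomial.X, MvPolynomial.monomial_mul, one_mul]
    simp only [mon, map_add, map_sub, map_mul, MvPolynomial.eval_X, hz, e₁, e₂, e₃, f₁, f₂, f₃]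
    ring)
  refine ⟨?_, ?_, ?_⟩
  · obtain ⟨x, hx, rfl | rfl | rfl, hle⟩ := key (Or.inl rfl)
    · exact absurd rfl hx
    · rw [wt, wt] at hle
      exact min_le_of_left_le hle
    · rw [wt, wt] at hle
      exact min_le_of_right_le hle
  · obtain ⟨x, hx, rfl | rfl | rfl, hle⟩ := key (Or.inr (Or.inl rfl))
    · rw [wt, wt] at hle
      exact min_le_of_left_le hle
    · exact absurd rfl hx
    · rw [wt, wt] at hle
      exact min_le_of_right_le hle
  · obtain ⟨x, hx, rfl | rfl | rfl, hle⟩ := key (Or.inr (Or.inr rfl))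
    · rw [wt, wt] at hle
      exact min_le_of_left_le hle
    · rw [wt, wt] at hle
      exact min_le_of_right_le hle
    · exact absurd rfl hx

/-- Subtracting the potential `W 0 i` from a tropical point `W` makes it vanish at the pairs
containing `0`, and turns the Plücker relations into the ultrametric inequality. -/
theorem exists_isUltra_of_mem_tropicalImage {K : Type*} [Field K] {P : Matrix (Fin m) (Pair n) ℚ}
    (hP : IsGaleDual (weightMatrix n) P) {x : Fin m → ℚ} (hx : x ∈ tropicalImage K P) :
    ∃ h, IsUltra h ∧ vec P h = x := by
  classical
  obtain ⟨w, hw, rfl⟩ := hx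
  obtain ⟨W, hsymm, hW⟩ := exists_symm_eq w
  refine ⟨fun i j => if i = 0 ∨ j = 0 then 0 else W i j - W 0 i - W 0 j, ⟨fun i j => ?_,
    fun i => by simp, ?_⟩, ?_⟩
  · simp only [or_comm (a := i = 0), hsymm i j]
    split_ifs <;> ring
  · intro i j k hi hj hk hij hjk hik
    have key : min (W 0 k + W i j) (W 0 i + W j k) ≤ W 0 j + W i k := by
      have pl := fun {a b c : Fin (n + 1)} (ha : a ≠ 0) hab hbc =>
        plucker_relation hw hW (a := a) (b := b) (c := c) (Fin.pos_of_ne_zero ha) hab hbc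
      rcases lt_or_gt_of_ne hij with h1 | h1 <;> rcases lt_or_gt_of_ne hjk with h2 | h2
      · rw [min_comm]
        exact (pl hi h1 h2).2.1
      · rcases lt_or_gt_of_ne hik with h3 | h3
        · rw [min_comm, hsymm j k]
          exact (pl hi h3 h2).2.2
        · rw [hsymm j k, hsymm i k]
          exact (pl hk h3 h1).2.2
      · rcases lt_or_gt_of_ne hik with h3 | h3
        · rw [hsymm i j, min_comm]
          exact (pl hj h1 h3).1
        · rw [hsymm i j, hsymm i k]
          exact (pl hj h2 h3).1
      · rw [hsymm i j, hsymm j k, hsymm i k]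
        exact (pl hk h2 h1).2.1
    simp only [hi, hj, hk, or_self, if_false]
    rcases min_le_iff.1 key with h1 | h1
    · exact min_le_of_left_le (by linarith)
    · exact min_le_of_right_le (by linarith)
  · have h1 : P.mulVec w = vec P W := by
      rw [Matrix.mulVec_eq_sum, vec]
      exact Finset.sum_congr rfl fun η _ => by rw [hW, op_smul_eq_smul]; rfl
    rw [h1, vec_eq_vec_iff hP]
    refine ⟨fun i => if i = 0 then 0 else -W 0 i, by simp, fun η => ?_⟩
    have h2 := η.snd_ne_zero
    by_cases h3 : η.1.1 = 0
    · simp [h2, h3]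
    · simp only [h2, h3, or_self, if_false]
      ring

end Tropical

/-! ### The reduction is a subfan -/

section Reduction

variable {V : Type*} [AddCommGroup V] [Module ℚ V]

theorem IsFan.isSubfan_of_subset {F G : Set (PointedCone ℚ V)} (hG : IsFan G) (h : F ⊆ G)
    (hF : ∀ σ ∈ F, ∀ τ : PointedCone ℚ V, τ.IsFaceOf σ → τ ∈ F) : IsSubfan F G where
  isFan_left :=
    { finite := hG.finite.subset h
      polyhedral := fun σ hσ => hG.polyhedral σ (h hσ)
      pointed := fun σ hσ => hG.pointed σ (h hσ)
      face_mem := hF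
      inter_face := fun σ hσ τ hτ => hG.inter_face σ (h hσ) τ (h hτ) }
  isFan_right := hG
  subset := h

theorem isFan_of_subsingleton [Subsingleton V] (F : Set (PointedCone ℚ V)) : IsFan F where
  finite := Set.toFinite _
  polyhedral σ _ := by
    rw [Subsingleton.elim σ ⊥]
    exact Submodule.fg_bot
  pointed _ _ x _ _ := Subsingleton.elim x 0
  face_mem σ hσ τ _ := by rwa [Subsingleton.elim τ σ]
  inter_face σ _ τ _ := by
    rw [Subsingleton.elim τ σ, inf_idem]
    exact ⟨PointedCone.IsFaceOf.refl _, PointedCone.IsFaceOf.refl _⟩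

theorem deltaReduction_face_mem {F : Set (PointedCone ℚ V)} {Δ : Set V} {σ τ : PointedCone ℚ V}
    (hσ : σ ∈ deltaReduction F Δ) (hτ : τ.IsFaceOf σ) : τ ∈ deltaReduction F Δ := by
  obtain ⟨ρ, hρ, hσρ, h⟩ := hσ
  exact ⟨ρ, hρ, hτ.trans hσρ, h⟩

theorem isEmpty_trueTwoBlock_one : IsEmpty (TrueTwoBlock 1) := by
  constructor
  rintro ⟨R, hR, hcard⟩
  obtain ⟨A, hA⟩ := Finset.card_pos.1 (by omega : 0 < R.parts.card)
  have h1 := hcard A hA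
  have h2 := Finset.card_le_univ A
  rw [card_N] at h2
  omega

/-- For `n = 1`, the chamber `λ_1` is the origin, and the empty set is enveloping. -/
theorem empty_mem_envelopingSets_one (K : Type*) [Field K] : ∅ ∈ envelopingSets K 1 := by
  refine ⟨∅, Set.Subset.rfl, ⟨0, ⟨0, 0, by simp⟩, by simp⟩, ?_, Set.Subset.rfl⟩
  rintro x ⟨⟨h1, h2, -⟩, -⟩
  have h3 : ∀ i : N 1, i.1 = 1 := fun i => Fin.eq_one_of_ne_zero _ i.2
  have hx : x = 0 := by
    funext i
    refine le_antisymm ?_ (h1 i)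
    have h4 : ∀ j : N 1, x j ≤ ∑ k, x k := fun j =>
      Finset.single_le_sum (fun k _ => h1 k) (Finset.mem_univ j)
    simp only [formOne, h3, if_true] at h2
    exact (h4 i).trans h2
  have h4 : (omega ∅ : PointedCone ℚ (N 1 → ℚ)) = ⊥ := by simp [omega, cone]
  rw [hx, h4]
  exact ⟨Submodule.zero_mem _, fun y hy => ⟨1, one_pos, by simpa using hy⟩⟩

end Reduction

end ConfigFan

theorem mainTheorem4 (K : Type*) [Field K] [IsAlgClosed K] (n : ℕ) (hn : 1 ≤ n)
    (P : Matrix (Fin (n.choose 2)) (ConfigFan.Pair n) ℚ)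
    (hP : ConfigFan.IsGaleDual (ConfigFan.weightMatrix n) P)
    (L : List (ConfigFan.TrueTwoBlock n)) (hL : ConfigFan.IsDescending P L) :
    ConfigFan.IsSubfan
      (ConfigFan.deltaReduction (ConfigFan.gkzFan P.col) (ConfigFan.tropicalImage K P))
      (ConfigFan.sigmaR K P L) := by
  classical
  open ConfigFan in
  rcases hn.eq_or_lt with rfl | hn
  · -- for `n = 1`, all cones live in the zero space
    have : Subsingleton (Fin (Nat.choose 1 2) → ℚ) :=
      have : IsEmpty (Fin (Nat.choose 1 2)) := Fin.isEmpty'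
      inferInstance
    have hemp := isEmpty_trueTwoBlock_one
    have hL0 : L = [] := List.eq_nil_iff_forall_not_mem.2 fun R => hemp.elim R
    refine (isFan_of_subsingleton _).isSubfan_of_subset (fun σ _ => ?_)
      fun σ hσ τ hτ => deltaReduction_face_mem hσ hτ
    rw [hL0]
    exact ⟨∅, empty_mem_envelopingSets_one K, Subsingleton.elim _ _⟩
  · obtain ⟨h1, h2⟩ := isSimplicial_complexR hn K hP hL
    rw [h2]
    refine h1.isFan.isSubfan_of_subset ?_ fun σ hσ τ hτ => deltaReduction_face_mem hσ hτ
    rintro σ ⟨_, ⟨z, rfl⟩, hσ, x, hx, hxΔ⟩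
    obtain ⟨h, hh, rfl⟩ := exists_isUltra_of_mem_tropicalImage hP hxΔ
    rw [← gkzCone_eq_of_mem_relint (weightMatrix n) weightMatrix_nonneg exists_weightMatrix_pos
      hP.exists_sum_smul_col_eq hP.sum_smul_col_eq_zero_iff hx, hh.gkzCone_eq hn hP] at hσ
    exact h1.isFan.face_mem _ ⟨_, hh.ultraGens_mem_complexR hn K hP hL, rfl⟩ σ hσ
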